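/- **Setting.** Let $\mathbb F_v$ be a finite field with $q_v$ elements, $A_v=\mathbb F_v[[z]]$ and $Q_v=\mathbb F_v((z))$. Let $R$ be a complete discrete valuation ring with finite residue field and fraction field $L$ which is an $\mathbb F_v$-algebra, and let $\zeta\ne 0$ be an element of its maximal ideal. This gives $\gamma\colon A_v\hookrightarrow R$, $z\mapsto\zeta$, and $\gamma\colon Q_v\hookrightarrow L$. Let $\hat\sigma$ be the endomorphism of $R[[z]]$ (and of $L^{\rm sep}[[z]]$) with $\hat\sigma(z)=z$ and $\hat\sigma(b)=b^{q_v}$ on coefficients, and write $\hat\sigma^*\hat M:=\hat M\otimes_{R[[z]],\hat\sigma}R[[z]]$. A *local shtuka* $\underline{\hat M}=(\hat M,\tau)$ over $R$ is a free $R[[z]]$-module $\hat M$ of finite rank with an isomorphism $\tau\colon\hat\sigma^*\hat M[\frac1{z-\zeta}]\to\hat M[\frac1{z-\zeta}]$. $\mathrm{End}_R(\underline{\hat M})$ is the $A_v$-algebra of $R[[z]]$-endomorphisms $f$ of $\hat M$ with $\tau\circ\hat\sigma^*f=f\circ\tau$, and $\mathrm{QEnd}_R(\underline{\hat M}):=\mathrm{End}_R(\underline{\hat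 M})\otimes_{A_v}Q_v$. It has *complex multiplication* by a finite-dimensional commutative semi-simple $Q_v$-algebra $E_v$ (a finite product of finite field extensions $E_{v,i}$ of $Q_v$) if $E_v\subset\mathrm{QEnd}_R(\underline{\hat M})$ as $Q_v$-algebras and $\dim_{Q_v}E_v=\mathrm{rk}\,\hat M$. Put - $H^1_v(\underline{\hat M},A_v):=\{m\in\hat M\otimes_{R[[z]]}L^{\rm sep}[[z]]:\tau(\hat\sigma^*m)=m\}$ and $H^1_v(\underline{\hat M},Q_v):=H^1_v(\underline{\hat M},A_v)\otimes_{A_v}Q_v$; - $H^1_{\rm dR}(\underline{\hat M},L[[z-\zeta]]):=\hat\sigma^*\hat M\otimes_{R[[z]]}L[[z-\zeta]]$ with $z\mapsto\zeta+(z-\zeta)$, and for $B=R$ or $L$, $H^1_{\rm dR}(\underline{\hat M},B):=\hat\sigma^*\hat M\otimes_{R[[z]],\,z\mapsto\zeta}B$. An endomorphism $a$ acts on these de Rham realizations through $[a]^*:=\hat\sigma^*a\otimes\mathrm{id}$. **Proposition 3.6.** Let $\underline{\hat M}$ have complex multiplication by $E_v$. (a) $H^1_v(\underline{\hat M},Q_v)$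 is a free $E_v$-module of rank $1$. (b) $H^1_{\rm dR}(\underline{\hat M},L[[z-\zeta]])$ is a free $E_v\otimes_{Q_v}L[[z-\zeta]]$-module of rank $1$, where $Q_v\to L[[z-\zeta]]$ is given by $z\mapsto\zeta+(z-\zeta)$. Assume now that $\psi(E_v)\subset L$ for every $\psi\in H_{E_v}$, the set of $Q_v$-homomorphisms from $E_v$ to an algebraic closure of $L$. For $\psi\in H_{E_v}$ let $E_{v,i(\psi)}$ be the factor field of $E_v$ through which $\psi$ factors. (c) Let $y_\psi$ be a uniformizer of $E_{v,i(\psi)}$ for every $\psi$, and let $L[[y_\psi-\psi(y_\psi)]]$ be the power series ring over $L$ in a variable denoted $y_\psi-\psi(y_\psi)$. For each $\psi$ there is a unique $L$-algebra homomorphism $E_v\otimes_{Q_v}L[[z-\zeta]]\to L[[y_\psi-\psi(y_\psi)]]$ which on $E_v$ is congruent to $\psi$ modulo $y_\psi-\psi(y_\psi)$ and sends (every lift to $E_v$ of) $y_\psi$ to $\psi(y_\psi)+(y_\psi-\psi(y_\psi))$. Together they form an isomorphism $E_v\otimes_{Q_v}L[[z-\zeta]]\cong\prod_{\psi}L[[y_\psi-\psi(y_\psi)]]$,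 which induces a decomposition $$H^1_{\rm dR}(\underline{\hat M},L[[z-\zeta]])=\bigoplus_{\psi\in H_{E_v}}H^\psi(\underline{\hat M},L[[y_\psi-\psi(y_\psi)]]),$$ where $H^\psi(\underline{\hat M},L[[y_\psi-\psi(y_\psi)]]):=H^1_{\rm dR}(\underline{\hat M},L[[z-\zeta]])\otimes_{E_v\otimes L[[z-\zeta]]}L[[y_\psi-\psi(y_\psi)]]$ is free of rank $1$ over $L[[y_\psi-\psi(y_\psi)]]$. (d) For $a\in E_v\cap\mathrm{End}_R(\underline{\hat M})$ one has $\psi(a)\in R$. Let $$H^\psi(\underline{\hat M},R):=\{\omega\in H^1_{\rm dR}(\underline{\hat M},R):\text{for all }a\in E_v\cap\mathrm{End}_R(\underline{\hat M}),\ ([a]^*-\psi(a))^n\omega=0\text{ for }n\gg0\}.$$ Then $$H^1_{\rm dR}(\underline{\hat M},L)=\bigoplus_{\psi\in H_{E_v}}H^\psi(\underline{\hat M},R)\otimes_RL,$$ and this is the decomposition into generalized eigenspaces of the $E_v$-action, i.e. the image of $H^\psi(\underline{\hat M},R)\otimes_RL$ is $\{\omega\in H^1_{\rm dR}(\underline{\hat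 M},L):\text{for all }a\in E_v,\ (a-\psi(a))^n\omega=0\text{ for }n\gg0\}$. (e) $H^\psi(\underline{\hat M},R)$ is a free $R$-module of finite rank equal to the inseparability degree of $E_{v,i(\psi)}$ over $Q_v$. -/

import Mathlib

open scoped PowerSeries LaurentSeries TensorProduct

noncomputable section

/-- The base change `M ⊗_{A,f} B` of an `A`-module `M` along a ring homomorphism `f : A → B`. -/
def BaseChange {A B : Type*} [CommRing A] [CommRing B] (f : A →+* B)
    (M : Type*) [AddCommGroup M] [Module A M] : Type _ :=
  letI := f.toAlgebra
  B ⊗[A] M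

namespace BaseChange

section basic

variable {A B C : Type*} [CommRing A] [CommRing B] [CommRing C] (f : A →+* B)
  (M : Type*) [AddCommGroup M] [Module A M]

instance : AddCommGroup (BaseChange f M) :=
  letI := f.toAlgebra
  (TensorProduct.addCommGroup : AddCommGroup (B ⊗[A] M))

instance : Module B (BaseChange f M) :=
  letI := f.toAlgebra
  (TensorProduct.leftModule : Module B (B ⊗[A] M))

variable {M}

/-- The canonical `f`-semilinear map `m ↦ m ⊗ 1`. -/
def mk : M →ₛₗ[f] BaseChange f M :=
  letI := f.toAlgebra
  { toFun := fun m => (1 : B) ⊗ₜ[A] m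
    map_add' := fun x y => TensorProduct.tmul_add _ _ _
    map_smul' := fun a x => by
      change (1 : B) ⊗ₜ[A] (a • x) = f a • ((1 : B) ⊗ₜ[A] x)
      rw [TensorProduct.tmul_smul, TensorProduct.smul_tmul', TensorProduct.smul_tmul',
        Algebra.smul_def, smul_eq_mul]
      rfl }

theorem induction {p : BaseChange f M → Prop} (h : ∀ (b : B) (m : M), p (b • mk f m))
    (hadd : ∀ x y, p x → p y → p (x + y)) (x : BaseChange f M) : p x := by
  letI := f.toAlgebra
  refine TensorProduct.induction_on (motive := p) x ?_ ?_ hadd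
  · have := h 0 0
    rwa [zero_smul] at this
  · intro b m
    have := h b m
    change p (b • ((1 : B) ⊗ₜ[A] m)) at this
    rwa [TensorProduct.smul_tmul', smul_eq_mul, mul_one] at this

variable {f}

/-- For a ring homomorphism `s : B → C`, an `s ∘ f`-semilinear map `g : M → P` extends uniquely to
an `s`-semilinear map `M ⊗_{A,f} B → P`, `m ⊗ b ↦ s(b) g(m)`. -/
def extend {P : Type*} [AddCommGroup P] [Module C P] (s : B →+* C) (g : M →ₛₗ[s.comp f] P) :
    BaseChange f M →ₛₗ[s] P :=
  letI := f.toAlgebra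
  letI : Module B P := Module.compHom P s
  letI : Module A P := Module.compHom P (s.comp f)
  haveI : IsScalarTower A B P := ⟨fun a b x => by
    change s (f a * b) • x = s (f a) • s b • x
    rw [map_mul, mul_smul]⟩
  let g' : M →ₗ[A] P :=
    { toFun := g
      map_add' := g.map_add
      map_smul' := fun a x => g.map_smulₛₗ a x }
  let h : B ⊗[A] M →ₗ[B] P := g'.liftBaseChange B
  { toFun := h
    map_add' := h.map_add
    map_smul' := fun b x => h.map_smul b x }

theorem extend_mk {P : Type*} [AddCommGroup P] [Module C P] (s : B →+* C)
    (g : M →ₛₗ[s.comp f] P) (m : M) : extend s g (mk f m) = g m := by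
  letI := f.toAlgebra
  letI : Module B P := Module.compHom P s
  change s 1 • g m = g m
  rw [map_one, one_smul]

/-- The homomorphism `M ⊗_{A,f} B → N ⊗_{A,f} B` induced by an `A`-linear map `M → N`. -/
def map (f : A →+* B) {N : Type*} [AddCommGroup N] [Module A N] (g : M →ₗ[A] N) :
    BaseChange f M →ₗ[B] BaseChange f N :=
  letI := f.toAlgebra
  g.baseChange B

theorem map_mk {N : Type*} [AddCommGroup N] [Module A N] (g : M →ₗ[A] N) (m : M) :
    map f g (mk f m) = mk f (g m) := rfl

theorem linear_ext {P : Type*} [AddCommGroup P] [Module C P] {s : B →+* C}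
    {g h : BaseChange f M →ₛₗ[s] P} (H : ∀ m, g (mk f m) = h (mk f m)) : g = h := by
  ext x
  refine induction (f := f) (p := fun x => g x = h x) ?_ ?_ x
  · intro b m; rw [map_smulₛₗ, map_smulₛₗ, H]
  · intro x y hx hy; rw [_root_.map_add, _root_.map_add, hx, hy]

variable (f) (M) in
/-- `map f` as a ring homomorphism on endomorphism rings. -/
def mapEnd : Module.End A M →+* Module.End B (BaseChange f M) where
  toFun g := map f g
  map_one' := linear_ext fun m => rfl
  map_mul' g h := linear_ext fun m => rfl
  map_zero' := linear_ext fun m => by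
    rw [map_mk, LinearMap.zero_apply, LinearMap.zero_apply, _root_.map_zero]
  map_add' g h := linear_ext fun m => by
    rw [map_mk, LinearMap.add_apply, LinearMap.add_apply, _root_.map_add, map_mk, map_mk]

theorem map_mul (g h : Module.End A M) : map f (g * h) = map f g * map f h :=
  (mapEnd f M).map_mul g h

theorem map_add (g h : Module.End A M) : map f (g + h) = map f g + map f h :=
  (mapEnd f M).map_add g h

theorem map_algebraMap (a : A) : map f (algebraMap A (Module.End A M) a) =
    algebraMap B (Module.End B (BaseChange f M)) (f a) :=
  linear_ext fun m => by
    rw [map_mk, Module.algebraMap_end_apply, map_smulₛₗ, Module.algebraMap_end_apply]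

/-- For `h : B → C`, the canonical `h`-semilinear map `M ⊗_{A,f} B → M ⊗_{A, h ∘ f} C`,
`m ⊗ b ↦ m ⊗ h(b)`. Here `g` is a name for the composite `h ∘ f`. -/
def along (f : A →+* B) (h : B →+* C) (g : A →+* C) (hg : h.comp f = g) :
    BaseChange f M →ₛₗ[h] BaseChange g M :=
  extend h
    { toFun := mk g
      map_add' := (mk g).map_add
      map_smul' := fun a x => by subst hg; exact (mk (h.comp f)).map_smulₛₗ a x }

theorem along_mk (h : B →+* C) (g : A →+* C) (hg : h.comp f = g) (m : M) :
    along f h g hg (mk f m) = mk g m := extend_mk _ _ _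

end basic

section ring

variable {A B : Type*} [CommRing A] [CommRing B]

/-- The base change `E ⊗_{A,f} B` of a commutative `A`-algebra, as a commutative ring. -/
def Ring (f : A →+* B) (E : Type*) [CommRing E] [Algebra A E] : Type _ :=
  letI := f.toAlgebra
  B ⊗[A] E

variable (f : A →+* B) (E : Type*) [CommRing E] [Algebra A E]

instance : CommRing (Ring f E) :=
  letI := f.toAlgebra
  (Algebra.TensorProduct.instCommRing : CommRing (B ⊗[A] E))

/-- The ring homomorphism `b ↦ 1 ⊗ b`. -/
def Ring.inl : B →+* Ring f E :=
  letI := f.toAlgebra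
  (Algebra.TensorProduct.includeLeft : B →ₐ[A] B ⊗[A] E).toRingHom

/-- The ring homomorphism `e ↦ e ⊗ 1`. -/
def Ring.inr : E →+* Ring f E :=
  letI := f.toAlgebra
  (Algebra.TensorProduct.includeRight : E →ₐ[A] B ⊗[A] E).toRingHom

end ring

end BaseChange

/-- The ring homomorphism `B ⊗_A D → T`, `b ⊗ d ↦ f(b) g(d)`, attached to ring homomorphisms
`f : B → T` with central image and `g : D → T` that agree on `A`. -/
def tensorLift {A B D T : Type*} [CommRing A] [CommRing B] [Ring D] [Ring T] [Algebra A B]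
    [Algebra A D] (f : B →+* T) (hf : ∀ b x, f b * x = x * f b) (g : D →+* T)
    (h : ∀ a, g (algebraMap A D a) = f (algebraMap A B a)) : B ⊗[A] D →+* T :=
  letI : Algebra A T := (f.comp (algebraMap A B)).toAlgebra' fun _ x => hf _ x
  let f' : B →ₐ[A] T := { f with commutes' := fun _ => rfl }
  let g' : D →ₐ[A] T := { g with commutes' := fun a => h a }
  (Algebra.TensorProduct.lift f' g' fun b d => hf b (g d)).toRingHom

theorem tensorLift_tmul {A B D T : Type*} [CommRing A] [CommRing B] [Ring D] [Ring T] [Algebra A B]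
    [Algebra A D] (f : B →+* T) (hf : ∀ b x, f b * x = x * f b) (g : D →+* T)
    (h : ∀ a, g (algebraMap A D a) = f (algebraMap A B a)) (b : B) (d : D) :
    tensorLift f hf g h (b ⊗ₜ d) = f b * g d := rfl

/-- The ring homomorphism `E ⊗_{A,f} B → T`, `e ⊗ b ↦ g(e) u(b)`, attached to ring homomorphisms
`u : B → T` with central image and `g : E → T` that agree on `A`. -/
def BaseChange.Ring.lift {A B E T : Type*} [CommRing A] [CommRing B] [CommRing E] [_root_.Ring T]
    [Algebra A E] (f : A →+* B) (u : B →+* T) (hu : ∀ b x, u b * x = x * u b) (g : E →+* T)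
    (h : ∀ a, g (algebraMap A E a) = u (f a)) : BaseChange.Ring f E →+* T :=
  letI := f.toAlgebra
  tensorLift u hu g h

/-- A point `ζ` of the punctured open unit disc of a local ring `R`: a nonzero element of the maximal
ideal of `R`. It plays the role of the image of `z` under `γ : 𝔽_v⟦z⟧ → R`. -/
structure CharPoint (R : Type*) [CommRing R] [IsLocalRing R] where
  /-- the element `ζ` -/
  ζ : R
  mem : ζ ∈ IsLocalRing.maximalIdeal R
  ne_zero : ζ ≠ 0

open scoped PowerSeries.WithPiTopology in
theorem continuousSMul_powerSeries {R : Type*} [CommRing R] [TopologicalSpace R]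
    [IsTopologicalRing R] : ContinuousSMul R R⟦X⟧ := ⟨by
  have h : (fun p : R × R⟦X⟧ => p.1 • p.2) = fun p => PowerSeries.C p.1 * p.2 := by
    funext p; exact PowerSeries.smul_eq_C_mul _ _
  rw [h]
  exact (PowerSeries.WithPiTopology.continuous_C.comp continuous_fst).mul continuous_snd⟩

section shift

variable {R : Type*} [CommRing R] [IsLocalRing R] [IsAdicComplete (IsLocalRing.maximalIdeal R) R]

open scoped PowerSeries.WithPiTopology in
/-- The `R`-algebra homomorphism `R⟦z⟧ → R⟦t⟧`, `z ↦ ζ + t` (so `t = z - ζ`), i.e. evaluation of a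
power series at `ζ + t`, convergent for the `𝔪_R`-adic topology of the complete local ring `R` and
the coefficientwise topology of `R⟦t⟧`. -/
def taylorShift (P : CharPoint R) : R⟦X⟧ →ₐ[R] R⟦X⟧ :=
  letI : WithIdeal R := ⟨IsLocalRing.maximalIdeal R⟩
  have hc : CompleteSpace R ∧ T2Space R :=
    (IsAdic.isAdicComplete_iff (I := IsLocalRing.maximalIdeal R) rfl).1 inferInstance
  haveI := hc.1
  haveI := hc.2
  haveI : IsLinearTopology R⟦X⟧ R⟦X⟧ :=
    inferInstanceAs (IsLinearTopology (MvPowerSeries Unit R) (MvPowerSeries Unit R))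
  haveI : ContinuousSMul R R⟦X⟧ := continuousSMul_powerSeries
  PowerSeries.aeval (R := R) (S := R⟦X⟧) (a := PowerSeries.C P.ζ + PowerSeries.X)
    (PowerSeries.HasEval.add
      (PowerSeries.HasEval.map PowerSeries.WithPiTopology.continuous_C
        (WithIdeal.isTopologicallyNilpotent_of_mem P.mem))
      PowerSeries.HasEval.X)

open scoped PowerSeries.WithPiTopology in
theorem taylorShift_X (P : CharPoint R) :
    taylorShift P PowerSeries.X = PowerSeries.C P.ζ + PowerSeries.X := by
  let : WithIdeal R := ⟨IsLocalRing.maximalIdeal R⟩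
  have hc : CompleteSpace R ∧ T2Space R :=
    (IsAdic.isAdicComplete_iff (I := IsLocalRing.maximalIdeal R) rfl).1 inferInstance
  have := hc.1
  have := hc.2
  have : IsLinearTopology R⟦X⟧ R⟦X⟧ :=
    inferInstanceAs (IsLinearTopology (MvPowerSeries Unit R) (MvPowerSeries Unit R))
  have : ContinuousSMul R R⟦X⟧ := continuousSMul_powerSeries
  have ha : PowerSeries.HasEval (PowerSeries.C P.ζ + PowerSeries.X : R⟦X⟧) :=
    PowerSeries.HasEval.add
      (PowerSeries.HasEval.map PowerSeries.WithPiTopology.continuous_C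
        (WithIdeal.isTopologicallyNilpotent_of_mem P.mem))
      PowerSeries.HasEval.X
  exact (congrArg (taylorShift P) (Polynomial.coe_X (R := R)).symm).trans
    ((PowerSeries.aeval_coe ha _).trans (Polynomial.aeval_X _))

end shift

/-- The endomorphism `∑ bᵢ zⁱ ↦ ∑ bᵢ^q zⁱ` of `S⟦z⟧`, for a ring `S` over the finite field `k` with
`q` elements. -/
def frobSeries {k S : Type*} [Field k] [Fintype k] [CommRing S] (φ : k →+* S) : S⟦X⟧ →+* S⟦X⟧ :=
  letI := φ.toAlgebra
  PowerSeries.map (FiniteField.frobeniusAlgHom k S).toRingHom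

theorem coeff_frobSeries {k S : Type*} [Field k] [Fintype k] [CommRing S] (φ : k →+* S)
    (f : S⟦X⟧) (n : ℕ) :
    PowerSeries.coeff n (frobSeries φ f) = PowerSeries.coeff n f ^ Fintype.card k := rfl

theorem frobSeries_map {k S : Type*} [Field k] [Fintype k] [CommRing S] (φ : k →+* S) (a : k⟦X⟧) :
    frobSeries φ (PowerSeries.map φ a) = PowerSeries.map φ a := by
  ext n
  rw [coeff_frobSeries, PowerSeries.coeff_map, ← map_pow, FiniteField.pow_card]

section shtuka

variable (k : Type*) {R : Type*} [Field k] [Fintype k] [CommRing R] [IsLocalRing R] [Algebra k R]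

/-- The element `z - ζ` of `R⟦z⟧`. -/
def CharPoint.zSubZeta (P : CharPoint R) : R⟦X⟧ := PowerSeries.X - PowerSeries.C P.ζ

/-- The ring `R⟦z⟧[1/(z-ζ)]`. -/
abbrev CharPoint.Loc (P : CharPoint R) : Type _ := Localization.Away P.zSubZeta

/-- The homomorphism `R⟦z⟧ → R⟦z⟧[1/(z-ζ)]`. -/
abbrev CharPoint.toLoc (P : CharPoint R) : R⟦X⟧ →+* P.Loc := algebraMap R⟦X⟧ P.Loc

variable (R) in
/-- The Frobenius `σ̂` of `R⟦z⟧`. -/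
abbrev sigmaHat : R⟦X⟧ →+* R⟦X⟧ := frobSeries (algebraMap k R)

/-- A local `σ̂`-shtuka over `R`: a free `R⟦z⟧`-module `M` of finite rank together with an
isomorphism `τ : σ̂^*M[1/(z-ζ)] ≃ M[1/(z-ζ)]`. -/
structure LocalShtuka.{w, u, v} (k : Type u) {R : Type v} [Field k] [Fintype k] [CommRing R]
    [IsLocalRing R] [Algebra k R] (P : CharPoint R) where
  /-- the underlying module `M` -/
  carrier : Type w
  [addCommGroup : AddCommGroup carrier]
  [module : Module R⟦X⟧ carrier]
  [free : Module.Free R⟦X⟧ carrier]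
  [finite : Module.Finite R⟦X⟧ carrier]
  /-- the isomorphism `τ` -/
  τ : BaseChange P.toLoc (BaseChange (sigmaHat k R) carrier) ≃ₗ[P.Loc] BaseChange P.toLoc carrier

namespace LocalShtuka

attribute [instance] addCommGroup module free finite

variable {k} {P : CharPoint R} (M : LocalShtuka k P)

/-- The rank of a local shtuka. -/
def rank : ℕ := Module.finrank R⟦X⟧ M.carrier

/-- The `R⟦z⟧`-module `σ̂^*M`. -/
abbrev sigmaPullback : Type _ := BaseChange (sigmaHat k R) M.carrier

/-- The action of `A_v = k⟦z⟧ ⊆ R⟦z⟧` on `M`. -/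
instance instModuleA : Module k⟦X⟧ M.carrier :=
  Module.compHom M.carrier (algebraMap k⟦X⟧ R⟦X⟧)

instance : IsScalarTower k⟦X⟧ R⟦X⟧ M.carrier :=
  ⟨fun a b x => by
    rw [Algebra.smul_def, mul_smul]; rfl⟩

theorem map_sigmaHat_algebraMap (a : k⟦X⟧) :
    BaseChange.map (sigmaHat k R) (algebraMap k⟦X⟧ (Module.End R⟦X⟧ M.carrier) a) =
      algebraMap R⟦X⟧ (Module.End R⟦X⟧ M.sigmaPullback) (algebraMap k⟦X⟧ R⟦X⟧ a) := by
  refine (BaseChange.map_algebraMap (algebraMap k⟦X⟧ R⟦X⟧ a)).trans ?_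
  exact congrArg _ (frobSeries_map (algebraMap k R) a)

/-- The `A_v`-algebra `End_R(M)` of endomorphisms of the local shtuka `M`, i.e. of `R⟦z⟧`-linear
endomorphisms `f` of the underlying module with `τ ∘ σ̂^*f = f ∘ τ`. -/
def End : Subalgebra k⟦X⟧ (Module.End R⟦X⟧ M.carrier) where
  carrier := {f | ∀ x, M.τ (BaseChange.map P.toLoc (BaseChange.map (sigmaHat k R) f) x) =
    BaseChange.map P.toLoc f (M.τ x)}
  mul_mem' {f g} hf hg x := by
    rw [BaseChange.map_mul, BaseChange.map_mul, BaseChange.map_mul, Module.End.mul_apply,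
      Module.End.mul_apply, hf, hg]
  add_mem' {f g} hf hg x := by
    rw [BaseChange.map_add, BaseChange.map_add, BaseChange.map_add, LinearMap.add_apply,
      LinearMap.add_apply, _root_.map_add, hf, hg]
  algebraMap_mem' a x := by
    have h : BaseChange.map P.toLoc (algebraMap k⟦X⟧ (Module.End R⟦X⟧ M.carrier) a) =
        algebraMap P.Loc _ (P.toLoc (algebraMap k⟦X⟧ R⟦X⟧ a)) :=
      BaseChange.map_algebraMap (algebraMap k⟦X⟧ R⟦X⟧ a)
    rw [map_sigmaHat_algebraMap, BaseChange.map_algebraMap, h, Module.algebraMap_end_apply,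
      Module.algebraMap_end_apply, _root_.map_smul]

/-- `QEnd_R(M) = Q_v ⊗_{A_v} End_R(M)`, where `Q_v = k((z))`. -/
abbrev QEnd : Type _ := k⸨X⸩ ⊗[k⟦X⟧] M.End

section tate

variable (L : Type*) [Field L] [Algebra R L] [IsFractionRing R L]

variable (k R) in
/-- The embedding of the finite field `k` into the separable closure of `L`. -/
def toSep : k →+* SeparableClosure L :=
  ((algebraMap L (SeparableClosure L)).comp (algebraMap R L)).comp (algebraMap k R)

variable (R) in
/-- The homomorphism `R⟦z⟧ → L^sep⟦z⟧`. -/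
def seriesToSep : R⟦X⟧ →+* (SeparableClosure L)⟦X⟧ :=
  PowerSeries.map ((algebraMap L (SeparableClosure L)).comp (algebraMap R L))

variable (k R) in
/-- The Frobenius `σ̂` of `L^sep⟦z⟧`. -/
def sigmaSep : (SeparableClosure L)⟦X⟧ →+* (SeparableClosure L)⟦X⟧ := frobSeries (toSep k R L)

theorem sigmaSep_comp : (sigmaSep k R L).comp (seriesToSep R L) =
    (seriesToSep R L).comp (sigmaHat k R) := by
  ext f n
  simp only [sigmaSep, seriesToSep, RingHom.comp_apply, coeff_frobSeries, PowerSeries.coeff_map,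
    map_pow]

theorem isUnit_zSubZeta (P : CharPoint R) : IsUnit (seriesToSep R L P.zSubZeta) := by
  rw [PowerSeries.isUnit_iff_constantCoeff]
  simp [seriesToSep, CharPoint.zSubZeta, P.ne_zero]

/-- The homomorphism `R⟦z⟧[1/(z-ζ)] → L^sep⟦z⟧`; note that `z - ζ` is a unit in `L^sep⟦z⟧`. -/
def locToSep (P : CharPoint R) : P.Loc →+* (SeparableClosure L)⟦X⟧ :=
  IsLocalization.Away.lift P.zSubZeta (isUnit_zSubZeta L P)

theorem locToSep_comp (P : CharPoint R) : (locToSep L P).comp P.toLoc = seriesToSep R L :=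
  IsLocalization.Away.lift_comp _ _

/-- The `L^sep⟦z⟧`-module `M ⊗_{R⟦z⟧} L^sep⟦z⟧`. -/
abbrev sepModule : Type _ := BaseChange (seriesToSep R L) M.carrier

/-- The `σ̂`-semilinear map `m ↦ τ(σ̂_M^* m)`, `M → M[1/(z-ζ)] → M ⊗ L^sep⟦z⟧`. -/
def tauSepAux : M.carrier →ₛₗ[(sigmaSep k R L).comp (seriesToSep R L)] M.sepModule L where
  toFun m := BaseChange.along P.toLoc (locToSep L P) (seriesToSep R L) (locToSep_comp L P)
    (M.τ (BaseChange.mk P.toLoc (BaseChange.mk (sigmaHat k R) m)))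
  map_add' x y := by simp only [_root_.map_add]
  map_smul' a x := by
    rw [map_smulₛₗ, map_smulₛₗ, _root_.map_smul, map_smulₛₗ]
    have h : (sigmaSep k R L).comp (seriesToSep R L) a =
        locToSep L P (P.toLoc (sigmaHat k R a)) := by
      rw [sigmaSep_comp, ← locToSep_comp L P]
      rfl
    rw [h]

/-- The `σ̂`-semilinear endomorphism `m ↦ τ_M(σ̂_M^* m)` of `M ⊗_{R⟦z⟧} L^sep⟦z⟧`,
given by `m ⊗ b ↦ σ̂(b) · τ(σ̂_M^* m)`. -/
def tauSep : M.sepModule L →ₛₗ[sigmaSep k R L] M.sepModule L :=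
  BaseChange.extend (sigmaSep k R L) (M.tauSepAux L)

/-- The action of `A_v = k⟦z⟧` on `M ⊗_{R⟦z⟧} L^sep⟦z⟧`. -/
instance instModuleASep : Module k⟦X⟧ (M.sepModule L) :=
  Module.compHom _ (PowerSeries.map (toSep k R L))

/-- The `v`-adic realization (dual Tate module)
`H¹_v(M, A_v) = {m ∈ M ⊗_{R⟦z⟧} L^sep⟦z⟧ : τ_M(σ̂_M^* m) = m}`. -/
def tateModule : Submodule k⟦X⟧ (M.sepModule L) where
  carrier := {m | M.tauSep L m = m}
  add_mem' {x y} hx hy := by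
    change M.tauSep L (x + y) = x + y
    rw [_root_.map_add, show M.tauSep L x = x from hx, show M.tauSep L y = y from hy]
  zero_mem' := _root_.map_zero _
  smul_mem' a x hx := by
    change M.tauSep L (PowerSeries.map (toSep k R L) a • x) = PowerSeries.map (toSep k R L) a • x
    rw [map_smulₛₗ, show M.tauSep L x = x from hx, sigmaSep, frobSeries_map]

theorem tauSep_map (f : M.End) (x : M.sepModule L) :
    M.tauSep L (BaseChange.map (seriesToSep R L) f.1 x) =
      BaseChange.map (seriesToSep R L) f.1 (M.tauSep L x) := by
  have h : ∀ y : BaseChange P.toLoc M.carrier,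
      BaseChange.along P.toLoc (locToSep L P) (seriesToSep R L) (locToSep_comp L P)
        (BaseChange.map P.toLoc f.1 y) = BaseChange.map (seriesToSep R L) f.1
      (BaseChange.along P.toLoc (locToSep L P) (seriesToSep R L) (locToSep_comp L P) y) := by
    refine BaseChange.induction P.toLoc ?_ ?_
    · intro b m
      rw [_root_.map_smul, map_smulₛₗ, map_smulₛₗ, _root_.map_smul, BaseChange.map_mk,
        BaseChange.along_mk, BaseChange.along_mk, BaseChange.map_mk]
    · intro x y hx hy
      simp only [_root_.map_add, hx, hy]
  refine BaseChange.induction (seriesToSep R L) (p := fun x => M.tauSep L (BaseChange.map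
    (seriesToSep R L) f.1 x) = BaseChange.map (seriesToSep R L) f.1 (M.tauSep L x)) ?_ ?_ x
  · intro b m
    rw [_root_.map_smul, map_smulₛₗ, map_smulₛₗ, _root_.map_smul, BaseChange.map_mk, tauSep,
      BaseChange.extend_mk, BaseChange.extend_mk]
    congr 1
    change BaseChange.along P.toLoc _ _ (locToSep_comp L P) (M.τ _) =
      BaseChange.map _ _ (BaseChange.along P.toLoc _ _ (locToSep_comp L P) (M.τ _))
    rw [← h, ← f.2]
    rfl
  · intro x y hx hy
    simp only [_root_.map_add, hx, hy]

/-- The action of `End_R(M)` on `H¹_v(M, A_v)`. -/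
def endTate : M.End →+* Module.End k⟦X⟧ (M.tateModule L) where
  toFun f :=
    { toFun := fun m => ⟨BaseChange.map (seriesToSep R L) f.1 m.1, by
        change M.tauSep L _ = _
        rw [tauSep_map, show M.tauSep L m.1 = m.1 from m.2]⟩
      map_add' := fun x y => Subtype.ext ((BaseChange.map (seriesToSep R L) f.1).map_add _ _)
      map_smul' := fun a x => Subtype.ext ((BaseChange.map (seriesToSep R L) f.1).map_smul
        (PowerSeries.map (toSep k R L) a) x.1) }
  map_one' := LinearMap.ext fun m => Subtype.ext
    (LinearMap.congr_fun (BaseChange.mapEnd (seriesToSep R L) M.carrier).map_one m.1)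
  map_mul' f g := LinearMap.ext fun m => Subtype.ext
    (LinearMap.congr_fun (BaseChange.map_mul f.1 g.1) m.1)
  map_zero' := LinearMap.ext fun m => Subtype.ext
    (LinearMap.congr_fun (BaseChange.mapEnd (seriesToSep R L) M.carrier).map_zero m.1)
  map_add' f g := LinearMap.ext fun m => Subtype.ext
    (LinearMap.congr_fun (BaseChange.map_add f.1 g.1) m.1)

/-- The rational `v`-adic realization `H¹_v(M, Q_v) = Q_v ⊗_{A_v} H¹_v(M, A_v)`. -/
abbrev rationalTate : Type _ := k⸨X⸩ ⊗[k⟦X⟧] M.tateModule L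

theorem endTate_algebraMap (a : k⟦X⟧) :
    M.endTate L (algebraMap k⟦X⟧ M.End a) = algebraMap k⟦X⟧ (Module.End k⟦X⟧ (M.tateModule L)) a := by
  ext m
  refine (LinearMap.congr_fun (BaseChange.map_algebraMap (f := seriesToSep R L) (M := M.carrier)
    (algebraMap k⟦X⟧ R⟦X⟧ a)) m.1).trans ?_
  rw [Module.algebraMap_end_apply]
  change _ = PowerSeries.map (toSep k R L) a • m.1
  congr 1

/-- The action of `QEnd_R(M)` on `H¹_v(M, Q_v)`, `q ⊗ f ↦ q · (id ⊗ f)`. -/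
def qEndTate : M.QEnd →+* Module.End k⸨X⸩ (M.rationalTate L) :=
  tensorLift (A := k⟦X⟧) (B := k⸨X⸩) (D := M.End) (T := Module.End k⸨X⸩ (M.rationalTate L))
    (algebraMap k⸨X⸩ _) (fun b x => Algebra.commutes b x)
    ((Module.End.baseChangeHom k⟦X⟧ k⸨X⸩ (M.tateModule L)).toRingHom.comp (M.endTate L))
    (fun a => by
      rw [RingHom.comp_apply, endTate_algebraMap]
      refine ((Module.End.baseChangeHom k⟦X⟧ k⸨X⸩ (M.tateModule L)).commutes a).trans ?_
      rw [IsScalarTower.algebraMap_apply k⟦X⟧ k⸨X⸩])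

end tate

section deRham

variable [IsAdicComplete (IsLocalRing.maximalIdeal R) R]
variable (L : Type*) [Field L] [Algebra R L] [IsFractionRing R L]

/-- The homomorphism `R⟦z⟧ → L⟦z-ζ⟧`, `z ↦ z = ζ + (z-ζ)`. Here `L⟦z-ζ⟧` is the power series ring
over `L`, whose variable `X` stands for `z - ζ`. -/
def toSeries (P : CharPoint R) : R⟦X⟧ →+* L⟦X⟧ :=
  (PowerSeries.map (algebraMap R L)).comp (taylorShift P).toRingHom

/-- The evaluation `R⟦z⟧ → R`, `z ↦ ζ`. -/
def evalZeta (P : CharPoint R) : R⟦X⟧ →+* R :=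
  (PowerSeries.constantCoeff (R := R)).comp (taylorShift P).toRingHom

variable (k)

theorem isUnit_toSeries_X (P : CharPoint R) :
    IsUnit ((toSeries L P).comp (algebraMap k⟦X⟧ R⟦X⟧) PowerSeries.X) := by
  have h : (toSeries L P).comp (algebraMap k⟦X⟧ R⟦X⟧) PowerSeries.X =
      PowerSeries.C (algebraMap R L P.ζ) + PowerSeries.X := by
    rw [RingHom.comp_apply, PowerSeries.algebraMap_apply'', PowerSeries.map_X]
    change PowerSeries.map (algebraMap R L) (taylorShift P PowerSeries.X) = _
    rw [taylorShift_X]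
    simp
  rw [h, PowerSeries.isUnit_iff_constantCoeff]
  simp [P.ne_zero]

/-- The homomorphism `Q_v = k((z)) → L⟦z-ζ⟧`, `z ↦ z = ζ + (z-ζ)`. -/
def qToSeries (P : CharPoint R) : k⸨X⸩ →+* L⟦X⟧ :=
  IsLocalization.Away.lift (PowerSeries.X : k⟦X⟧) (isUnit_toSeries_X k L P)

theorem qToSeries_algebraMap (P : CharPoint R) (a : k⟦X⟧) :
    qToSeries k L P (algebraMap k⟦X⟧ k⸨X⸩ a) = toSeries L P (algebraMap k⟦X⟧ R⟦X⟧ a) :=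
  IsLocalization.Away.lift_eq _ _ _

/-- The embedding `γ : Q_v = k((z)) → L`, `z ↦ ζ`. -/
def gamma (P : CharPoint R) : k⸨X⸩ →+* L :=
  (PowerSeries.constantCoeff (R := L)).comp (qToSeries k L P)

variable {k}

theorem gamma_algebraMap (P : CharPoint R) (a : k⟦X⟧) :
    gamma k L P (algebraMap k⟦X⟧ k⸨X⸩ a) =
      algebraMap R L (evalZeta P (algebraMap k⟦X⟧ R⟦X⟧ a)) := by
  rw [gamma, RingHom.comp_apply, qToSeries_algebraMap]
  rw [← PowerSeries.coeff_zero_eq_constantCoeff_apply, evalZeta, RingHom.comp_apply,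
    ← PowerSeries.coeff_zero_eq_constantCoeff_apply, toSeries, RingHom.comp_apply,
    PowerSeries.coeff_map]

/-- For a homomorphism `g` from `R⟦z⟧` to a ring `B`, the action of `End_R(M)` on
`σ̂^*M ⊗_{R⟦z⟧, g} B`, where `f` acts as `σ̂^*f ⊗ id`. -/
def endPullback {B : Type*} [CommRing B] (g : R⟦X⟧ →+* B) :
    M.End →+* Module.End B (BaseChange g M.sigmaPullback) :=
  (BaseChange.mapEnd g M.sigmaPullback).comp
    ((BaseChange.mapEnd (sigmaHat k R) M.carrier).comp M.End.val.toRingHom)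

theorem endPullback_algebraMap {B : Type*} [CommRing B] (g : R⟦X⟧ →+* B) (a : k⟦X⟧) :
    M.endPullback g (algebraMap k⟦X⟧ M.End a) = algebraMap B _ (g (algebraMap k⟦X⟧ R⟦X⟧ a)) :=
  (congrArg (BaseChange.map g) (M.map_sigmaHat_algebraMap a)).trans
    (BaseChange.map_algebraMap _)

/-- The de Rham realization `H¹_dR(M, R) = σ̂^*M ⊗_{R⟦z⟧, z ↦ ζ} R`. -/
abbrev deRhamR : Type _ := BaseChange (evalZeta P) M.sigmaPullback

/-- The de Rham realization `H¹_dR(M, L) = σ̂^*M ⊗_{R⟦z⟧, z ↦ ζ} L`. -/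
abbrev deRhamL : Type _ := BaseChange ((algebraMap R L).comp (evalZeta P)) M.sigmaPullback

/-- The de Rham realization `H¹_dR(M, L⟦z-ζ⟧) = σ̂^*M ⊗_{R⟦z⟧} L⟦z-ζ⟧`. -/
abbrev deRhamSeries : Type _ := BaseChange (toSeries L P) M.sigmaPullback

/-- The canonical map `H¹_dR(M, R) → H¹_dR(M, L)`. -/
def deRhamRtoL : M.deRhamR →ₛₗ[algebraMap R L] M.deRhamL L :=
  BaseChange.along (evalZeta P) (algebraMap R L) _ rfl

/-- The action of `QEnd_R(M)` on `H¹_dR(M, L⟦z-ζ⟧)`. -/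
def qEndSeries : M.QEnd →+* Module.End L⟦X⟧ (M.deRhamSeries L) :=
  tensorLift ((algebraMap L⟦X⟧ _).comp (qToSeries k L P)) (fun _ x => Algebra.commutes _ x)
    (M.endPullback (toSeries L P)) (fun a => by
      rw [endPullback_algebraMap, RingHom.comp_apply, qToSeries_algebraMap])

/-- The action of `QEnd_R(M)` on `H¹_dR(M, L)`. -/
def qEndL : M.QEnd →+* Module.End L (M.deRhamL L) :=
  tensorLift ((algebraMap L _).comp (gamma k L P)) (fun _ x => Algebra.commutes _ x)
    (M.endPullback ((algebraMap R L).comp (evalZeta P))) (fun a => by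
      rw [endPullback_algebraMap, RingHom.comp_apply, RingHom.comp_apply, gamma_algebraMap])

end deRham


section cm

variable (E : Type*) [CommRing E] [Algebra k⸨X⸩ E]

/-- Complex multiplication of the local shtuka `M` by a commutative `Q_v`-algebra `E`: an
embedding `E ⊆ QEnd_R(M)` of `Q_v`-algebras, where `dim_{Q_v} E = rk M`. -/
structure CM where
  /-- the embedding -/
  ι : E →ₐ[k⸨X⸩] M.QEnd
  injective : Function.Injective ι
  finrank_eq : Module.finrank k⸨X⸩ E = M.rank

variable (k) in
/-- For a homomorphism `g : Q_v → K`, the set of `Q_v`-homomorphisms `ψ : E → K`. -/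
def Emb {K : Type*} [CommRing K] (g : k⸨X⸩ →+* K) : Type _ :=
  {ψ : E →+* K // ψ.comp (algebraMap k⸨X⸩ E) = g}

namespace CM

variable {M E} (C : M.CM E)
variable (L : Type*) [Field L] [Algebra R L] [IsFractionRing R L]

/-- `H¹_v(M, Q_v)` with the `E`-module structure given by the complex multiplication. -/
def tate (_C : M.CM E) : Type _ := M.rationalTate L

instance : AddCommGroup (C.tate L) :=
  (TensorProduct.addCommGroup : AddCommGroup (M.rationalTate L))

instance : Module E (C.tate L) :=
  Module.compHom (M.rationalTate L) ((M.qEndTate L).comp C.ι.toRingHom)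

variable [IsAdicComplete (IsLocalRing.maximalIdeal R) R]

variable (k P E) in
/-- The ring `E ⊗_{Q_v} L⟦z-ζ⟧`. -/
abbrev ESeries : Type _ := BaseChange.Ring (qToSeries k L P) E

/-- `H¹_dR(M, L⟦z-ζ⟧)` with the `E ⊗_{Q_v} L⟦z-ζ⟧`-module structure given by the complex
multiplication. -/
def deRham (_C : M.CM E) : Type _ := M.deRhamSeries L

instance : AddCommGroup (C.deRham L) := inferInstanceAs (AddCommGroup (M.deRhamSeries L))

/-- The action of `E ⊗_{Q_v} L⟦z-ζ⟧` on `H¹_dR(M, L⟦z-ζ⟧)`. -/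
def seriesAction : ESeries k P E L →+* Module.End L⟦X⟧ (M.deRhamSeries L) :=
  BaseChange.Ring.lift (qToSeries k L P) (algebraMap L⟦X⟧ _) (fun b x => Algebra.commutes b x)
    ((M.qEndSeries L).comp C.ι.toRingHom) (fun a => by
      have h : (C.ι.toRingHom (algebraMap k⸨X⸩ E a) : M.QEnd) = a ⊗ₜ 1 := C.ι.commutes a
      rw [RingHom.comp_apply, h, qEndSeries, tensorLift_tmul, map_one, mul_one,
        RingHom.comp_apply])

instance : Module (ESeries k P E L) (C.deRham L) :=
  Module.compHom (M.deRhamSeries L) (C.seriesAction L)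

/-- The action of `E` on `H¹_dR(M, L)`. -/
def actionL : E →+* Module.End L (M.deRhamL L) := (M.qEndL L).comp C.ι.toRingHom

variable {L}

/-- The factor field `E_{i(ψ)}` of `E` through which `ψ : E → L` factors. -/
abbrev Factor {g : k⸨X⸩ →+* L} (ψ : Emb k E g) : Type _ := E ⧸ RingHom.ker ψ.1

variable (k) in
/-- `y` is a uniformizer of the finite field extension `F` of `Q_v`, i.e. a prime element of the
integral closure of `A_v` in `F`. -/
def IsUniformizer {F : Type*} [CommRing F] [Algebra k⸨X⸩ F] (y : F) : Prop :=
  letI : Algebra k⟦X⟧ F := ((algebraMap k⸨X⸩ F).comp (algebraMap k⟦X⟧ k⸨X⸩)).toAlgebra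
  ∃ h : y ∈ integralClosure k⟦X⟧ F, Irreducible (⟨y, h⟩ : integralClosure k⟦X⟧ F)

/-- The inseparability degree of `E_{i(ψ)}` over `Q_v`. -/
def insepDegree [Module.Finite k⸨X⸩ E] {g : k⸨X⸩ →+* L} (ψ : Emb k E g) : ℕ :=
  haveI : IsArtinianRing E := IsArtinianRing.of_finite k⸨X⸩ E
  haveI : (RingHom.ker ψ.1).IsPrime := RingHom.ker_isPrime ψ.1
  haveI : (RingHom.ker ψ.1).IsMaximal := IsArtinianRing.isMaximal_of_isPrime _
  letI : Field (Factor ψ) := Ideal.Quotient.field _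
  Field.finInsepDegree k⸨X⸩ (Factor ψ)

/-- `L⟦y-ψ(y)⟧` as an `E ⊗_{Q_v} L⟦z-ζ⟧`-algebra, where `y ∈ E_{i(ψ)}`: the power series ring `L⟦Y⟧`
in the variable `Y = y - ψ(y)`, together with an `L`-algebra homomorphism
`E ⊗_{Q_v} L⟦z-ζ⟧ → L⟦Y⟧` that sends `y` to `ψ(y) + Y` and reduces to `ψ` on `E` modulo `Y`. -/
@[ext]
structure Expansion (ψ : Emb k E (gamma k L P)) (y : Factor ψ) where
  /-- the homomorphism `E ⊗_{Q_v} L⟦z-ζ⟧ → L⟦y-ψ(y)⟧` -/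
  toRingHom : ESeries k P E L →+* L⟦X⟧
  map_C : ∀ c : L, toRingHom (BaseChange.Ring.inl _ E (PowerSeries.C c)) = PowerSeries.C c
  constantCoeff_map : ∀ e : E,
    PowerSeries.constantCoeff (toRingHom (BaseChange.Ring.inr _ E e)) = ψ.1 e
  map_uniformizer : ∀ e : E, Ideal.Quotient.mk _ e = y →
    toRingHom (BaseChange.Ring.inr _ E e) = PowerSeries.C (ψ.1 e) + PowerSeries.X

/-- `H^ψ(M, L⟦y-ψ(y)⟧) = H¹_dR(M, L⟦z-ζ⟧) ⊗_{E ⊗ L⟦z-ζ⟧} L⟦y-ψ(y)⟧`. -/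
abbrev HPsiSeries {ψ : Emb k E (gamma k L P)} {y : Factor ψ} (Θ : Expansion ψ y) : Type _ :=
  BaseChange Θ.toRingHom (C.deRham L)

/-- The generalized `ψ`-eigenspace of the `E`-action on `H¹_dR(M, L)`. -/
def genEigenspace (ψ : Emb k E (gamma k L P)) : Submodule L (M.deRhamL L) :=
  ⨅ a : E, (C.actionL L a).maxGenEigenspace (ψ.1 a)

/-- `H^ψ(M, R)`, the set of `ω ∈ H¹_dR(M, R)` such that for every `a ∈ E ∩ End_R(M)` one has
`([a]^* - ψ(a))^n ω = 0` for `n ≫ 0`. Here `f ∈ End_R(M)` is the element `a` of `E ∩ End_R(M)` and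
`r` is `ψ(a)` as an element of `R`. -/
def HPsiR (ψ : Emb k E (gamma k L P)) : Submodule R M.deRhamR :=
  ⨅ (a : E) (f : M.End) (r : R) (_ : C.ι a = 1 ⊗ₜ f) (_ : algebraMap R L r = ψ.1 a),
    (M.endPullback (evalZeta P) f).maxGenEigenspace r

/-- The canonical `L`-linear map `H^ψ(M, R) ⊗_R L → H¹_dR(M, L)`. -/
def HPsiRtoL (ψ : Emb k E (gamma k L P)) :
    BaseChange (algebraMap R L) (C.HPsiR ψ) →ₗ[L] M.deRhamL L :=
  BaseChange.extend (RingHom.id L)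
    { toFun := fun ω => M.deRhamRtoL L ω.1
      map_add' := fun x y => (M.deRhamRtoL L).map_add x.1 y.1
      map_smul' := fun a x => (M.deRhamRtoL L).map_smulₛₗ a x.1 }

end CM

end cm

end LocalShtuka

end shtuka

end

/-! The rank one statements come from vectors with a large `E`-orbit, and the decompositions come
from a power series description of `E ⊗ L⟦z-ζ⟧`.

Tate module. Over `L^sep⟦z⟧` the element `z - ζ` is a unit, so `τ` becomes a bijective Frobenius
structure, and Lang's theorem (`exists_lang_matrix`) yields a basis of invariant vectors. Hence the
Tate module has rank `rk M`, and `E` acts on it faithfully. A faithful module over a commutative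
semisimple ring has a vector with trivial annihilator, and by dimension the orbit of such a vector
is everything.

The ring `E ⊗ L⟦z-ζ⟧`. Let `p` be the characteristic. Since `k((z))` satisfies `[F : F^p] = p`, so
does every factor field `F` of `E`. An element `y` of `F` that is not a `p`-th power, such as a
uniformizer, therefore generates `F` over `F^(p^n)` for all `n`. This gives existence and uniqueness
of the expansion `F → L⟦Y⟧` with `y ↦ ψ(y) + Y`. The inseparability degree `d_ψ` is a power of `p`,
and `z` is a `d_ψ`-th power in `F`, so `Y^(d_ψ)` divides the image of `z - ζ`. If all embeddings
land in `L`, the `d_ψ` add up to `dim E`. The Chinese remainder theorem together with this count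
makes the map to the product bijective.

De Rham realization. The determinant of an orbit is a polynomial in the coordinates of the vector
(`orbitDet`), compatible with base change. The Tate module shows that it is nonzero over `R⟦z⟧`
(`orbitDet_end_ne_zero`). Over an algebraic closure `Λ` of `L` the ring `E ⊗ Λ⟦z-ζ⟧` is a principal
ideal ring, so a vector with nonzero determinant can be replaced by one with unit determinant
(`exists_isUnit_det`). Thus the polynomial remains nonzero at `z = ζ` (`map_orbitDet_ne_zero`). As
`L` is infinite, it has a nonvanishing point already over `L`, without any assumption on the
embeddings of `E`.

Eigenspaces. Modulo `z - ζ` the cyclic module `H¹_dR(M, L)` becomes the product of the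
`L[Y]/Y^(d_ψ)`, whose factors are the generalized eigenspaces. Clearing denominators transfers this
to the lattices `H^ψ(M, R)`. -/

noncomputable section

/-! ### Lang's theorem for Frobenius modules over a separably closed field and its power series
ring. -/

section Lang

open Polynomial

/-- The equations say that `∑ c i • w i` is fixed by a Frobenius-semilinear map with `w i ↦ w (i +
1)` and `w (m + 1) = ∑ a i • w i`. Eliminating all unknowns but `c m` leaves one polynomial
equation, which is separable because its derivative is `-1`. -/
theorem exists_additive_root {K : Type*} [Field K] [IsSepClosed K] {q : ℕ} (hq : 1 < q)
    (hq0 : (q : K) = 0) (a : ℕ → K) (m : ℕ) (ha : a 0 ≠ 0) :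
    ∃ c : ℕ → K, c m ≠ 0 ∧ c 0 = a 0 * c m ^ q ∧
      ∀ i < m, c (i + 1) = c i ^ q + a (i + 1) * c m ^ q := by
  -- `P i` is `c i` written as a polynomial in the last unknown `c m`; the remaining condition is `P
  -- m = X`.
  let P : ℕ → K[X] := fun n => Nat.rec (C (a 0) * X ^ q) (fun i r => r ^ q + C (a (i + 1)) * X ^ q) n
  have hP0 : P 0 = C (a 0) * X ^ q := rfl
  have hPs : ∀ i, P (i + 1) = P i ^ q + C (a (i + 1)) * X ^ q := fun i => rfl
  have hdeg : ∀ i, q ≤ (P i).natDegree := by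
    intro i
    induction i with
    | zero => rw [hP0, natDegree_C_mul_X_pow _ _ ha]
    | succ i ih =>
      have h1 : (C (a (i + 1)) * X ^ q).natDegree ≤ q := natDegree_C_mul_X_pow_le _ _
      have h2 : q < (P i ^ q).natDegree := by rw [natDegree_pow]; nlinarith
      rw [hPs, natDegree_add_eq_left_of_natDegree_lt (h1.trans_lt h2)]
      exact h2.le
  have hder : ∀ i, derivative (P i) = 0 := by
    intro i
    have hqp : (C (q : K) : K[X]) = 0 := by rw [hq0, C_0]
    have hqp' : ((q : ℕ) : K[X]) = 0 := by rw [← hqp]; simp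
    cases i with
    | zero => rw [hP0, derivative_C_mul, derivative_X_pow, hqp]; simp
    | succ i => rw [hPs, derivative_add, derivative_C_mul, derivative_X_pow, hqp, derivative_pow, hqp]
                simp
  have hdvd : ∀ i, X ^ q ∣ P i := by
    intro i
    induction i with
    | zero => exact Dvd.intro_left _ rfl
    | succ i ih =>
      rw [hPs]
      exact dvd_add (ih.trans (dvd_pow_self _ (by omega))) (Dvd.intro_left _ rfl)
  obtain ⟨h, hh⟩ := hdvd m
  -- Splitting off `X` discards the zero solution: since `q > 1`, the cofactor takes the value `-1`
  -- at `0`.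
  have hfac : P m - X = X * (X ^ (q - 1) * h - 1) := by
    rw [hh]
    obtain ⟨q, rfl⟩ : ∃ r, q = r + 1 := ⟨q - 1, by omega⟩
    simp only [Nat.add_sub_cancel]; ring
  have hsep : (P m - X).Separable := by
    rw [separable_def, derivative_sub, hder, derivative_X, zero_sub]
    exact ⟨0, -1, by ring⟩
  rw [hfac] at hsep
  have hsep' := hsep.of_mul_right
  have hdeg' : (X ^ (q - 1) * h - 1 : K[X]).degree ≠ 0 := by
    intro hd
    have h1 : (P m - X).natDegree = (P m).natDegree := by
      apply natDegree_sub_eq_left_of_natDegree_lt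
      rw [natDegree_X]
      exact hq.trans_le (hdeg m)
    have h0 : (X ^ (q - 1) * h - 1 : K[X]).natDegree = 0 := natDegree_eq_of_degree_eq_some hd
    have h2 : (P m - X).natDegree ≤ 1 := by
      rw [hfac]
      refine natDegree_mul_le.trans ?_
      rw [h0, natDegree_X]
    have := hdeg m
    omega
  obtain ⟨c, hc⟩ := IsSepClosed.exists_root _ hdeg' hsep'
  have hc0 : c ≠ 0 := by
    rintro rfl
    simp [IsRoot, eval_sub, eval_mul, eval_pow, zero_pow (show q - 1 ≠ 0 by omega)] at hc
  have hcm : (P m).eval c = c := by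
    have : (P m - X).eval c = 0 := by rw [hfac, eval_mul, hc.eq_zero, mul_zero]
    rwa [eval_sub, eval_X, sub_eq_zero] at this
  refine ⟨fun i => (P i).eval c, by simpa [hcm] using hc0, ?_, fun i _ => ?_⟩
  · simp only [hcm]; simp [hP0]
  · simp only [hcm]; simp [hPs]

variable {K V : Type*} [Field K] [AddCommGroup V] [Module K V] {s : K →+* K}

/-- A semilinear map whose image spans a finite-dimensional space preserves linear independence of
bases, so it is injective. -/
theorem injective_of_span_range [FiniteDimensional K V] (φ : V →ₛₗ[s] V)
    (h : Submodule.span K (Set.range φ) = ⊤) {n : Type*} [Finite n] {v : n → V}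
    (hv : LinearIndependent K v) : LinearIndependent K (fun i => φ (v i)) := by
  have key : ∀ {ι : Type _} [Finite ι] (b : Module.Basis ι K V),
      LinearIndependent K (fun i => φ (b i)) := by
    intro ι _ b
    have := Fintype.ofFinite ι
    refine linearIndependent_of_top_le_span_of_card_eq_finrank ?_ (Module.finrank_eq_card_basis b).symm
    rw [← h, Submodule.span_le]
    rintro _ ⟨x, rfl⟩
    rw [← b.sum_repr x, map_sum]
    refine Submodule.sum_mem _ fun i _ => ?_
    rw [map_smulₛₗ]
    exact Submodule.smul_mem _ _ (Submodule.subset_span ⟨i, rfl⟩)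
  have h1 := hv.linearIndepOn_id
  have hb := key (Module.Basis.extend h1)
  have hinj := hv.injective
  have : (fun i => φ (v i)) = (fun i => φ (Module.Basis.extend h1 i)) ∘
      (fun i => (⟨v i, h1.subset_extend _ ⟨i, rfl⟩⟩ : h1.extend (Set.subset_univ _))) := by
    funext i; simp
  rw [this]
  refine hb.comp _ ?_
  intro i j hij
  exact hinj (by simpa using hij)

variable {q : ℕ}

/-- On the cyclic subspace spanned by the iterates of one nonzero vector, being fixed is the
triangular system of `exists_additive_root`. -/
theorem exists_fixed_ne_zero [IsSepClosed K] [FiniteDimensional K V] [Nontrivial V] (hq : 1 < q)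
    (hq0 : (q : K) = 0) (hs : ∀ a, s a = a ^ q) (φ : V →ₛₗ[s] V)
    (h : Submodule.span K (Set.range φ) = ⊤) : ∃ x, φ x = x ∧ x ≠ 0 := by
  obtain ⟨v, hv⟩ := exists_ne (0 : V)
  let w : ℕ → V := fun i => φ^[i] v
  have hw : ∀ i, φ (w i) = w (i + 1) := fun i => (Function.iterate_succ_apply' φ i v).symm
  have hex : ∃ m, ¬ LinearIndependent K (fun i : Fin m => w i) := by
    refine ⟨Module.finrank K V + 1, fun hl => ?_⟩
    have := hl.fintype_card_le_finrank
    simp at this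
  classical
  obtain ⟨m, hm, hmin⟩ : ∃ m, ¬ LinearIndependent K (fun i : Fin m => w i) ∧
      ∀ j < m, LinearIndependent K (fun i : Fin j => w i) :=
    ⟨Nat.find hex, Nat.find_spec hex, fun j hj => not_not.1 (Nat.find_min hex hj)⟩
  obtain _ | _ | m := m
  · exact absurd (linearIndependent_empty_type) hm
  · refine absurd ?_ hm
    rw [Fintype.linearIndependent_iff]
    intro g hg i
    have h0 : g 0 • v = 0 := by simpa [w] using hg
    obtain rfl : i = 0 := Fin.ext (by have := i.2; omega)
    exact (smul_eq_zero.1 h0).resolve_right hv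
  have hli := hmin (m + 1) (by omega)
  have hmem : w (m + 1) ∈ Submodule.span K (Set.range fun i : Fin (m + 1) => w i) := by
    by_contra hn
    exact hm (linearIndependent_finSucc'.2 ⟨hli, hn⟩)
  rw [Submodule.mem_span_range_iff_exists_fun] at hmem
  obtain ⟨a', ha'⟩ := hmem
  obtain ⟨a, ha⟩ : ∃ a : ℕ → K, ∀ i : Fin (m + 1), a i = a' i :=
    ⟨fun n => if h : n < m + 1 then a' ⟨n, h⟩ else 0, fun i => dif_pos i.2⟩
  have hsum : ∑ i ∈ Finset.range (m + 1), a i • w i = w (m + 1) := by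
    rw [Finset.sum_range, ← ha']
    simp [ha]
  -- If `a 0` vanished, the relation would involve only images under `φ` of the independent `w 0, …,
  -- w m`, and these images are again independent.
  have ha0 : a 0 ≠ 0 := by
    intro ha0
    have hli' : LinearIndependent K (fun i : Fin (m + 1) => w (i + 1)) := by
      simpa only [hw] using injective_of_span_range φ h hli
    have h2 : w (m + 1) - ∑ i : Fin m, a (i + 1) • w (i + 1) = 0 := by
      rw [← hsum, Finset.sum_range_succ', ha0, zero_smul, add_zero, Finset.sum_range, sub_self]
    have := Fintype.linearIndependent_iff.1 hli' (Fin.snoc (fun i : Fin m => - a (i + 1)) 1) (by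
      rw [Fin.sum_univ_castSucc]
      simp only [Fin.snoc_castSucc, Fin.snoc_last, Fin.val_castSucc, Fin.val_last, one_smul,
        neg_smul, Finset.sum_neg_distrib]
      rw [← h2]; abel) (Fin.last m)
    simp at this
  obtain ⟨c, hcm, hc0, hcs⟩ := exists_additive_root hq hq0 a m ha0
  refine ⟨∑ i ∈ Finset.range (m + 1), c i • w i, ?_, ?_⟩
  · rw [map_sum]
    simp only [map_smulₛₗ, hs, hw]
    rw [Finset.sum_range_succ, ← hsum, Finset.smul_sum, Finset.sum_range_succ' _ m,
      Finset.sum_range_succ' (fun i => c i • w i) m, hc0, ← add_assoc, ← Finset.sum_add_distrib]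
    congr 1
    · refine Finset.sum_congr rfl fun i hi => ?_
      rw [hcs i (Finset.mem_range.1 hi), add_smul, smul_smul, mul_comm]
    · rw [smul_smul, mul_comm]
  · intro h0
    rw [Finset.sum_range] at h0
    have := Fintype.linearIndependent_iff.1 hli (fun i => c i) h0 (Fin.last m)
    exact hcm (by simpa using this)

/-- On a multiple `c • x` of a fixed vector, `φ - 1` acts by `c ↦ c ^ q - c`, which is surjective
since the Artin–Schreier polynomial is separable. -/
theorem exists_sub_eq_of_mem_span_fixed [IsSepClosed K] (hq : 1 < q) (hq0 : (q : K) = 0)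
    (hs : ∀ a, s a = a ^ q) (φ : V →ₛₗ[s] V) {w : V}
    (hw : w ∈ Submodule.span K {x | φ x = x}) :
    ∃ u ∈ Submodule.span K {x | φ x = x}, φ u - u = w := by
  have hroot : ∀ a : K, ∃ c : K, c ^ q - c = a := by
    intro a
    have hsep : (X ^ q - X - C a : K[X]).Separable := by
      rw [separable_def]
      have hqp : (C (q : K) : K[X]) = 0 := by rw [hq0, C_0]
      simp only [derivative_sub, derivative_X_pow, hqp, derivative_X, derivative_C]
      exact ⟨0, -1, by ring⟩
    have hd : (X ^ q - X - C a : K[X]).degree ≠ 0 := by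
      have : (X ^ q - X - C a : K[X]).natDegree = q := by
        rw [sub_sub]
        rw [natDegree_sub_eq_left_of_natDegree_lt, natDegree_X_pow]
        rw [natDegree_X_pow]
        exact (natDegree_X_add_C a).trans_lt hq
      refine degree_ne_of_natDegree_ne (n := 0) ?_
      rw [this]
      omega
    obtain ⟨c, hc⟩ := IsSepClosed.exists_root _ hd hsep
    refine ⟨c, ?_⟩
    simpa [IsRoot, sub_eq_zero] using hc
  rw [Finsupp.mem_span_iff_linearCombination] at hw
  obtain ⟨l, rfl⟩ := hw
  choose r hr using hroot
  refine ⟨l.sum fun x a => r a • (x : V), ?_, ?_⟩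
  · exact Submodule.sum_mem _ fun x _ => Submodule.smul_mem _ _ (Submodule.subset_span x.2)
  · rw [Finsupp.linearCombination_apply, Finsupp.sum, Finsupp.sum, map_sum, ← Finset.sum_sub_distrib]
    refine Finset.sum_congr rfl fun x _ => ?_
    rw [map_smulₛₗ, hs, show φ x = x from x.2, ← sub_smul, hr]

/-- Over a separably closed field an étale Frobenius module is spanned by its fixed vectors. -/
theorem span_fixed_eq_top [IsSepClosed K] [FiniteDimensional K V] (hq : 1 < q)
    (hq0 : (q : K) = 0) (hs : ∀ a, s a = a ^ q) (φ : V →ₛₗ[s] V)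
    (h : Submodule.span K (Set.range φ) = ⊤) : Submodule.span K {x | φ x = x} = ⊤ := by
  by_contra hne
  set V' := Submodule.span K {x | φ x = x} with hV'
  have hmap : V' ≤ V'.comap φ := by
    rw [hV', Submodule.span_le]
    intro x hx
    refine Submodule.subset_span ?_
    rw [Set.mem_ofPred_eq] at hx ⊢
    rw [hx, hx]
  -- A nonzero fixed vector of the quotient lifts to some `x` with `φ x - x ∈ V'`. Correcting `x` by
  -- an element of `V'` makes it fixed, so `x` was in `V'` already.
  let ψ : V ⧸ V' →ₛₗ[s] V ⧸ V' := V'.mapQ V' φ hmap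
  have : Nontrivial (V ⧸ V') := Submodule.Quotient.nontrivial_iff.2 hne
  have hψ : Submodule.span K (Set.range ψ) = ⊤ := by
    rw [eq_top_iff]
    rintro x -
    obtain ⟨x, rfl⟩ := V'.mkQ_surjective x
    have hx : x ∈ Submodule.span K (Set.range φ) := h ▸ Submodule.mem_top
    have := Submodule.mem_map_of_mem (f := V'.mkQ) hx
    rw [Submodule.map_span] at this
    refine Submodule.span_mono ?_ this
    rintro _ ⟨_, ⟨y, rfl⟩, rfl⟩
    exact ⟨V'.mkQ y, rfl⟩
  obtain ⟨x, hx, hx0⟩ := exists_fixed_ne_zero hq hq0 hs ψ hψ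
  obtain ⟨x, rfl⟩ := V'.mkQ_surjective x
  have hx' : φ x - x ∈ V' := (Submodule.Quotient.eq _).1 hx
  obtain ⟨u, hu, hux⟩ := exists_sub_eq_of_mem_span_fixed hq hq0 hs φ hx'
  apply hx0
  rw [Submodule.mkQ_apply, Submodule.Quotient.mk_eq_zero]
  have : x - u ∈ V' := Submodule.subset_span (by
    rw [Set.mem_ofPred_eq, map_sub]
    have := sub_eq_sub_iff_add_eq_add.1 hux
    rw [sub_eq_sub_iff_add_eq_add, add_comm x, ← this, add_comm])
  simpa using V'.add_mem this hu


theorem exists_seq_of_strong {V : Type*} [Nonempty V] (P : ℕ → (ℕ → V) → V → Prop)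
    (hP : ∀ n f, ∃ v, P n f v) (hext : ∀ n f g v, (∀ b < n, f b = g b) → P n f v → P n g v) :
    ∃ x : ℕ → V, ∀ n, P n x (x n) := by
  have := Classical.inhabited_of_nonempty ‹Nonempty V›
  choose S hS using hP
  let x : ℕ → V := fun n => Nat.strongRec (motive := fun _ => V)
    (fun n ih => S n (fun m => if h : m < n then ih m h else default)) n
  have hx : ∀ n, x n = S n (fun m => if m < n then x m else default) := by
    intro n
    change Nat.strongRec (motive := fun _ => V) _ n = _
    rw [Nat.strongRec_eq]
    rfl
  refine ⟨x, fun n => ?_⟩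
  have := hS n (fun m => if m < n then x m else default)
  rw [← hx] at this
  exact hext n _ _ _ (fun b hb => if_pos hb) this

section PowerSeries

variable {n : Type*} [Fintype n]

theorem coeff_mulVec {A : Type*} [CommRing A] (Φ : Matrix n n A⟦X⟧) (x : n → A⟦X⟧) (m : ℕ) (i : n) :
    PowerSeries.coeff m ((Φ.mulVec x) i) = ∑ p ∈ Finset.HasAntidiagonal.antidiagonal m,
      ((Φ.map (PowerSeries.coeff p.1)).mulVec (fun j => PowerSeries.coeff p.2 (x j))) i := by
  simp only [Matrix.mulVec, dotProduct, map_sum, PowerSeries.coeff_mul, Matrix.map_apply]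
  exact Finset.sum_comm

variable [DecidableEq n] [IsSepClosed K]

/-- Lang's theorem for `GL_n(K⟦X⟧)`, with `K` separably closed and `σ` the `q`-Frobenius on
coefficients. -/
theorem exists_lang_matrix (hq : 1 < q) (hq0 : (q : K) = 0) (σ : K⟦X⟧ →+* K⟦X⟧)
    (hσ : ∀ f m, PowerSeries.coeff m (σ f) = PowerSeries.coeff m f ^ q)
    (Φ : Matrix n n K⟦X⟧) (hΦ : IsUnit Φ.det) :
    ∃ U : Matrix n n K⟦X⟧, IsUnit U.det ∧ Φ * U.map σ = U := by
  let s : K →+* K := (PowerSeries.constantCoeff.comp σ).comp PowerSeries.C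
  have hs : ∀ a, s a = a ^ q := by
    intro a
    change PowerSeries.constantCoeff (σ (PowerSeries.C a)) = _
    rw [← PowerSeries.coeff_zero_eq_constantCoeff_apply, hσ]
    simp
  let Φc : ℕ → Matrix n n K := fun m => Φ.map (PowerSeries.coeff m)
  have hΦ0 : IsUnit (Φc 0).det := by
    have := hΦ.map (PowerSeries.constantCoeff (R := K))
    rw [RingHom.map_det] at this
    convert this using 3
    ext i j
    exact PowerSeries.coeff_zero_eq_constantCoeff_apply _
  let φ : (n → K) →ₛₗ[s] (n → K) :=
    { toFun := fun x => (Φc 0).mulVec (fun j => s (x j))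
      map_add' := fun x y => by
        rw [← Matrix.mulVec_add]; congr 1; funext j; simp
      map_smul' := fun a x => by
        rw [← Matrix.mulVec_smul]; congr 1; funext j; simp }
  have hspan : Submodule.span K (Set.range φ) = ⊤ := by
    rw [eq_top_iff]
    rintro y -
    have hy : y = ∑ j, ((Φc 0)⁻¹.mulVec y) j • φ (Pi.single j 1) := by
      have h1 : ∀ j, φ (Pi.single j 1) = (Φc 0).mulVec (Pi.single j 1) := by
        intro j
        change (Φc 0).mulVec _ = _
        congr 1
        funext i
        rcases eq_or_ne i j with rfl | h <;> simp [*] <;> omega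
      simp only [h1, ← Matrix.mulVec_smul]
      rw [← Matrix.mulVec_sum]
      have h2 : ∑ j, ((Φc 0)⁻¹.mulVec y) j • (Pi.single j (1 : K) : n → K) = (Φc 0)⁻¹.mulVec y :=
        (pi_eq_sum_univ' _).symm
      rw [h2, Matrix.mulVec_mulVec, Matrix.mul_nonsing_inv _ hΦ0, Matrix.one_mulVec]
    rw [hy]
    exact Submodule.sum_mem _ fun j _ => Submodule.smul_mem _ _ (Submodule.subset_span ⟨_, rfl⟩)
  have hfix := span_fixed_eq_top hq hq0 hs φ hspan
  have hsurj : ∀ w, ∃ u, φ u - u = w := fun w => by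
    obtain ⟨u, -, hu⟩ := exists_sub_eq_of_mem_span_fixed hq hq0 hs φ
      (show w ∈ _ from hfix ▸ Submodule.mem_top)
    exact ⟨u, hu⟩
  -- A solution modulo `X` is lifted coefficient by coefficient; each new coefficient solves an
  -- inhomogeneous equation for `φ - 1`, which is surjective.
  have hlift : ∀ x0, φ x0 = x0 → ∃ x : n → K⟦X⟧, Φ.mulVec (fun j => σ (x j)) = x ∧
      ∀ j, PowerSeries.constantCoeff (x j) = x0 j := by
    intro x0 hx0
    -- `w r` collects the terms of the coefficient of index `r + 1` in `Φ σ(x)` that involve only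
    -- the coefficients of `x` up to `r`.
    let w : ℕ → (ℕ → n → K) → n → K := fun m f =>
      ∑ p ∈ Finset.HasAntidiagonal.antidiagonal m, (Φc (p.1 + 1)).mulVec (fun j => s (f p.2 j))
    obtain ⟨x, hx⟩ := exists_seq_of_strong (V := n → K)
      (fun m f v => (m = 0 → v = x0) ∧ ∀ r, m = r + 1 → φ v + w r f = v) (by
        intro m f
        obtain _ | r := m
        · exact ⟨x0, fun _ => rfl, fun r hr => by omega⟩
        · obtain ⟨u, hu⟩ := hsurj (-w r f)
          refine ⟨u, fun h => by omega, fun r' hr' => ?_⟩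
          obtain rfl : r = r' := by omega
          rw [sub_eq_iff_eq_add] at hu
          rw [hu]; abel) (by
        rintro m f g v hfg ⟨h1, h2⟩
        refine ⟨h1, fun r hr => ?_⟩
        refine Eq.trans (congrArg (φ v + ·) ?_) (h2 r hr)
        refine Finset.sum_congr rfl fun p hp => ?_
        have := Finset.HasAntidiagonal.antidiagonal.snd_le hp
        rw [hfg p.2 (by omega)])
    have hx00 : x 0 = x0 := (hx 0).1 rfl
    refine ⟨fun j => PowerSeries.mk fun m => x m j, ?_, fun j => ?_⟩
    · funext i
      ext m
      rw [coeff_mulVec]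
      simp only [hσ, PowerSeries.coeff_mk, ← hs]
      obtain _ | r := m
      · simp only [Finset.Nat.antidiagonal_zero, Finset.sum_singleton]
        rw [hx00]
        exact congrFun hx0 i
      · rw [Finset.Nat.sum_antidiagonal_succ]
        have := congrFun ((hx (r + 1)).2 r rfl) i
        rw [← this, Pi.add_apply]
        exact congrArg (_ + ·) (Finset.sum_apply i _ _).symm
    · rw [← PowerSeries.coeff_zero_eq_constantCoeff_apply, PowerSeries.coeff_mk, hx00]
  let b := Module.Basis.ofSpan hfix.ge
  have hb : ∀ i, φ (b i) = b i := fun i => Module.Basis.ofSpan_subset hfix.ge ⟨i, rfl⟩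
  let e : _ ≃ n := b.indexEquiv (Pi.basisFun K n)
  let b' := b.reindex e
  have hb' : ∀ i, φ (b' i) = b' i := fun i => by simp [b', hb]
  choose x hx hx0 using fun i => hlift (b' i) (hb' i)
  refine ⟨Matrix.of fun i j => x j i, ?_, ?_⟩
  -- Modulo `X` the matrix is the change of basis from the standard basis to the basis of fixed
  -- vectors.
  · rw [PowerSeries.isUnit_iff_constantCoeff, RingHom.map_det]
    have h1 := (Pi.basisFun K n).isUnit_det b'
    rw [Module.Basis.det_apply] at h1
    convert h1 using 2
    ext i j
    simp [hx0, Module.Basis.toMatrix_apply]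
  · ext i j : 1
    have := congrFun (hx j) i
    simpa [Matrix.mul_apply, Matrix.mulVec, dotProduct] using this

end PowerSeries

end Lang
end

/-! ### Bases of base changes, and coordinates on `E ⊗ B`. -/

noncomputable section

namespace BaseChange

variable {A B : Type*} [CommRing A] [CommRing B] (f : A →+* B)
  {M : Type*} [AddCommGroup M] [Module A M] {n : Type*}

/-- The basis of a base change induced by a basis. -/
def basis (b : Module.Basis n A M) : Module.Basis n B (BaseChange f M) :=
  letI := f.toAlgebra
  b.baseChange B

theorem basis_apply (b : Module.Basis n A M) (i : n) : basis f b i = mk f (b i) := by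
  letI := f.toAlgebra
  exact Module.Basis.baseChange_apply B b i

theorem mk_eq_sum [Fintype n] (b : Module.Basis n A M) (m : M) :
    mk f m = ∑ i, f (b.repr m i) • basis f b i := by
  conv_lhs => rw [← b.sum_repr m]
  rw [_root_.map_sum]
  exact Finset.sum_congr rfl fun i _ => by rw [map_smulₛₗ, basis_apply]

theorem basis_repr_mk [Finite n] (b : Module.Basis n A M) (m : M) (i : n) :
    (basis f b).repr (mk f m) i = f (b.repr m i) := by
  have := Fintype.ofFinite n
  rw [mk_eq_sum f b m, Module.Basis.repr_sum_self]

theorem toMatrix_map [Fintype n] [DecidableEq n] (b : Module.Basis n A M) (g : Module.End A M) :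
    LinearMap.toMatrix (basis f b) (basis f b) (map f g) = (LinearMap.toMatrix b b g).map f := by
  ext i j
  rw [LinearMap.toMatrix_apply, basis_apply, map_mk, basis_repr_mk, Matrix.map_apply,
    LinearMap.toMatrix_apply]

theorem mk_injective [Finite n] (b : Module.Basis n A M) (hf : Function.Injective f) :
    Function.Injective (mk f : M → BaseChange f M) := by
  intro x y hxy
  apply b.repr.injective
  ext i
  apply hf
  rw [← basis_repr_mk, ← basis_repr_mk, hxy]

theorem along_basis {C : Type*} [CommRing C] (h : B →+* C) (g : A →+* C) (hg : h.comp f = g)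
    (b : Module.Basis n A M) (i : n) : along f h g hg (basis f b i) = basis g b i := by
  rw [basis_apply, along_mk, basis_apply]

theorem basis_repr_along [Finite n] {C : Type*} [CommRing C] (h : B →+* C) (g : A →+* C)
    (hg : h.comp f = g) (b : Module.Basis n A M) (x : BaseChange f M) (i : n) :
    (basis g b).repr (along f h g hg x) i = h ((basis f b).repr x i) := by
  have := Fintype.ofFinite n
  conv_lhs => rw [← (basis f b).sum_repr x]
  rw [_root_.map_sum]
  simp only [map_smulₛₗ, along_basis]
  rw [Module.Basis.repr_sum_self]

namespace Ring

variable {E : Type*} [CommRing E] [Algebra A E]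

/-- Coordinates on `E ⊗_{A,f} B` with respect to a basis of `E`. -/
def coord (b : Module.Basis n A E) : Ring f E ≃+ (n →₀ B) :=
  letI := f.toAlgebra
  ((b.baseChange B).repr : B ⊗[A] E ≃ₗ[B] _).toAddEquiv

theorem coord_inl_mul (b : Module.Basis n A E) (c : B) (x : Ring f E) :
    coord f b (inl f E c * x) = c • coord f b x := by
  letI := f.toAlgebra
  refine Eq.trans ?_ ((b.baseChange B).repr.map_smul c x)
  change (b.baseChange B).repr _ = (b.baseChange B).repr _
  congr 1
  exact (Algebra.smul_def (A := B ⊗[A] E) c x).symm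

theorem coord_inr (b : Module.Basis n A E) (i : n) :
    coord f b (inr f E (b i)) = Finsupp.single i 1 := by
  letI := f.toAlgebra
  have := (b.baseChange B).repr_self i
  rw [Module.Basis.baseChange_apply] at this
  exact this

theorem inr_algebraMap (a : A) : inr f E (algebraMap A E a) = inl f E (f a) := by
  letI := f.toAlgebra
  change (1 : B) ⊗ₜ[A] (algebraMap A E a) = (f a) ⊗ₜ[A] (1 : E)
  rw [Algebra.algebraMap_eq_smul_one, TensorProduct.tmul_smul, TensorProduct.smul_tmul',
    Algebra.smul_def, mul_one]
  rfl

theorem eq_sum_coord [Fintype n] (b : Module.Basis n A E) (x : Ring f E) :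
    x = ∑ i, inl f E (coord f b x i) * inr f E (b i) := by
  apply (coord f b).injective
  rw [_root_.map_sum]
  simp only [coord_inl_mul, coord_inr]
  ext i
  simp [Finsupp.finsetSum_apply]

theorem coord_sum [Fintype n] (b : Module.Basis n A E) (c : n → B) (i : n) :
    coord f b (∑ i, inl f E (c i) * inr f E (b i)) i = c i := by
  rw [_root_.map_sum]
  simp only [coord_inl_mul, coord_inr]
  classical
  simp [Finsupp.finsetSum_apply, Finsupp.single_apply]

theorem induction {p : Ring f E → Prop} (h : ∀ (c : B) (e : E), p (inl f E c * inr f E e))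
    (hadd : ∀ x y, p x → p y → p (x + y)) (x : Ring f E) : p x := by
  letI := f.toAlgebra
  refine TensorProduct.induction_on (motive := p) x ?_ ?_ hadd
  · have := h 0 0
    rwa [_root_.map_zero, zero_mul] at this
  · intro c e
    have := h c e
    change p ((c ⊗ₜ[A] (1 : E)) * ((1 : B) ⊗ₜ[A] e)) at this
    rwa [Algebra.TensorProduct.tmul_mul_tmul, mul_one, one_mul] at this

theorem ringHom_ext {T : Type*} [_root_.Ring T] {g h : Ring f E →+* T}
    (hl : ∀ c, g (inl f E c) = h (inl f E c)) (hr : ∀ e, g (inr f E e) = h (inr f E e)) : g = h := by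
  ext x
  refine induction f (p := fun x => g x = h x) (fun c e => ?_) (fun x y hx hy => ?_) x
  · rw [_root_.map_mul, _root_.map_mul, hl, hr]
  · rw [_root_.map_add, _root_.map_add, hx, hy]

variable {T : Type*} [_root_.Ring T] (u : B →+* T) (hu : ∀ b x, u b * x = x * u b) (g : E →+* T)
    (h : ∀ a, g (algebraMap A E a) = u (f a))

theorem lift_inl (c : B) : lift f u hu g h (inl f E c) = u c := by
  letI := f.toAlgebra
  refine (tensorLift_tmul u hu g h c 1).trans ?_
  rw [map_one, mul_one]

theorem lift_inr (e : E) : lift f u hu g h (inr f E e) = g e := by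
  letI := f.toAlgebra
  refine (tensorLift_tmul u hu g h 1 e).trans ?_
  rw [map_one, one_mul]

end Ring

end BaseChange

/-! ### The determinant of an orbit as a polynomial in the coordinates of the vector. -/

section Generator

variable {A : Type*} [CommRing A] {M : Type*} [AddCommGroup M] [Module A M]
  {n : Type*} [Fintype n] [DecidableEq n]

/-- The polynomial whose value at the coordinates of `x` is the determinant of `(fⱼ x)ⱼ`. -/
def orbitDet (b : Module.Basis n A M) (f : n → Module.End A M) : MvPolynomial n A :=
  (Matrix.of fun i j => ∑ l, MvPolynomial.C (LinearMap.toMatrix b b (f j) i l) *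
    MvPolynomial.X l : Matrix n n (MvPolynomial n A)).det

theorem eval_orbitDet (b : Module.Basis n A M) (f : n → Module.End A M) (x : M) :
    MvPolynomial.eval (fun l => b.repr x l) (orbitDet b f) = b.det fun j => f j x := by
  rw [orbitDet, RingHom.map_det, Module.Basis.det_apply]
  congr 1
  ext i j
  rw [RingHom.mapMatrix_apply, Matrix.map_apply, Matrix.of_apply, map_sum, Module.Basis.toMatrix_apply]
  simp only [map_mul, MvPolynomial.eval_C, MvPolynomial.eval_X]
  have := congrFun (LinearMap.toMatrix_mulVec_repr b b (f j) x) i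
  exact this

/-- This compatibility carries nonvanishing from the Tate module to the de Rham side: both are
governed by one polynomial over `R⟦z⟧`. -/
theorem map_orbitDet {B : Type*} [CommRing B] (g : A →+* B) (b : Module.Basis n A M)
    (f : n → Module.End A M) :
    MvPolynomial.map g (orbitDet b f) =
      orbitDet (BaseChange.basis g b) (fun j => BaseChange.map g (f j)) := by
  rw [orbitDet, orbitDet, RingHom.map_det]
  congr 1
  ext i j : 1
  rw [RingHom.mapMatrix_apply, Matrix.map_apply, Matrix.of_apply, Matrix.of_apply, map_sum]
  simp only [map_mul, MvPolynomial.map_C, MvPolynomial.map_X, BaseChange.toMatrix_map,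
    Matrix.map_apply]

theorem exists_det_ne_zero [IsDomain A] [Infinite A] {b : Module.Basis n A M}
    {f : n → Module.End A M} (h : orbitDet b f ≠ 0) : ∃ x : M, b.det (fun j => f j x) ≠ 0 := by
  by_contra! hn
  apply h
  refine MvPolynomial.funext fun c => ?_
  have := hn (∑ i, c i • b i)
  rw [← eval_orbitDet] at this
  rw [map_zero, ← this]
  congr 2
  funext l
  rw [Module.Basis.repr_sum_self]

theorem orbitDet_ne_zero {b : Module.Basis n A M} {f : n → Module.End A M} {x : M}
    (hx : b.det (fun j => f j x) ≠ 0) : orbitDet b f ≠ 0 := by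
  intro h
  rw [← eval_orbitDet, h, map_zero] at hx
  exact hx rfl

theorem linearIndependent_of_det_ne_zero [IsDomain A] (b : Module.Basis n A M) {v : n → M}
    (h : b.det v ≠ 0) : LinearIndependent A v := by
  rw [Fintype.linearIndependent_iff]
  intro g hg
  have h1 : (b.toMatrix v).mulVec g = 0 := by
    funext i
    have := congrArg (fun x => b.repr x i) hg
    simp only [map_sum, map_smul, Finsupp.finsetSum_apply, Finsupp.smul_apply, map_zero,
      Finsupp.zero_apply, smul_eq_mul] at this
    simp only [Matrix.mulVec, dotProduct, Module.Basis.toMatrix_apply, Pi.zero_apply]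
    rw [← this]
    exact Finset.sum_congr rfl fun j _ => mul_comm _ _
  have := Matrix.eq_zero_of_mulVec_eq_zero (by rwa [Module.Basis.det_apply] at h) h1
  exact congrFun this

theorem det_ne_zero_of_linearIndependent [IsDomain A] (b : Module.Basis n A M) {v : n → M}
    (h : LinearIndependent A v) : b.det v ≠ 0 := by
  rw [Module.Basis.det_apply]
  intro h0
  obtain ⟨g, hg0, hg⟩ := Matrix.exists_mulVec_eq_zero_iff.2 h0
  apply hg0
  funext j
  refine Fintype.linearIndependent_iff.1 h g ?_ j
  apply b.repr.injective
  ext i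
  have := congrFun hg i
  simp only [Matrix.mulVec, dotProduct, Module.Basis.toMatrix_apply, Pi.zero_apply] at this
  simp only [map_sum, map_smul, Finsupp.finsetSum_apply, Finsupp.smul_apply, map_zero,
      Finsupp.zero_apply, smul_eq_mul]
  rw [← this]
  exact Finset.sum_congr rfl fun j _ => mul_comm _ _

end Generator
end

/-! ### The Tate module: invariant bases, faithfulness and cyclic vectors. -/

noncomputable section

/-- Over `k` the polynomial `X^q - X` is the product of all `X - c`, so a root in `K` equals the
image of some `c`. -/
theorem exists_mem_of_pow_card_eq {k K : Type*} [Field k] [Fintype k] [Field K] (φ : k →+* K)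
    {a : K} (ha : a ^ Fintype.card k = a) : ∃ c, φ c = a := by
  open Polynomial in
  have h1 : (X ^ Fintype.card k - X : k[X]).Monic := by
    apply monic_X_pow_sub
    rw [degree_X]
    exact_mod_cast Fintype.one_lt_card
  have h2 := prod_multiset_X_sub_C_of_monic_of_roots_card_eq h1 (by
    rw [FiniteField.roots_X_pow_card_sub_X,
      FiniteField.X_pow_card_sub_X_natDegree_eq _ Fintype.one_lt_card]
    rfl)
  rw [FiniteField.roots_X_pow_card_sub_X] at h2
  have h3 := congrArg (eval₂ φ a) h2
  change eval₂ φ a (∏ c : k, (X - C c)) = _ at h3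
  rw [eval₂_finsetProd] at h3
  simp only [eval₂_sub, eval₂_X, eval₂_C, eval₂_pow, ha, sub_self] at h3
  obtain ⟨c, -, hc⟩ := Finset.prod_eq_zero_iff.1 h3
  exact ⟨c, (sub_eq_zero.1 hc).symm⟩

/-- A faithful module over a commutative semisimple ring contains a vector with trivial
annihilator. -/
theorem exists_annihilator_eq_bot {E V : Type*} [CommRing E] [IsSemisimpleRing E] [AddCommGroup V]
    [Module E V] (h : ∀ e : E, (∀ v : V, e • v = 0) → e = 0) :
    ∃ v : V, ∀ e : E, e • v = 0 → e = 0 := by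
  let A : V → Ideal E := fun v => LinearMap.ker (LinearMap.toSpanSingleton E V v)
  have hA : ∀ v e, e ∈ A v ↔ e • v = 0 := fun v e => Iff.rfl
  -- Take `v` with minimal annihilator. The latter is generated by an idempotent `i`; if `i • w ≠ 0`
  -- for some `w`, then `v + i • w` has a strictly smaller annihilator.
  obtain ⟨-, ⟨v, rfl⟩, hmin⟩ := IsArtinian.set_has_minimal (Set.range A) ⟨_, 0, rfl⟩
  refine ⟨v, fun e he => ?_⟩
  obtain ⟨i, hi, hs⟩ := IsSemisimpleRing.ideal_eq_span_idempotent (A v)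
  have hiv : i • v = 0 := by
    rw [← hA, hs]
    exact Ideal.mem_span_singleton_self i
  suffices h0 : i = 0 by
    rw [← hA, hs, h0, Ideal.span_singleton_zero] at he
    exact he
  refine h i fun w => ?_
  by_contra hw
  refine hmin (A (v + i • w)) ⟨_, rfl⟩ (lt_of_le_of_ne ?_ ?_)
  · intro x hx
    rw [hA] at hx ⊢
    have h1 : i • x • (v + i • w) = 0 := by rw [hx, smul_zero]
    rw [smul_comm, smul_add, hiv, zero_add, ← mul_smul i i, hi.eq] at h1
    rwa [smul_add, h1, add_zero] at hx
  · intro heq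
    apply hw
    have : i ∈ A (v + i • w) := by rw [heq, hs]; exact Ideal.mem_span_singleton_self i
    rwa [hA, smul_add, hiv, zero_add, ← mul_smul, hi.eq] at this

theorem one_tmul_smul {A Q N : Type*} [CommRing A] [CommRing Q] [Algebra A Q]
    [AddCommGroup N] [Module A N] (s : A) (x : N) :
    (1 : Q) ⊗ₜ[A] (s • x) = algebraMap A Q s • ((1 : Q) ⊗ₜ[A] x) := by
  rw [TensorProduct.tmul_smul, algebraMap_smul]

theorem exists_smul_eq_one_tmul {A Q N : Type*} [CommRing A] [IsDomain A] [Field Q] [Algebra A Q]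
    [IsFractionRing A Q] [AddCommGroup N] [Module A N] (x : Q ⊗[A] N) :
    ∃ s : A, s ≠ 0 ∧ ∃ t : N, algebraMap A Q s • x = 1 ⊗ₜ t := by
  induction x with
  | zero => exact ⟨1, one_ne_zero, 0, by simp⟩
  | tmul a n =>
    obtain ⟨r, s, hs, rfl⟩ := IsFractionRing.div_surjective (A := A) a
    have hs0 := nonZeroDivisors.ne_zero hs
    refine ⟨s, hs0, r • n, ?_⟩
    have : algebraMap A Q s ≠ 0 := by
      simpa using (IsFractionRing.injective A Q).ne hs0
    rw [TensorProduct.smul_tmul', smul_eq_mul, mul_div_cancel₀ _ this, TensorProduct.tmul_smul,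
      TensorProduct.smul_tmul', Algebra.smul_def, mul_one]
  | add x y hx hy =>
    obtain ⟨s, hs, t, h⟩ := hx
    obtain ⟨s', hs', t', h'⟩ := hy
    refine ⟨s * s', mul_ne_zero hs hs', s' • t + s • t', ?_⟩
    rw [smul_add, map_mul, mul_smul, mul_smul, h', smul_comm, h, TensorProduct.tmul_add,
      one_tmul_smul, one_tmul_smul]

namespace LocalShtuka

variable {k : Type*} {R : Type*} [Field k] [Fintype k] [CommRing R] [IsLocalRing R] [Algebra k R]
  {P : CharPoint R} (M : LocalShtuka k P)
  (L : Type*) [Field L] [Algebra R L] [IsFractionRing R L]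

theorem tauSep_mk (m : M.carrier) : M.tauSep L (BaseChange.mk _ m) =
    BaseChange.along P.toLoc (locToSep L P) (seriesToSep R L) (locToSep_comp L P)
    (M.τ (BaseChange.mk P.toLoc (BaseChange.mk (sigmaHat k R) m))) :=
  BaseChange.extend_mk _ _ _

variable {n : Type*} [Fintype n] [DecidableEq n]

/-- `τ` is invertible over `R⟦z⟧[1/(z-ζ)]`, and this ring maps to `L^sep⟦z⟧`. This is the hypothesis
needed for Lang's theorem. -/
theorem isUnit_toMatrix_tauSep (b : Module.Basis n R⟦X⟧ M.carrier) :
    IsUnit ((BaseChange.basis (seriesToSep R L) b).toMatrix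
      (fun j => M.tauSep L (BaseChange.basis (seriesToSep R L) b j))).det := by
  let bl := BaseChange.basis P.toLoc b
  let bs := BaseChange.basis P.toLoc (BaseChange.basis (sigmaHat k R) b)
  have h := (bl.isUnit_det (bs.map M.τ)).map (locToSep L P)
  rw [Module.Basis.det_apply, RingHom.map_det] at h
  convert h using 2
  ext i j : 1
  rw [RingHom.mapMatrix_apply, Matrix.map_apply, Module.Basis.toMatrix_apply,
    Module.Basis.toMatrix_apply, BaseChange.basis_apply, tauSep_mk, BaseChange.basis_repr_along,
    Module.Basis.map_apply, BaseChange.basis_apply, BaseChange.basis_apply]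

theorem exists_fixed_basis (b : Module.Basis n R⟦X⟧ M.carrier) :
    ∃ u : Module.Basis n (SeparableClosure L)⟦X⟧ (M.sepModule L), ∀ j, M.tauSep L (u j) = u j := by
  let bs := BaseChange.basis (seriesToSep R L) b
  obtain ⟨U, hU, hΦ⟩ := exists_lang_matrix (q := Fintype.card k) Fintype.one_lt_card (by
      rw [← map_natCast (toSep k R L), FiniteField.cast_card_eq_zero, map_zero]) (sigmaSep k R L) (fun f m => coeff_frobSeries _ f m) _
    (M.isUnit_toMatrix_tauSep L b)
  have hu : IsUnit (bs.det fun j => ∑ i, U i j • bs i) := by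
    rw [Module.Basis.det_apply]
    convert hU using 2
    ext i j : 1
    rw [Module.Basis.toMatrix_apply, Module.Basis.repr_sum_self]
  obtain ⟨h1, h2⟩ := (Module.Basis.is_basis_iff_det bs).2 hu
  refine ⟨Module.Basis.mk h1 h2.ge, fun j => ?_⟩
  rw [Module.Basis.mk_apply]
  apply bs.repr.injective
  ext i : 1
  rw [Module.Basis.repr_sum_self, map_sum, map_sum]
  conv_rhs => rw [← hΦ]
  simp only [map_smulₛₗ, Finsupp.finsetSum_apply, Finsupp.smul_apply, Matrix.mul_apply,
    Module.Basis.toMatrix_apply, Matrix.map_apply, smul_eq_mul]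
  exact Finset.sum_congr rfl fun l _ => mul_comm _ _

theorem smul_tate_val (a : k⟦X⟧) (x : M.tateModule L) :
    (a • x).1 = PowerSeries.map (toSep k R L) a • x.1 := rfl

/-- A basis of `M ⊗ L^sep⟦z⟧` of `τ`-invariant vectors is a basis of the Tate module. -/
theorem exists_tate_basis (b : Module.Basis n R⟦X⟧ M.carrier) :
    ∃ (u : Module.Basis n (SeparableClosure L)⟦X⟧ (M.sepModule L))
      (t : Module.Basis n k⟦X⟧ (M.tateModule L)), ∀ j, (t j).1 = u j := by
  obtain ⟨u, hu⟩ := M.exists_fixed_basis L b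
  let v : n → M.tateModule L := fun j => ⟨u j, hu j⟩
  have hval : ∀ c : n → k⟦X⟧, (∑ j, c j • v j).1 =
      ∑ j, PowerSeries.map (toSep k R L) (c j) • u j := by
    intro c
    rw [AddSubmonoidClass.coe_finsetSum]
    rfl
  have hinj : Function.Injective (PowerSeries.map (toSep k R L)) :=
    PowerSeries.map_injective _ (toSep k R L).injective
  have hli : LinearIndependent k⟦X⟧ v := by
    rw [Fintype.linearIndependent_iff]
    intro c hc j
    have h1 := congrArg Subtype.val hc
    rw [hval] at h1
    have := Fintype.linearIndependent_iff.1 u.linearIndependent _ h1 j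
    rwa [map_eq_zero_iff _ hinj] at this
  have hsp : ⊤ ≤ Submodule.span k⟦X⟧ (Set.range v) := by
    rintro ⟨x, hx⟩ -
    have hx' : M.tauSep L x = x := hx
    -- In a basis of invariant vectors the coordinates of an invariant vector are fixed by `σ̂`,
    -- hence their coefficients satisfy `a^q = a` and come from `k`.
    have hcoef : ∀ j, ∃ c, PowerSeries.map (toSep k R L) c = u.repr x j := by
      intro j
      have h1 : sigmaSep k R L (u.repr x j) = u.repr x j := by
        have h2 : M.tauSep L x = ∑ j, sigmaSep k R L (u.repr x j) • u j := by
          conv_lhs => rw [← u.sum_repr x]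
          rw [map_sum]
          exact Finset.sum_congr rfl fun i _ => by rw [map_smulₛₗ, hu]
        rw [hx'] at h2
        conv_rhs => rw [h2]
        rw [Module.Basis.repr_sum_self]
      have h3 : ∀ m, ∃ c, toSep k R L c = PowerSeries.coeff m (u.repr x j) := fun m =>
        exists_mem_of_pow_card_eq _ (by
          conv_rhs => rw [← h1]
          exact (coeff_frobSeries _ _ _).symm)
      choose c hc using h3
      exact ⟨PowerSeries.mk c, by ext m; simp [hc]⟩
    choose c hc using hcoef
    rw [Submodule.mem_span_range_iff_exists_fun]
    refine ⟨c, Subtype.ext ?_⟩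
    rw [hval]
    simp only [hc]
    exact u.sum_repr x
  exact ⟨u, Module.Basis.mk hli hsp, fun j => by rw [Module.Basis.mk_apply]⟩

theorem endTate_val (f : M.End) (x : M.tateModule L) :
    (M.endTate L f x).1 = BaseChange.map (seriesToSep R L) f.1 x.1 := rfl

theorem qEndTate_one_tmul (f : M.End) (x : M.tateModule L) :
    M.qEndTate L (1 ⊗ₜ f) (1 ⊗ₜ x) = 1 ⊗ₜ (M.endTate L f x) := by
  rw [qEndTate, tensorLift_tmul, map_one, one_mul]
  rfl

theorem seriesToSep_injective : Function.Injective (seriesToSep R L) :=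
  PowerSeries.map_injective _
    ((algebraMap L (SeparableClosure L)).injective.comp (IsFractionRing.injective R L))

namespace CM

variable {M} {E : Type*} [CommRing E] [Algebra k⸨X⸩ E] (C : M.CM E)

theorem exists_smul_mem_end (e : E) : ∃ s : k⟦X⟧, s ≠ 0 ∧ ∃ f : M.End,
    C.ι (algebraMap k⟦X⟧ k⸨X⸩ s • e) = 1 ⊗ₜ f := by
  obtain ⟨s, hs, f, h⟩ := exists_smul_eq_one_tmul (C.ι e)
  exact ⟨s, hs, f, by rw [map_smul, h]⟩

theorem exists_basis_end [IsDomain R] [Module.Finite k⸨X⸩ E] :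
    ∃ (e : Module.Basis (Fin M.rank) k⸨X⸩ E) (f : Fin M.rank → M.End),
      ∀ j, C.ι (e j) = 1 ⊗ₜ f j := by
  let e := Module.finBasisOfFinrankEq k⸨X⸩ E C.finrank_eq
  choose s hs f hf using fun j => C.exists_smul_mem_end (e j)
  have hs' : ∀ j, IsUnit (algebraMap k⟦X⟧ k⸨X⸩ (s j)) := fun j =>
    isUnit_iff_ne_zero.2 (by simpa using (IsFractionRing.injective k⟦X⟧ k⸨X⸩).ne (hs j))
  exact ⟨e.isUnitSMul hs', f, fun j => by rw [Module.Basis.isUnitSMul_apply, hf]⟩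

theorem algebraMap_smul_tate (a : k⸨X⸩) (x : M.rationalTate L) :
    M.qEndTate L (C.ι (algebraMap k⸨X⸩ E a)) x = a • x := by
  have h : C.ι (algebraMap k⸨X⸩ E a) = a ⊗ₜ 1 := C.ι.commutes a
  rw [h, qEndTate, tensorLift_tmul, map_one, mul_one, Module.algebraMap_end_apply]

variable [IsDomain R] [Module.Finite k⸨X⸩ E] [IsSemisimpleRing E]

/-- Some multiple of `e` by a nonzero `s` is an honest endomorphism. It kills the Tate module, which
contains a basis of `M ⊗ L^sep⟦z⟧`, and `M` embeds into the latter. -/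
theorem eq_zero_of_smul_tate (e : E) (h : ∀ v : C.tate L, e • v = 0) : e = 0 := by
  obtain ⟨s, hs, f, hf⟩ := C.exists_smul_mem_end e
  let b := Module.finBasis R⟦X⟧ M.carrier
  obtain ⟨u, t, ht⟩ := M.exists_tate_basis L b
  have hs' : algebraMap k⟦X⟧ k⸨X⸩ s ≠ 0 := by
    simpa using (IsFractionRing.injective k⟦X⟧ k⸨X⸩).ne hs
  have h1 : ∀ x : M.tateModule L, M.endTate L f x = 0 := by
    intro x
    have h2 : M.qEndTate L (1 ⊗ₜ f) (1 ⊗ₜ x) = 0 := by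
      rw [← hf, Algebra.smul_def, map_mul, map_mul, Module.End.mul_apply]
      have : M.qEndTate L (C.ι e) (1 ⊗ₜ x) = 0 := h (1 ⊗ₜ x : M.rationalTate L)
      rw [this, map_zero]
    rw [qEndTate_one_tmul] at h2
    apply t.repr.injective
    ext i : 1
    have h3 := congrArg (fun y => (t.baseChange k⸨X⸩).repr y i) h2
    simp only [Module.Basis.baseChange_repr_tmul, map_zero, Finsupp.zero_apply] at h3
    rw [Algebra.smul_def, mul_one] at h3
    rw [map_zero, Finsupp.zero_apply]
    exact (map_eq_zero_iff _ (IsFractionRing.injective k⟦X⟧ k⸨X⸩)).1 h3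
  have h4 : BaseChange.map (seriesToSep R L) f.1 = 0 := by
    refine u.ext fun j => ?_
    rw [← ht, ← endTate_val, h1]
    rfl
  have h5 : f = 0 := by
    ext m
    apply BaseChange.mk_injective (seriesToSep R L) b (seriesToSep_injective L)
    rw [← BaseChange.map_mk, h4]
    simp
  rw [h5, TensorProduct.tmul_zero, map_eq_zero_iff _ C.injective] at hf
  exact (smul_eq_zero_iff_right hs').1 hf

theorem exists_tate_generator : ∃ v : M.rationalTate L, ∀ e : E, M.qEndTate L (C.ι e) v = 0 → e = 0 :=
  exists_annihilator_eq_bot (C.eq_zero_of_smul_tate L)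

/-- The orbit map of a vector with trivial annihilator is injective, and both sides have dimension
`rk M` over `k((z))`. -/
theorem tate_equiv : Nonempty (C.tate L ≃ₗ[E] E) := by
  obtain ⟨v, hv⟩ := C.exists_tate_generator L
  let g : E →ₗ[k⸨X⸩] M.rationalTate L :=
    { toFun := fun e => M.qEndTate L (C.ι e) v
      map_add' := fun x y => by rw [map_add, map_add, LinearMap.add_apply]
      map_smul' := fun a x => by
        rw [Algebra.smul_def, map_mul, map_mul, Module.End.mul_apply, algebraMap_smul_tate]
        rfl }
  have hinj : Function.Injective g := by
    rw [injective_iff_map_eq_zero]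
    exact fun e he => hv e he
  obtain ⟨u, t, -⟩ := M.exists_tate_basis L (Module.finBasis R⟦X⟧ M.carrier)
  have : Module.Finite k⸨X⸩ (M.rationalTate L) := Module.Finite.of_basis (t.baseChange k⸨X⸩)
  have hsurj : Function.Surjective g := by
    refine (LinearMap.injective_iff_surjective_of_finrank_eq_finrank ?_).1 hinj
    rw [C.finrank_eq, Module.finrank_eq_card_basis (t.baseChange k⸨X⸩), Fintype.card_fin]
    rfl
  exact ⟨(LinearEquiv.ofBijective (LinearMap.toSpanSingleton E (C.tate L) (v : C.tate L)) ⟨hinj, hsurj⟩).symm⟩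

/-- Scaled into the lattice, a cyclic vector of the rational Tate module has an independent orbit
over `k⟦z⟧`. Since a basis of the lattice is also a basis of `M ⊗ L^sep⟦z⟧`, this gives a nonzero
value of the polynomial after base change. -/
theorem orbitDet_end_ne_zero (b : Module.Basis (Fin M.rank) R⟦X⟧ M.carrier)
    (e : Module.Basis (Fin M.rank) k⸨X⸩ E) (f : Fin M.rank → M.End)
    (hf : ∀ j, C.ι (e j) = 1 ⊗ₜ f j) : orbitDet b (fun j => (f j).1) ≠ 0 := by
  let L := FractionRing R
  obtain ⟨v, hv⟩ := C.exists_tate_generator L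
  obtain ⟨s, hs, h, hsv⟩ := exists_smul_eq_one_tmul (A := k⟦X⟧) (Q := k⸨X⸩) v
  have hs' : algebraMap k⟦X⟧ k⸨X⸩ s ≠ 0 := by
    simpa using (IsFractionRing.injective k⟦X⟧ k⸨X⸩).ne hs
  obtain ⟨u, t, ht⟩ := M.exists_tate_basis L b
  have hli : LinearIndependent k⟦X⟧ (fun j => M.endTate L (f j) h) := by
    rw [Fintype.linearIndependent_iff]
    intro c hc
    have h1 : M.qEndTate L (C.ι (∑ j, algebraMap k⟦X⟧ k⸨X⸩ (c j) • e j)) (1 ⊗ₜ h) = 0 := by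
      rw [map_sum, map_sum, LinearMap.sum_apply]
      have h2 : (1 : k⸨X⸩) ⊗ₜ[k⟦X⟧] (∑ j, c j • M.endTate L (f j) h) = 0 := by
        rw [hc, TensorProduct.tmul_zero]
      rw [TensorProduct.tmul_sum] at h2
      rw [← h2]
      refine Finset.sum_congr rfl fun j _ => ?_
      rw [Algebra.smul_def, map_mul, map_mul, Module.End.mul_apply, hf, qEndTate_one_tmul,
        algebraMap_smul_tate, one_tmul_smul]
    rw [← hsv, map_smul] at h1
    have h3 := hv _ ((IsUnit.mk0 _ hs').smul_eq_zero.1 h1)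
    intro j
    have := Fintype.linearIndependent_iff.1 e.linearIndependent _ h3 j
    exact (map_eq_zero_iff _ (IsFractionRing.injective k⟦X⟧ k⸨X⸩)).1 this
  have hdet := det_ne_zero_of_linearIndependent t hli
  let bs := BaseChange.basis (seriesToSep R L) b
  have hrepr : ∀ (x : M.tateModule L) i,
      u.repr x.1 i = PowerSeries.map (toSep k R L) (t.repr x i) := by
    intro x i
    have : x.1 = ∑ j, PowerSeries.map (toSep k R L) (t.repr x j) • u j := by
      conv_lhs => rw [← t.sum_repr x]
      rw [AddSubmonoidClass.coe_finsetSum]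
      refine Finset.sum_congr rfl fun j _ => ?_
      rw [smul_tate_val, ht]
    conv_lhs => rw [this]
    rw [Module.Basis.repr_sum_self]
  have hdet' : u.det (fun j => BaseChange.map (seriesToSep R L) (f j).1 h.1) ≠ 0 := by
    have h1 : u.det (fun j => BaseChange.map (seriesToSep R L) (f j).1 h.1) =
        PowerSeries.map (toSep k R L) (t.det fun j => M.endTate L (f j) h) := by
      rw [Module.Basis.det_apply, Module.Basis.det_apply, RingHom.map_det]
      congr 1
      ext i j : 1
      rw [RingHom.mapMatrix_apply, Matrix.map_apply, Module.Basis.toMatrix_apply,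
        Module.Basis.toMatrix_apply, ← hrepr, endTate_val]
    rw [h1]
    intro h0
    exact hdet ((map_eq_zero_iff _
      (PowerSeries.map_injective _ (toSep k R L).injective)).1 h0)
  have h1 := orbitDet_ne_zero (b := bs) (f := fun j => BaseChange.map (seriesToSep R L) (f j).1)
    (det_ne_zero_of_linearIndependent bs (linearIndependent_of_det_ne_zero u hdet'))
  rw [← map_orbitDet] at h1
  intro h0
  rw [h0, map_zero] at h1
  exact h1 rfl

end CM

end LocalShtuka
end

noncomputable section

/-! ### Fields of characteristic `p` with `[F : F^p] = p`. -/

section PBasis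

open Module

variable {F : Type*} [Field F] (p : ℕ) [hp : Fact p.Prime] [CharP F p]

/-- `F` has `p`-rank one: `[F : F^p] = p`. -/
def PRankOne : Prop := finrank (frobenius F p).fieldRange F = p

variable {p}

/-- `X^p - y^p` is irreducible over `F^p`: a root there would be a `p`-th root of `y^p`, hence `y`
itself. -/
theorem finrank_adjoin_of_notMem {y : F} (hy : y ∉ (frobenius F p).fieldRange) :
    finrank (frobenius F p).fieldRange (IntermediateField.adjoin (frobenius F p).fieldRange {y}) =
      p := by
  let A := (frobenius F p).fieldRange
  let a : A := ⟨y ^ p, y, rfl⟩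
  open Polynomial in
  have hirr : Irreducible (X ^ p - C a : A[X]) := by
    refine X_pow_sub_C_irreducible_of_prime hp.out fun b hb => hy ?_
    have h1 : frobenius F p b.1 = frobenius F p y := congrArg Subtype.val hb
    rw [← frobenius_inj F p h1]
    exact b.2
  have hroot : Polynomial.aeval y (Polynomial.X ^ p - Polynomial.C a : Polynomial A) = 0 := by
    simp only [map_sub, map_pow, Polynomial.aeval_X, Polynomial.aeval_C]
    exact sub_self _
  have hmonic := Polynomial.monic_X_pow_sub_C a hp.out.ne_zero
  have hmin := minpoly.eq_of_irreducible_of_monic hirr hroot hmonic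
  rw [IntermediateField.adjoin.finrank ⟨_, hmonic, hroot⟩, ← hmin, Polynomial.natDegree_X_pow_sub_C]

/-- By degrees `F = F^p(y)`. Phrasing this through subfields lets it be applied to equalizers and
preimages. -/
theorem PRankOne.eq_top (h : PRankOne (F := F) p) {y : F} (hy : y ∉ (frobenius F p).fieldRange)
    {S : Subfield F} (hS : ∀ x, x ^ p ∈ S) (hyS : y ∈ S) : S = ⊤ := by
  let A := (frobenius F p).fieldRange
  have hA : A ≤ S := by
    rintro _ ⟨x, rfl⟩
    exact hS x
  have h0 : FiniteDimensional A F := FiniteDimensional.of_finrank_pos (by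
    rw [show finrank A F = p from h]; exact hp.out.pos)
  have h1 : IntermediateField.adjoin A {y} = ⊤ := by
    rw [← IntermediateField.toSubalgebra_inj, IntermediateField.top_toSubalgebra,
      ← Algebra.toSubmodule_eq_top]
    refine Submodule.eq_top_of_finrank_eq ?_
    exact (finrank_adjoin_of_notMem hy).trans h.symm
  have h2 : IntermediateField.adjoin A {y} ≤ Subfield.extendScalars hA := by
    rw [IntermediateField.adjoin_le_iff]
    rintro _ rfl
    exact hyS
  rw [h1] at h2
  rw [eq_top_iff]
  intro x _
  exact h2 (IntermediateField.mem_top (x := x))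

theorem pRankOne_of_eq_top {y : F} (hy : y ∉ (frobenius F p).fieldRange)
    (h : ∀ S : Subfield F, (∀ x, x ^ p ∈ S) → y ∈ S → S = ⊤) : PRankOne (F := F) p := by
  let A := (frobenius F p).fieldRange
  have h1 : (IntermediateField.adjoin A {y}).toSubfield = ⊤ := by
    refine h _ (fun x => ?_) (IntermediateField.mem_adjoin_simple_self A y)
    exact (IntermediateField.adjoin A {y}).algebraMap_mem ⟨x ^ p, x, rfl⟩
  have h2 : IntermediateField.adjoin A {y} = ⊤ := by
    rw [eq_top_iff]
    intro x _
    have : x ∈ (⊤ : Subfield F) := trivial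
    rw [← h1] at this
    exact this
  have := finrank_adjoin_of_notMem hy
  rw [PRankOne, ← IntermediateField.finrank_top', ← h2]
  exact this

theorem PRankOne.exists_notMem (h : PRankOne (F := F) p) :
    ∃ y, y ∉ (frobenius F p).fieldRange := by
  by_contra! hn
  have : (frobenius F p).fieldRange = ⊤ := eq_top_iff.2 fun x _ => hn x
  have h1 := (Subfield.relfinrank_top_right (frobenius F p).fieldRange).symm
  rw [PRankOne, h1, this, Subfield.relfinrank_self] at h
  exact hp.out.one_lt.ne h

/-- The `p`-rank is invariant under finite extensions. -/
theorem PRankOne.of_finite {Q : Type*} [Field Q] [CharP Q p] [Algebra Q F] [FiniteDimensional Q F]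
    (h : PRankOne (F := Q) p) : PRankOne (F := F) p := by
  let Q' := (algebraMap Q F).fieldRange
  let A := (frobenius F p).fieldRange
  have hA : A = (⊤ : Subfield F).map (frobenius F p) := RingHom.fieldRange_eq_map _
  have hcomp : (frobenius F p).comp (algebraMap Q F) = (algebraMap Q F).comp (frobenius Q p) := by
    ext x; simp [frobenius_def]
  have h1 : Q'.map (frobenius F p) = (frobenius Q p).fieldRange.map (algebraMap Q F) := by
    simp only [Q', RingHom.fieldRange_eq_map, Subfield.map_map, hcomp]
  have hQ : Q'.map (frobenius F p) ≤ Q' := by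
    rw [h1]
    rintro _ ⟨x, -, rfl⟩
    exact ⟨x, rfl⟩
  -- Frobenius identifies `F/Q` with `F^p/Q^p`. Comparing the towers through `Q` and through `F^p`
  -- from `Q^p` to `F` then gives `[F : F^p] = [Q : Q^p]`.
  have hd : Subfield.relfinrank (Q'.map (frobenius F p)) A = Subfield.relfinrank Q' ⊤ := by
    rw [hA, Subfield.relfinrank_map_map]
  have hp1 : Subfield.relfinrank (Q'.map (frobenius F p)) Q' = p := by
    rw [h1]
    change Subfield.relfinrank _ (algebraMap Q F).fieldRange = p
    rw [RingHom.fieldRange_eq_map (algebraMap Q F), Subfield.relfinrank_map_map,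
      Subfield.relfinrank_top_right]
    exact h
  have hpos : 0 < Subfield.relfinrank Q' ⊤ := by
    have h3 : Subfield.relfinrank Q' ⊤ = finrank Q F := by
      have := Algebra.finrank_eq_of_equiv_equiv
        (algebraMap Q F).rangeRestrictFieldEquiv (RingEquiv.refl F) (by ext x; rfl)
      rw [Subfield.relfinrank_top_right, this]
    rw [h3]
    exact finrank_pos
  have e1 := Subfield.relfinrank_mul_relfinrank hQ (le_top (a := Q'))
  have e2 := Subfield.relfinrank_mul_relfinrank
    (show Q'.map (frobenius F p) ≤ A from
    hA ▸ (Subfield.gc_map_comap (frobenius F p)).monotone_l le_top) (le_top (a := A))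
  rw [hd, ← e1, hp1, mul_comm, Subfield.relfinrank_top_right] at e2
  exact Nat.eq_of_mul_eq_mul_right hpos e2

/-- Induction on `n`: the preimage of `S` under the `n`-fold Frobenius contains all `p`-th powers
and `y`, so it is everything, which lowers the exponent by one. -/
theorem PRankOne.eq_top_of_pow (h : PRankOne (F := F) p) {y : F}
    (hy : y ∉ (frobenius F p).fieldRange) (n : ℕ) {S : Subfield F} (hS : ∀ x, x ^ p ^ n ∈ S)
    (hyS : y ∈ S) : S = ⊤ := by
  induction n with
  | zero => exact eq_top_iff.2 fun x _ => by simpa using hS x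
  | succ n ih =>
    refine ih fun x => ?_
    have : S.comap (iterateFrobenius F p n) = ⊤ := by
      refine h.eq_top hy (fun x => ?_) ?_
      · rw [Subfield.mem_comap, iterateFrobenius_def, ← pow_mul, ← pow_succ']
        exact hS x
      · rw [Subfield.mem_comap, iterateFrobenius_def]
        exact S.pow_mem hyS _
    have hx : x ∈ S.comap (iterateFrobenius F p n) := this ▸ (trivial : x ∈ (⊤ : Subfield F))
    exact hx

theorem PRankOne.finrank_iterateFrobenius (h : PRankOne (F := F) p) (n : ℕ) :
    finrank (iterateFrobenius F p n).fieldRange F = p ^ n := by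
  rw [← Subfield.relfinrank_top_right]
  induction n with
  | zero =>
    have : (iterateFrobenius F p 0).fieldRange = ⊤ :=
      eq_top_iff.2 fun x _ => ⟨x, by simp⟩
    rw [this, Subfield.relfinrank_self, pow_zero]
  | succ n ih =>
    have h1 : (iterateFrobenius F p (n + 1)).fieldRange =
        (frobenius F p).fieldRange.map (iterateFrobenius F p n) := by
      simp only [RingHom.fieldRange_eq_map, Subfield.map_map]
      congr 1
      ext x
      simp [iterateFrobenius_def, frobenius_def, ← pow_mul, pow_succ']
    have h2 : (iterateFrobenius F p (n + 1)).fieldRange ≤ (iterateFrobenius F p n).fieldRange := by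
      rw [h1]
      rintro _ ⟨x, -, rfl⟩
      exact ⟨x, rfl⟩
    rw [← Subfield.relfinrank_mul_relfinrank h2 le_top, ih]
    have h3 : Subfield.relfinrank (iterateFrobenius F p (n + 1)).fieldRange
        (iterateFrobenius F p n).fieldRange = p := by
      rw [h1, RingHom.fieldRange_eq_map (iterateFrobenius F p n), Subfield.relfinrank_map_map,
        Subfield.relfinrank_top_right]
      exact h
    rw [h3, pow_succ']

/-- Over a field of `p`-rank one, every element of the base is a power of exponent the
inseparability degree. -/
theorem PRankOne.exists_pow_finInsepDegree {Q : Type*} [Field Q] [CharP Q p] [Algebra Q F]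
    [FiniteDimensional Q F] (h : PRankOne (F := Q) p) (z : Q) :
    ∃ w : F, w ^ Field.finInsepDegree Q F = algebraMap Q F z := by
  have hF : PRankOne (F := F) p := h.of_finite
  have : ExpChar Q p := ExpChar.prime hp.out
  obtain ⟨m, hm⟩ := finInsepDegree_eq_pow (F := Q) (E := F) p
  let S := separableClosure Q F
  -- `F` is purely inseparable of degree `p^m` over the separable closure `S`, so each `x` satisfies
  -- `x^(p^r) ∈ S` for some `r ≤ m`.
  have hle : (iterateFrobenius F p m).fieldRange ≤ S.toSubfield := by
    rintro _ ⟨x, rfl⟩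
    obtain ⟨r, a, ha⟩ := IsPurelyInseparable.minpoly_eq_X_pow_sub_C (F := S) (E := F) p x
    have hr : (minpoly S x).natDegree ≤ p ^ m := by
      rw [← hm]
      exact minpoly.natDegree_le (A := S) x
    rw [ha, Polynomial.natDegree_X_pow_sub_C, Nat.pow_le_pow_iff_right hp.out.one_lt] at hr
    have h1 := minpoly.aeval S x
    rw [ha] at h1
    simp only [map_sub, map_pow, Polynomial.aeval_X, Polynomial.aeval_C, sub_eq_zero] at h1
    rw [iterateFrobenius_def, ← Nat.sub_add_cancel hr, pow_add, mul_comm, pow_mul, h1]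
    exact S.toSubfield.pow_mem a.2 _
  -- `F` has degree `p^m` over `F^(p^m)` and also over `S`, so the two subfields coincide; `S`
  -- contains the base field.
  have h1 := Subfield.relfinrank_mul_finrank_top hle
  rw [hF.finrank_iterateFrobenius] at h1
  have h2 : finrank S.toSubfield F = p ^ m := hm
  rw [h2] at h1
  have h3 := Nat.eq_of_mul_eq_mul_right (pow_pos hp.out.pos m) (h1.trans (one_mul _).symm)
  rw [Subfield.relfinrank_eq_one_iff] at h3
  obtain ⟨w, hw⟩ := h3 (S.algebraMap_mem z)
  exact ⟨w, by rw [hm]; exact hw⟩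

end PBasis

/-! ### Power series expansions of `F` along an element that is not a `p`-th power. -/

section Expansion

variable {F : Type*} [Field F] {p : ℕ} [hp : Fact p.Prime] [CharP F p]

theorem PRankOne.adjoin_eq_top (h : PRankOne (F := F) p) {y : F}
    (hy : y ∉ (frobenius F p).fieldRange) (n : ℕ) :
    IntermediateField.adjoin (iterateFrobenius F p n).fieldRange {y} = ⊤ := by
  let A := (iterateFrobenius F p n).fieldRange
  have : (IntermediateField.adjoin A {y}).toSubfield = ⊤ := by
    refine h.eq_top_of_pow hy n (fun x => ?_) (IntermediateField.mem_adjoin_simple_self A y)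
    exact (IntermediateField.adjoin A {y}).algebraMap_mem ⟨x ^ p ^ n, x, rfl⟩
  rw [eq_top_iff]
  intro x _
  have hx : x ∈ (⊤ : Subfield F) := trivial
  rw [← this] at hx
  exact hx

theorem PRankOne.finite_iterateFrobenius (h : PRankOne (F := F) p) (n : ℕ) :
    FiniteDimensional (iterateFrobenius F p n).fieldRange F :=
  FiniteDimensional.of_finrank_pos (by
    rw [h.finrank_iterateFrobenius]; exact pow_pos hp.out.pos n)

theorem PRankOne.minpoly_eq (h : PRankOne (F := F) p) {y : F}
    (hy : y ∉ (frobenius F p).fieldRange) (n : ℕ) :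
    minpoly (iterateFrobenius F p n).fieldRange y =
      Polynomial.X ^ p ^ n - Polynomial.C ⟨y ^ p ^ n, y, rfl⟩ := by
  have := h.finite_iterateFrobenius n
  have hint : IsIntegral (iterateFrobenius F p n).fieldRange y := Algebra.IsIntegral.isIntegral y
  have hmonic := Polynomial.monic_X_pow_sub_C
    (⟨y ^ p ^ n, y, rfl⟩ : (iterateFrobenius F p n).fieldRange) (pow_ne_zero n hp.out.ne_zero)
  refine (Polynomial.eq_of_monic_of_dvd_of_natDegree_le (minpoly.monic hint) hmonic ?_ ?_).symm
  · apply minpoly.dvd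
    simp only [map_sub, map_pow, Polynomial.aeval_X, Polynomial.aeval_C]
    exact sub_self (y ^ p ^ n)
  · rw [Polynomial.natDegree_X_pow_sub_C, ← IntermediateField.adjoin.finrank hint,
      h.adjoin_eq_top hy, IntermediateField.finrank_top', h.finrank_iterateFrobenius]

/-- If `F = F^{p^n}(y)` with `[F : F^{p^n}] = p^n`, then a homomorphism from `F` is obtained by
prescribing it compatibly on `F^{p^n}` and on `y`. -/
theorem PRankOne.exists_lift (h : PRankOne (F := F) p) {y : F}
    (hy : y ∉ (frobenius F p).fieldRange) (n : ℕ) {B : Type*} [CommRing B] (g : F →+* B)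
    {y' : B} (hy' : y' ^ p ^ n = g y ^ p ^ n) :
    ∃ θ : F →+* B, θ y = y' ∧ ∀ x, θ x ^ p ^ n = g x ^ p ^ n := by
  let A := (iterateFrobenius F p n).fieldRange
  let : Algebra A B := (g.comp A.subtype).toAlgebra
  have hA : ∀ x : F, algebraMap A B ⟨x ^ p ^ n, x, rfl⟩ = g x ^ p ^ n := fun x => map_pow g x _
  have := h.finite_iterateFrobenius n
  have hint : IsIntegral A y := Algebra.IsIntegral.isIntegral y
  have htop : IntermediateField.adjoin A {y} = ⊤ := h.adjoin_eq_top hy n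
  let pb := IntermediateField.adjoin.powerBasis hint
  have hgen : pb.gen = IntermediateField.AdjoinSimple.gen A y := rfl
  have hy'' : Polynomial.aeval y' (minpoly A pb.gen) = 0 := by
    rw [hgen, IntermediateField.minpoly_gen, h.minpoly_eq hy]
    rw [map_sub, map_pow, Polynomial.aeval_X, Polynomial.aeval_C, hy', hA, sub_self]
  let e := (IntermediateField.equivOfEq htop).trans IntermediateField.topEquiv
  have he1 : e.symm y = pb.gen := by
    rw [AlgEquiv.symm_apply_eq, hgen]
    rfl
  refine ⟨((pb.lift y' hy'').comp e.symm.toAlgHom).toRingHom, ?_, fun x => ?_⟩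
  · change pb.lift y' hy'' (e.symm y) = y'
    rw [he1, PowerBasis.lift_gen]
  · rw [← map_pow, ← hA]
    exact ((pb.lift y' hy'').comp e.symm.toAlgHom).commutes (⟨x ^ p ^ n, x, rfl⟩ : A)

variable {Λ : Type*} [Field Λ] [CharP Λ p]

theorem PowerSeries.X_pow_dvd_sub_pow {f g : Λ⟦X⟧}
    (h : PowerSeries.constantCoeff f = PowerSeries.constantCoeff g) (n : ℕ) :
    (PowerSeries.X : Λ⟦X⟧) ^ p ^ n ∣ f ^ p ^ n - g ^ p ^ n := by
  have : CharP Λ⟦X⟧ p := charP_of_injective_ringHom (PowerSeries.C_injective (R := Λ)) p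
  rw [← sub_pow_char_pow]
  apply pow_dvd_pow_of_dvd
  rw [PowerSeries.X_dvd_iff, map_sub, h, sub_self]

/-- Modulo `X^(p^n)` the image of a `p^n`-th power depends only on constant terms, and `y` generates
`F` over `F^(p^n)`. So the two maps agree modulo every `X^(p^n)`. -/
theorem PRankOne.ringHom_ext (h : PRankOne (F := F) p) {y : F}
    (hy : y ∉ (frobenius F p).fieldRange) {θ θ' : F →+* Λ⟦X⟧}
    (hc : ∀ x, PowerSeries.constantCoeff (θ x) = PowerSeries.constantCoeff (θ' x))
    (hyy : θ y = θ' y) : θ = θ' := by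
  ext1 x
  rw [← sub_eq_zero]
  have key : ∀ n, (PowerSeries.X : Λ⟦X⟧) ^ p ^ n ∣ θ x - θ' x := by
    intro n
    let I : Ideal Λ⟦X⟧ := Ideal.span {PowerSeries.X ^ p ^ n}
    have : ((Ideal.Quotient.mk I).comp θ).eqLocusField ((Ideal.Quotient.mk I).comp θ') = ⊤ := by
      refine h.eq_top_of_pow hy n (fun x => ?_) ?_
      · change Ideal.Quotient.mk I (θ (x ^ p ^ n)) = Ideal.Quotient.mk I (θ' (x ^ p ^ n))
        rw [Ideal.Quotient.eq, Ideal.mem_span_singleton, map_pow, map_pow]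
        exact PowerSeries.X_pow_dvd_sub_pow (hc x) n
      · exact congrArg (Ideal.Quotient.mk I) hyy
    have hx : x ∈ ((Ideal.Quotient.mk I).comp θ).eqLocusField ((Ideal.Quotient.mk I).comp θ') :=
      this ▸ (trivial : x ∈ (⊤ : Subfield F))
    exact Ideal.mem_span_singleton.1 (Ideal.Quotient.eq.1 hx)
  ext m
  have h1 : m < p ^ m := Nat.lt_pow_self hp.out.one_lt
  rw [map_zero]
  exact PowerSeries.X_pow_dvd_iff.1 (key m) m h1

/-- Modulo `X^(p^n)` one keeps the constant embedding on `F^(p^n)` and sends `y` to `ψ(y) + X`. This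
is consistent because `(ψ(y) + X)^(p^n) ≡ ψ(y)^(p^n)`. The expansion is the `X`-adic limit. -/
theorem PRankOne.exists_expansion (h : PRankOne (F := F) p) {y : F}
    (hy : y ∉ (frobenius F p).fieldRange) (ψ : F →+* Λ) :
    ∃ θ : F →+* Λ⟦X⟧, (∀ x, PowerSeries.constantCoeff (θ x) = ψ x) ∧
      θ y = PowerSeries.C (ψ y) + PowerSeries.X := by
  let I : Ideal Λ⟦X⟧ := Ideal.span {PowerSeries.X}
  have hI : ∀ n, I ^ n = Ideal.span {PowerSeries.X ^ n} := fun n => Ideal.span_singleton_pow _ _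
  let g : F →+* Λ⟦X⟧ := PowerSeries.C.comp ψ
  have hex : ∀ n, ∃ θ : F →+* Λ⟦X⟧ ⧸ I ^ p ^ n,
      θ y = Ideal.Quotient.mk _ (PowerSeries.C (ψ y) + PowerSeries.X) ∧
        ∀ x, θ x ^ p ^ n = Ideal.Quotient.mk _ (g x) ^ p ^ n := by
    intro n
    refine h.exists_lift hy n ((Ideal.Quotient.mk (I ^ p ^ n)).comp g) ?_
    rw [← map_pow, RingHom.comp_apply, ← map_pow, Ideal.Quotient.eq, hI, Ideal.mem_span_singleton]
    apply PowerSeries.X_pow_dvd_sub_pow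
    simp [g]
  choose θ hθy hθ using hex
  have hlift : ∀ n x, ∃ f : Λ⟦X⟧, θ n x = Ideal.Quotient.mk _ f ∧
      PowerSeries.constantCoeff f = ψ x := by
    intro n x
    obtain ⟨f, hf⟩ := Ideal.Quotient.mk_surjective (θ n x)
    refine ⟨f, hf.symm, ?_⟩
    have h1 := hθ n x
    rw [← hf, ← map_pow, ← map_pow, Ideal.Quotient.eq, hI, Ideal.mem_span_singleton] at h1
    have h2 : (PowerSeries.X : Λ⟦X⟧) ∣ f ^ p ^ n - g x ^ p ^ n :=
      (dvd_pow_self _ (pow_ne_zero n hp.out.ne_zero)).trans h1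
    rw [PowerSeries.X_dvd_iff, map_sub, map_pow, map_pow, sub_eq_zero] at h2
    have h3 := iterateFrobenius_inj Λ p n (by simpa [iterateFrobenius_def] using h2)
    rw [h3]
    simp [g]
  have hmono : StrictMono fun n => p ^ n := pow_right_strictMono₀ hp.out.one_lt
  -- Both maps agree on `y` and on all `p^m`-th powers, and these generate `F`.
  have hcompat : ∀ {m}, (Ideal.Quotient.factorPow I (hmono.monotone m.le_succ)).comp (θ (m + 1)) =
      θ m := by
    intro m
    have : ((Ideal.Quotient.factorPow I (hmono.monotone m.le_succ)).comp
        (θ (m + 1))).eqLocusField (θ m) = ⊤ := by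
      refine h.eq_top_of_pow hy m (fun x => ?_) ?_
      · change Ideal.Quotient.factorPow I (hmono.monotone m.le_succ) (θ (m + 1) (x ^ p ^ m)) =
          θ m (x ^ p ^ m)
        obtain ⟨f, hf, hfc⟩ := hlift (m + 1) x
        rw [map_pow, map_pow, map_pow, hθ, hf]
        change Ideal.Quotient.mk (I ^ p ^ m) f ^ p ^ m = _
        rw [← map_pow, ← map_pow, Ideal.Quotient.eq, hI, Ideal.mem_span_singleton]
        apply PowerSeries.X_pow_dvd_sub_pow
        rw [hfc]
        simp [g]
      · change Ideal.Quotient.factorPow I (hmono.monotone m.le_succ) (θ (m + 1) y) = θ m y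
        rw [hθy, hθy]
        rfl
    ext1 x
    have hx : x ∈ ((Ideal.Quotient.factorPow I (hmono.monotone m.le_succ)).comp
        (θ (m + 1))).eqLocusField (θ m) := this ▸ (trivial : x ∈ (⊤ : Subfield F))
    exact hx
  let Θ : F →+* Λ⟦X⟧ := IsAdicComplete.StrictMono.liftRingHom I hmono θ hcompat
  have hΘ : ∀ n x, Ideal.Quotient.mk (I ^ p ^ n) (Θ x) = θ n x := fun n x =>
    IsAdicComplete.StrictMono.mk_liftRingHom I hmono θ hcompat x
  refine ⟨Θ, fun x => ?_, ?_⟩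
  · obtain ⟨f, hf, hfc⟩ := hlift 0 x
    have h1 := hΘ 0 x
    rw [hf, Ideal.Quotient.eq, hI, Ideal.mem_span_singleton, pow_zero, pow_one,
      PowerSeries.X_dvd_iff, map_sub, hfc, sub_eq_zero] at h1
    exact h1
  · ext m
    have h1 := hΘ m y
    rw [hθy, Ideal.Quotient.eq, hI, Ideal.mem_span_singleton] at h1
    have h2 := PowerSeries.X_pow_dvd_iff.1 h1 m (Nat.lt_pow_self hp.out.one_lt)
    rwa [map_sub, sub_eq_zero] at h2

end Expansion

/-! ### Laurent series over a perfect field have `p`-rank one. -/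

section Laurent

variable {k : Type*} [Field k] [PerfectField k] {p : ℕ} [hp : Fact p.Prime] [CharP k p]

theorem LaurentSeries.charP : CharP k⸨X⸩ p :=
  charP_of_injective_ringHom (f := (algebraMap k⟦X⟧ k⸨X⸩).comp (PowerSeries.C (R := k)))
    ((IsFractionRing.injective k⟦X⟧ k⸨X⸩).comp PowerSeries.C_injective) p

/-- Sort the monomials by exponent modulo `p` and take `p`-th roots of the coefficients in the
perfect field `k`. -/
theorem PowerSeries.eq_sum_pow (f : k⟦X⟧) : ∃ g : ℕ → k⟦X⟧,
    f = ∑ i ∈ Finset.range p, PowerSeries.X ^ i * g i ^ p := by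
  have : ExpChar k p := ExpChar.prime hp.out
  have hperf : ∀ a : k, ∃ b, b ^ p = a := fun a => by
    have : PerfectRing k p := PerfectField.toPerfectRing p
    exact surjective_frobenius k p a
  choose r hr using hperf
  have hpow : ∀ g : k⟦X⟧, ∀ m, PowerSeries.coeff m (g ^ p) =
      if p ∣ m then PowerSeries.coeff (m / p) g ^ p else 0 := by
    intro g m
    have h1 : PowerSeries.map (frobenius k p) (PowerSeries.expand p hp.out.ne_zero g) = g ^ p :=
      MvPowerSeries.map_frobenius_expand p hp.out.ne_zero
    rw [← h1, PowerSeries.coeff_map, PowerSeries.coeff_expand]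
    split_ifs <;> simp [frobenius_def, hp.out.ne_zero]
  refine ⟨fun i => PowerSeries.mk fun m => r (PowerSeries.coeff (p * m + i) f), ?_⟩
  ext m
  rw [map_sum]
  simp only [PowerSeries.coeff_X_pow_mul', hpow, PowerSeries.coeff_mk, hr]
  rw [Finset.sum_eq_single (m % p)]
  · have hle := Nat.mod_le m p
    rw [if_pos hle, if_pos (Nat.dvd_sub_mod m)]
    congr 2
    have h2 := Nat.div_add_mod m p
    have h3 : (m - m % p) / p = m / p := by
      rw [show m - m % p = p * (m / p) by omega, Nat.mul_div_cancel_left _ hp.out.pos]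
    rw [h3, h2]
  · intro i hi hne
    rw [Finset.mem_range] at hi
    split_ifs with h1 h2
    · exfalso
      apply hne
      have h3 : i ≡ m [MOD p] := (Nat.modEq_iff_dvd' h1).2 h2
      rw [← h3, Nat.mod_eq_of_lt hi]
    · rfl
    · rfl
  · intro hn
    exact absurd (Finset.mem_range.2 (Nat.mod_lt m hp.out.pos)) hn

theorem LaurentSeries.X_notMem [CharP k⸨X⸩ p] :
    algebraMap k⟦X⟧ k⸨X⸩ PowerSeries.X ∉ (frobenius k⸨X⸩ p).fieldRange := by
  rintro ⟨w, hw⟩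
  rw [frobenius_def] at hw
  have h1 := congrArg HahnSeries.order hw
  rw [HahnSeries.order_pow] at h1
  have h2 : (algebraMap k⟦X⟧ k⸨X⸩ PowerSeries.X : k⸨X⸩).order = 1 := by
    have : (algebraMap k⟦X⟧ k⸨X⸩ PowerSeries.X : k⸨X⸩) = HahnSeries.single 1 1 :=
      HahnSeries.ofPowerSeries_X
    rw [this, HahnSeries.order_single one_ne_zero]
  rw [h2, nsmul_eq_mul] at h1
  have h3 : (p : ℤ) ∣ 1 := Dvd.intro _ h1
  have h4 := Int.natAbs_dvd_natAbs.2 h3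
  simp only [Int.natAbs_natCast, Int.natAbs_one, Nat.dvd_one] at h4
  exact hp.out.one_lt.ne' h4

theorem LaurentSeries.pRankOne [CharP k⸨X⸩ p] : PRankOne (F := k⸨X⸩) p := by
  refine pRankOne_of_eq_top LaurentSeries.X_notMem fun S hS hX => ?_
  have hps : ∀ f : k⟦X⟧, algebraMap k⟦X⟧ k⸨X⸩ f ∈ S := by
    intro f
    obtain ⟨g, hg⟩ := PowerSeries.eq_sum_pow (p := p) f
    rw [hg, map_sum]
    refine S.sum_mem fun i _ => ?_
    rw [map_mul, map_pow, map_pow]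
    exact S.mul_mem (S.pow_mem hX i) (hS _)
  rw [eq_top_iff]
  rintro x -
  obtain ⟨a, b, -, rfl⟩ := IsFractionRing.div_surjective (A := k⟦X⟧) x
  exact S.div_mem (hps a) (hps b)

end Laurent
end

/-! ### Counting embeddings of `E` with their inseparability degrees. -/

noncomputable section

namespace LocalShtuka

section EmbeddingCount

variable {k : Type*} [Field k] [Fintype k] {Λ : Type*} [Field Λ]
  {E : Type*} [CommRing E] [Algebra k⸨X⸩ E] {g : k⸨X⸩ →+* Λ}

theorem Emb.isMaximal_ker [Module.Finite k⸨X⸩ E] (ψ : Emb k E g) : (RingHom.ker ψ.1).IsMaximal := by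
  have : IsArtinianRing E := IsArtinianRing.of_finite k⸨X⸩ E
  have : (RingHom.ker ψ.1).IsPrime := RingHom.ker_isPrime ψ.1
  exact IsArtinianRing.isMaximal_of_isPrime _

/-- The inseparability degree of a residue field of `E`. -/
def residueInsepDegree (m : MaximalSpectrum E) : ℕ :=
  letI : Field (E ⧸ m.asIdeal) := Ideal.Quotient.field _
  Field.finInsepDegree k⸨X⸩ (E ⧸ m.asIdeal)

theorem CM.insepDegree_eq [Module.Finite k⸨X⸩ E] (ψ : Emb k E g) :
    CM.insepDegree ψ = residueInsepDegree (k := k) ⟨RingHom.ker ψ.1, ψ.isMaximal_ker⟩ := rfl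

instance Emb.finite [Module.Finite k⸨X⸩ E] : Finite (Emb k E g) := by
  let : Algebra k⸨X⸩ Λ := g.toAlgebra
  let f : Emb k E g → (E →ₐ[k⸨X⸩] Λ) := fun ψ =>
    { ψ.1 with commutes' := fun a => RingHom.congr_fun ψ.2 a }
  refine Finite.of_injective f fun ψ ψ' h => Subtype.ext ?_
  ext e
  exact DFunLike.congr_fun h e

/-- Embeddings with kernel `m` are embeddings of the residue field into an algebraic closure of `Λ`,
since all of these take values in `Λ`. Their number is the separable degree. -/
theorem card_fiber [Module.Finite k⸨X⸩ E]
    (hemb : ∀ (ψ : Emb k E ((algebraMap Λ (AlgebraicClosure Λ)).comp g)) (a : E),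
      ψ.1 a ∈ (algebraMap Λ (AlgebraicClosure Λ)).range) (m : MaximalSpectrum E) :
    Nat.card {ψ : Emb k E g // (⟨RingHom.ker ψ.1, ψ.isMaximal_ker⟩ : MaximalSpectrum E) = m} *
      residueInsepDegree (k := k) m = Module.finrank k⸨X⸩ (E ⧸ m.asIdeal) := by
  let : Field (E ⧸ m.asIdeal) := Ideal.Quotient.field _
  let : Algebra k⸨X⸩ (AlgebraicClosure Λ) := ((algebraMap Λ (AlgebraicClosure Λ)).comp g).toAlgebra
  have : FiniteDimensional k⸨X⸩ (E ⧸ m.asIdeal) := inferInstance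
  have h1 := Field.finSepDegree_eq_of_isAlgClosed k⸨X⸩ (E ⧸ m.asIdeal) (AlgebraicClosure Λ)
  have h2 := Field.finSepDegree_mul_finInsepDegree k⸨X⸩ (E ⧸ m.asIdeal)
  rw [← h2]
  congr 1
  rw [h1]
  have hinj := (algebraMap Λ (AlgebraicClosure Λ)).injective
  refine Nat.card_congr (Equiv.ofBijective (fun ψ => ?_) ⟨?_, ?_⟩)
  · refine { Ideal.Quotient.lift m.asIdeal ((algebraMap Λ (AlgebraicClosure Λ)).comp ψ.1.1)
      (fun a ha => ?_) with commutes' := fun a => ?_ }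
    · have h3 : RingHom.ker ψ.1.1 = m.asIdeal := congrArg MaximalSpectrum.asIdeal ψ.2
      rw [← h3] at ha
      rw [RingHom.comp_apply, (RingHom.mem_ker).1 ha, map_zero]
    · exact congrArg (algebraMap Λ (AlgebraicClosure Λ)) (RingHom.congr_fun ψ.1.2 a)
  · intro ψ ψ' h
    refine Subtype.ext (Subtype.ext ?_)
    ext e
    apply hinj
    exact DFunLike.congr_fun h (Ideal.Quotient.mk _ e)
  · intro φ
    let ψ' : Emb k E ((algebraMap Λ (AlgebraicClosure Λ)).comp g) :=
      ⟨φ.toRingHom.comp (Ideal.Quotient.mk _), by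
        ext a
        exact φ.commutes a⟩
    choose r hr using hemb ψ'
    let ψ : E →+* Λ :=
      { toFun := r
        map_one' := hinj (by rw [hr, map_one, map_one])
        map_mul' := fun x y => hinj (by rw [hr, map_mul, map_mul, hr, hr])
        map_zero' := hinj (by rw [hr, map_zero, map_zero])
        map_add' := fun x y => hinj (by rw [hr, map_add, map_add, hr, hr]) }
    have hker : RingHom.ker ψ = m.asIdeal := by
      ext e
      rw [RingHom.mem_ker, ← map_eq_zero_iff _ hinj]
      change algebraMap Λ (AlgebraicClosure Λ) (r e) = 0 ↔ _
      rw [hr]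
      change φ (Ideal.Quotient.mk _ e) = 0 ↔ _
      rw [← Ideal.Quotient.eq_zero_iff_mem]
      exact map_eq_zero_iff φ.toRingHom φ.toRingHom.injective
    refine ⟨⟨⟨ψ, ?_⟩, MaximalSpectrum.ext hker⟩, ?_⟩
    · ext a
      apply hinj
      exact (hr _).trans (φ.commutes a)
    · refine AlgHom.ext fun x => ?_
      obtain ⟨e, rfl⟩ := Ideal.Quotient.mk_surjective x
      exact hr e

theorem sum_insepDegree [Module.Finite k⸨X⸩ E] [IsSemisimpleRing E] [Fintype (Emb k E g)]
    (hemb : ∀ (ψ : Emb k E ((algebraMap Λ (AlgebraicClosure Λ)).comp g)) (a : E),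
      ψ.1 a ∈ (algebraMap Λ (AlgebraicClosure Λ)).range) :
    ∑ ψ : Emb k E g, CM.insepDegree ψ = Module.finrank k⸨X⸩ E := by
  classical
  have : IsArtinianRing E := IsArtinianRing.of_finite k⸨X⸩ E
  have : Fintype (MaximalSpectrum E) := Fintype.ofFinite _
  have e : E ≃ₗ[k⸨X⸩] (∀ m : MaximalSpectrum E, E ⧸ m.asIdeal) :=
    (IsArtinianRing.equivPi E).toLinearEquiv.restrictScalars k⸨X⸩
  rw [e.finrank_eq, Module.finrank_pi_fintype]
  simp only [CM.insepDegree_eq, ← card_fiber hemb]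
  rw [← Finset.sum_fiberwise (s := Finset.univ)
    (g := fun ψ : Emb k E g => (⟨RingHom.ker ψ.1, ψ.isMaximal_ker⟩ : MaximalSpectrum E))]
  refine Finset.sum_congr rfl fun m _ => ?_
  rw [Finset.sum_congr rfl (g := fun _ => residueInsepDegree (k := k) m)
    (fun ψ hψ => by rw [(Finset.mem_filter.1 hψ).2]), Finset.sum_const, smul_eq_mul]
  congr 1
  rw [Nat.card_eq_fintype_card, Fintype.card_subtype]

end EmbeddingCount

end LocalShtuka
end

noncomputable section

/-! ### Substitution in power series rings. -/

section Substitution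

variable {Λ : Type*} [CommRing Λ]

/-- The `Λ`-algebra homomorphism `Λ⟦X⟧ → Λ⟦X⟧` with `X ↦ t`, for `t` without constant term. -/
theorem PowerSeries.exists_subst {t : Λ⟦X⟧} (ht : PowerSeries.constantCoeff t = 0) :
    ∃ s : Λ⟦X⟧ →+* Λ⟦X⟧, (∀ c, s (PowerSeries.C c) = PowerSeries.C c) ∧ s PowerSeries.X = t ∧
      ∀ f, PowerSeries.constantCoeff (s f) = PowerSeries.constantCoeff f := by
  have h := PowerSeries.HasSubst.of_constantCoeff_zero' ht
  let s : Λ⟦X⟧ →ₐ[Λ] Λ⟦X⟧ := PowerSeries.substAlgHom h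
  have hC : ∀ c, s (PowerSeries.C c) = PowerSeries.C c := fun c => s.commutes c
  have hX : s PowerSeries.X = t := PowerSeries.substAlgHom_X h
  refine ⟨s.toRingHom, hC, hX, fun f => ?_⟩
  change PowerSeries.constantCoeff (s f) = _
  obtain ⟨g, hg⟩ : (PowerSeries.X : Λ⟦X⟧) ∣ f - PowerSeries.C (PowerSeries.constantCoeff f) := by
    rw [PowerSeries.X_dvd_iff]; simp
  rw [sub_eq_iff_eq_add] at hg
  conv_lhs => rw [hg]
  rw [map_add, map_mul, hC, hX, map_add, map_mul, ht]
  simp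

theorem PowerSeries.eq_sum_add (f : Λ⟦X⟧) (n : ℕ) : ∃ g : Λ⟦X⟧, f =
    ∑ m ∈ Finset.range n, PowerSeries.C (PowerSeries.coeff m f) * PowerSeries.X ^ m +
      PowerSeries.X ^ n * g := by
  obtain ⟨g, hg⟩ : (PowerSeries.X : Λ⟦X⟧) ^ n ∣ f -
      ∑ m ∈ Finset.range n, PowerSeries.C (PowerSeries.coeff m f) * PowerSeries.X ^ m := by
    rw [PowerSeries.X_pow_dvd_iff]
    intro m hm
    rw [map_sub, map_sum]
    simp only [PowerSeries.coeff_C_mul, PowerSeries.coeff_X_pow, mul_ite, mul_one, mul_zero]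
    simp [hm]
  exact ⟨g, by rw [← hg]; ring⟩

/-- `Λ`-algebra homomorphisms out of `Λ⟦X⟧` that send `X` to the same topologically nilpotent
element agree. -/
theorem PowerSeries.ringHom_ext_of_X {s s' : Λ⟦X⟧ →+* Λ⟦X⟧}
    (hC : ∀ c, s (PowerSeries.C c) = s' (PowerSeries.C c))
    (hX : s PowerSeries.X = s' PowerSeries.X)
    (h0 : PowerSeries.constantCoeff (s PowerSeries.X) = 0) : s = s' := by
  ext1 f
  ext n
  obtain ⟨g, hg⟩ := PowerSeries.eq_sum_add f (n + 1)
  have h1 : (PowerSeries.X : Λ⟦X⟧) ^ (n + 1) ∣ s f - s' f := by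
    conv_rhs => rw [hg]
    simp only [map_add, map_sum, map_mul, map_pow, hC, hX, add_sub_add_left_eq_sub, ← mul_sub]
    refine Dvd.dvd.mul_right (pow_dvd_pow_of_dvd ?_ _) _
    rw [← hX, PowerSeries.X_dvd_iff, h0]
  have := PowerSeries.X_pow_dvd_iff.1 h1 n (Nat.lt_succ_self n)
  rwa [map_sub, sub_eq_zero] at this

end Substitution

theorem charP_quotient (Q : Type*) {E : Type*} [Field Q] [CommRing E] [Algebra Q E] {p : ℕ}
    [CharP Q p] (I : Ideal E) [I.IsMaximal] : CharP (E ⧸ I) p :=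
  letI := Ideal.Quotient.field I
  charP_of_injective_ringHom (f := algebraMap Q (E ⧸ I)) (algebraMap Q (E ⧸ I)).injective p

namespace LocalShtuka

/-! ### Existence and uniqueness of expansions of `E ⊗ Λ⟦X⟧`. -/

section Expansion

open BaseChange (Ring)

variable {k : Type*} [Field k] [Fintype k] {p : ℕ} [hp : Fact p.Prime] [CharP k⸨X⸩ p]
  [CharP k p]
  {Λ : Type*} [Field Λ] [CharP Λ p] {E : Type*} [CommRing E] [Algebra k⸨X⸩ E]
  [Module.Finite k⸨X⸩ E]
  {q : k⸨X⸩ →+* Λ⟦X⟧} {c : Λ}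

/-- `Θ` is an expansion of `ψ : E → Λ` along `y`, where `q : k⸨X⸩ → Λ⟦X⟧` sends `X` to `c + X`. -/
structure IsExpansion (ψ : Emb k E (PowerSeries.constantCoeff.comp q)) (y : CM.Factor ψ)
    (Θ : Ring q E →+* Λ⟦X⟧) : Prop where
  map_C : ∀ c : Λ, Θ (Ring.inl q E (PowerSeries.C c)) = PowerSeries.C c
  constantCoeff_map : ∀ e : E, PowerSeries.constantCoeff (Θ (Ring.inr q E e)) = ψ.1 e
  map_uniformizer : ∀ e : E, Ideal.Quotient.mk _ e = y →
    Θ (Ring.inr q E e) = PowerSeries.C (ψ.1 e) + PowerSeries.X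

/-- `y` is not a `p`-th power. -/
def NotPow (p : ℕ) {F : Type*} [Monoid F] (y : F) : Prop := ∀ w, w ^ p ≠ y

variable {ψ : Emb k E (PowerSeries.constantCoeff.comp q)} {y : CM.Factor ψ}

/-- The kernel of `Θ` on the Artinian ring `E` is prime, hence maximal, and it lies in the kernel of
`ψ`. Thus `Θ` factors over the factor field of `ψ`. -/
theorem ker_comp_inr {Θ : Ring q E →+* Λ⟦X⟧}
    (hΘ : ∀ e : E, PowerSeries.constantCoeff (Θ (Ring.inr q E e)) = ψ.1 e) (e : E) :
    Θ (Ring.inr q E e) = 0 ↔ ψ.1 e = 0 := by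
  have : IsArtinianRing E := IsArtinianRing.of_finite k⸨X⸩ E
  let θ := Θ.comp (Ring.inr q E)
  have h1 : (RingHom.ker θ).IsPrime := RingHom.ker_isPrime θ
  have h2 : (RingHom.ker θ).IsMaximal := IsArtinianRing.isMaximal_of_isPrime _
  have h3 : RingHom.ker θ = RingHom.ker ψ.1 := by
    refine h2.eq_of_le ψ.isMaximal_ker.ne_top fun x hx => ?_
    rw [RingHom.mem_ker] at hx ⊢
    rw [← hΘ]
    change PowerSeries.constantCoeff (θ x) = 0
    rw [hx, map_zero]
  exact (RingHom.mem_ker (f := θ)).symm.trans (h3 ▸ RingHom.mem_ker)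

/-- The factorization of `Θ` over the factor field. -/
theorem exists_factor {Θ : Ring q E →+* Λ⟦X⟧}
    (hΘ : ∀ e : E, PowerSeries.constantCoeff (Θ (Ring.inr q E e)) = ψ.1 e) :
    ∃ θ : CM.Factor ψ →+* Λ⟦X⟧, ∀ e, θ (Ideal.Quotient.mk _ e) = Θ (Ring.inr q E e) :=
  ⟨Ideal.Quotient.lift _ (Θ.comp (Ring.inr q E)) fun e he => (ker_comp_inr hΘ e).2 he,
    fun _ => rfl⟩

theorem map_inl_X (hq : q (algebraMap k⟦X⟧ k⸨X⸩ PowerSeries.X) = PowerSeries.C c + PowerSeries.X)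
    {Θ : Ring q E →+* Λ⟦X⟧}
    (hC : ∀ c : Λ, Θ (Ring.inl q E (PowerSeries.C c)) = PowerSeries.C c) :
    Θ (Ring.inl q E PowerSeries.X) =
      Θ (Ring.inr q E (algebraMap k⸨X⸩ E (algebraMap k⟦X⟧ k⸨X⸩ PowerSeries.X))) -
        PowerSeries.C c := by
  rw [BaseChange.Ring.inr_algebraMap, hq, map_add, map_add, hC, add_sub_cancel_left]

theorem constantCoeff_inl_X
    (hq : q (algebraMap k⟦X⟧ k⸨X⸩ PowerSeries.X) = PowerSeries.C c + PowerSeries.X)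
    {Θ : Ring q E →+* Λ⟦X⟧}
    (hC : ∀ c : Λ, Θ (Ring.inl q E (PowerSeries.C c)) = PowerSeries.C c)
    (hΘ : ∀ e : E, PowerSeries.constantCoeff (Θ (Ring.inr q E e)) = ψ.1 e) :
    PowerSeries.constantCoeff (Θ (Ring.inl q E PowerSeries.X)) = 0 := by
  rw [map_inl_X hq hC, map_sub, hΘ]
  have := RingHom.congr_fun ψ.2 (algebraMap k⟦X⟧ k⸨X⸩ PowerSeries.X)
  rw [RingHom.comp_apply] at this
  rw [this, RingHom.comp_apply, hq]
  simp

/-- On `E` this is the rigidity of expansions of the factor field. On `Λ⟦X⟧` the map is then forced,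
because `X` becomes `z - c` with `z` in the image of `E`. -/
theorem IsExpansion.unique
    (hq : q (algebraMap k⟦X⟧ k⸨X⸩ PowerSeries.X) = PowerSeries.C c + PowerSeries.X)
    (hy : NotPow p y) {Θ Θ' : Ring q E →+* Λ⟦X⟧}
    (h : IsExpansion ψ y Θ) (h' : IsExpansion ψ y Θ') : Θ = Θ' := by
  have := ψ.isMaximal_ker
  have := PerfectField.ofFinite (K := k)
  let : Field (CM.Factor ψ) := Ideal.Quotient.field _
  have : CharP (CM.Factor ψ) p := charP_quotient k⸨X⸩ _
  have hF : PRankOne (F := CM.Factor ψ) p :=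
    (LaurentSeries.pRankOne (k := k) (p := p)).of_finite
  obtain ⟨θ, hθ⟩ := exists_factor h.constantCoeff_map
  obtain ⟨θ', hθ'⟩ := exists_factor h'.constantCoeff_map
  have heq : θ = θ' := by
    refine hF.ringHom_ext (y := y) ?_ (fun x => ?_) ?_
    · rintro ⟨w, hw⟩
      exact hy w hw
    · obtain ⟨e, rfl⟩ := Ideal.Quotient.mk_surjective x
      rw [hθ, hθ', h.constantCoeff_map, h'.constantCoeff_map]
    · obtain ⟨e, rfl⟩ := Ideal.Quotient.mk_surjective y
      rw [hθ, hθ', h.map_uniformizer e rfl, h'.map_uniformizer e rfl]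
  have hr : ∀ e, Θ (Ring.inr q E e) = Θ' (Ring.inr q E e) := fun e => by rw [← hθ, ← hθ', heq]
  refine BaseChange.Ring.ringHom_ext q (fun b => ?_) hr
  have := PowerSeries.ringHom_ext_of_X (s := Θ.comp (Ring.inl q E)) (s' := Θ'.comp (Ring.inl q E))
    (fun c => (h.map_C c).trans (h'.map_C c).symm) (by
      rw [RingHom.comp_apply, RingHom.comp_apply, map_inl_X hq h.map_C, map_inl_X hq h'.map_C, hr])
    (constantCoeff_inl_X hq h.map_C h.constantCoeff_map)
  exact RingHom.congr_fun this b

/-- On `E` one expands the factor field along `y`; on `Λ⟦X⟧` one substitutes the resulting image of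
`z - c` for `X`. -/
theorem exists_isExpansion
    (hq : q (algebraMap k⟦X⟧ k⸨X⸩ PowerSeries.X) = PowerSeries.C c + PowerSeries.X)
    (hy : NotPow p y) : ∃ Θ : Ring q E →+* Λ⟦X⟧, IsExpansion ψ y Θ := by
  have := ψ.isMaximal_ker
  have := PerfectField.ofFinite (K := k)
  let : Field (CM.Factor ψ) := Ideal.Quotient.field _
  have : CharP (CM.Factor ψ) p := charP_quotient k⸨X⸩ _
  have hQ := LaurentSeries.pRankOne (k := k) (p := p)
  have hF : PRankOne (F := CM.Factor ψ) p := hQ.of_finite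
  obtain ⟨θ, hθ, hθy⟩ := hF.exists_expansion (y := y) (by
    rintro ⟨w, hw⟩
    exact hy w hw) (RingHom.kerLift ψ.1)
  let z : k⸨X⸩ := algebraMap k⟦X⟧ k⸨X⸩ PowerSeries.X
  let θE : E →+* Λ⟦X⟧ := θ.comp (Ideal.Quotient.mk _)
  have hθE : ∀ e, PowerSeries.constantCoeff (θE e) = ψ.1 e := fun e => hθ _
  have hψ : ∀ a, ψ.1 (algebraMap k⸨X⸩ E a) = PowerSeries.constantCoeff (q a) := fun a =>
    RingHom.congr_fun ψ.2 a
  obtain ⟨s, hsC, hsX, hs0⟩ := PowerSeries.exists_subst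
    (t := θE (algebraMap k⸨X⸩ E z) - PowerSeries.C c) (by
      rw [map_sub, hθE, hψ, hq]; simp)
  -- The two halves agree on `k((z))`: there a homomorphism is determined by its constant terms and
  -- by the image of `z`, since `z` is not a `p`-th power.
  have hcompat : θE.comp (algebraMap k⸨X⸩ E) = s.comp q := by
    refine hQ.ringHom_ext (y := z) LaurentSeries.X_notMem (fun x => ?_) ?_
    · exact (hθE _).trans ((hψ x).trans (hs0 (q x)).symm)
    · have h1 : s (q z) = θE (algebraMap k⸨X⸩ E z) := by
        rw [hq, map_add, hsC, hsX]; ring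
      exact h1.symm
  let Θ := BaseChange.Ring.lift q s (fun b x => mul_comm _ _) θE (fun a => RingHom.congr_fun hcompat a)
  have hr : ∀ e, Θ (Ring.inr q E e) = θE e := BaseChange.Ring.lift_inr q s _ θE _
  have hl : ∀ b, Θ (Ring.inl q E b) = s b := BaseChange.Ring.lift_inl q s _ θE _
  refine ⟨Θ, fun c => by rw [hl, hsC], fun e => by rw [hr, hθE], ?_⟩
  rintro e rfl
  rw [hr]
  exact hθy

/-- `y - ψ(y)` divides `z - ζ` at least as often as the inseparability degree says. -/
theorem X_pow_insepDegree_dvd (p : ℕ) [hp : Fact p.Prime] [CharP k⸨X⸩ p] [CharP k p] [CharP Λ p]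
    (hq : q (algebraMap k⟦X⟧ k⸨X⸩ PowerSeries.X) = PowerSeries.C c + PowerSeries.X)
    {Θ : Ring q E →+* Λ⟦X⟧}
    (hC : ∀ c : Λ, Θ (Ring.inl q E (PowerSeries.C c)) = PowerSeries.C c)
    (hΘ : ∀ e : E, PowerSeries.constantCoeff (Θ (Ring.inr q E e)) = ψ.1 e) :
    (PowerSeries.X : Λ⟦X⟧) ^ CM.insepDegree ψ ∣ Θ (Ring.inl q E PowerSeries.X) := by
  have := ψ.isMaximal_ker
  have := PerfectField.ofFinite (K := k)
  let : Field (CM.Factor ψ) := Ideal.Quotient.field _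
  have : CharP (CM.Factor ψ) p := charP_quotient k⸨X⸩ _
  have hQ := LaurentSeries.pRankOne (k := k) (p := p)
  have : ExpChar k⸨X⸩ p := ExpChar.prime hp.out
  have hd : CM.insepDegree ψ = Field.finInsepDegree k⸨X⸩ (CM.Factor ψ) := rfl
  obtain ⟨m, hm⟩ := finInsepDegree_eq_pow (F := k⸨X⸩) (E := CM.Factor ψ) p
  let z : k⸨X⸩ := algebraMap k⟦X⟧ k⸨X⸩ PowerSeries.X
  obtain ⟨w, hw⟩ := hQ.exists_pow_finInsepDegree (F := CM.Factor ψ) z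
  obtain ⟨e, rfl⟩ := Ideal.Quotient.mk_surjective w
  obtain ⟨θ, hθ⟩ := exists_factor hΘ
  -- With `z = w^(p^m)` in the factor field, the image of `z - c` is the `p^m`-th power of `θ(w) -
  -- ψ(w)`, which has no constant term.
  have h1 : Θ (Ring.inr q E (algebraMap k⸨X⸩ E z)) = Θ (Ring.inr q E e) ^ p ^ m := by
    rw [← hθ, ← hθ, ← map_pow, ← hm, hw]
    rfl
  have h2 := constantCoeff_inl_X hq hC hΘ
  rw [map_inl_X hq hC, map_sub, h1, map_pow, hΘ, sub_eq_zero, PowerSeries.constantCoeff_C] at h2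
  rw [map_inl_X hq hC, h1, hd, hm, ← h2, map_pow]
  apply PowerSeries.X_pow_dvd_sub_pow
  rw [hΘ, PowerSeries.constantCoeff_C]

end Expansion

end LocalShtuka
end

noncomputable section

/-! ### The isomorphism of `E ⊗ Λ⟦X⟧` with a product of power series rings. -/

section Decomposition

open BaseChange (Ring)

variable {Λ : Type*} [Field Λ] {Q : Type*} [Field Q] {E : Type*} [CommRing E] [Algebra Q E]
  {q : Q →+* Λ⟦X⟧} {Ψ : Type*} [Fintype Ψ]

/-- A family of `Λ`-algebra homomorphisms `E ⊗ Λ⟦X⟧ → Λ⟦X⟧` that reduce to pairwise distinct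
homomorphisms `ψ i : E → Λ` and hit uniformizers. -/
structure IsExpansionFamily (ψ : Ψ → E →+* Λ) (Θ : Ψ → Ring q E →+* Λ⟦X⟧) : Prop where
  injective : Function.Injective ψ
  map_C : ∀ i c, Θ i (Ring.inl q E (PowerSeries.C c)) = PowerSeries.C c
  constantCoeff_map : ∀ i e, PowerSeries.constantCoeff (Θ i (Ring.inr q E e)) = ψ i e
  exists_uniformizer : ∀ i, ∃ e, Θ i (Ring.inr q E e) = PowerSeries.C (ψ i e) + PowerSeries.X

namespace IsExpansionFamily

variable {ψ : Ψ → E →+* Λ} {Θ : Ψ → Ring q E →+* Λ⟦X⟧} (H : IsExpansionFamily ψ Θ)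

include H

/-- Since `X` itself is the image of `e - ψ(e)`, every polynomial in `X` lies in the image of `Θ i`.
-/
theorem exists_X_pow_dvd_sub (i : Ψ) (n : ℕ) (v : Λ⟦X⟧) :
    ∃ w, (PowerSeries.X : Λ⟦X⟧) ^ n ∣ Θ i w - v := by
  obtain ⟨e, he⟩ := H.exists_uniformizer i
  obtain ⟨g, hg⟩ := PowerSeries.eq_sum_add v n
  refine ⟨∑ m ∈ Finset.range n, Ring.inl q E (PowerSeries.C (PowerSeries.coeff m v)) *
    (Ring.inr q E e - Ring.inl q E (PowerSeries.C (ψ i e))) ^ m, -g, ?_⟩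
  simp only [map_sum, map_mul, map_pow, map_sub, H.map_C, he, add_sub_cancel_left]
  rw [← neg_sub, sub_eq_iff_eq_add'.2 hg, mul_neg]

/-- Chinese remainder theorem: if `ψ i e ≠ ψ j e`, the elements `e - ψ i e` and `e - ψ j e` differ
by a unit, so the two ideals are coprime. -/
theorem exists_forall_X_pow_dvd_sub (n : Ψ → ℕ) (v : Ψ → Λ⟦X⟧) :
    ∃ w, ∀ i, (PowerSeries.X : Λ⟦X⟧) ^ n i ∣ Θ i w - v i := by
  let I : Ψ → Ideal (Ring q E) := fun i => (Ideal.span {PowerSeries.X ^ n i}).comap (Θ i)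
  have hI : ∀ i w, w ∈ I i ↔ (PowerSeries.X : Λ⟦X⟧) ^ n i ∣ Θ i w := fun i w =>
    Ideal.mem_comap.trans Ideal.mem_span_singleton
  have hcop : Pairwise fun i j => IsCoprime (I i) (I j) := by
    intro i j hij
    obtain ⟨e, he⟩ : ∃ e, ψ i e ≠ ψ j e := by
      by_contra! hn
      exact hij (H.injective (RingHom.ext hn))
    let a : Ψ → Ring q E := fun l => Ring.inr q E e - Ring.inl q E (PowerSeries.C (ψ l e))
    have ha : ∀ l, a l ^ n l ∈ I l := by
      intro l
      rw [hI, map_pow]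
      apply pow_dvd_pow_of_dvd
      rw [PowerSeries.X_dvd_iff, map_sub, map_sub, H.map_C, H.constantCoeff_map]
      simp
    have hu : IsCoprime (a i) (a j) := by
      refine ⟨-Ring.inl q E (PowerSeries.C (ψ i e - ψ j e)⁻¹),
        Ring.inl q E (PowerSeries.C (ψ i e - ψ j e)⁻¹), ?_⟩
      have h1 : (ψ i e - ψ j e)⁻¹ * (ψ i e - ψ j e) = 1 := inv_mul_cancel₀ (sub_ne_zero.2 he)
      have h2 : Ring.inl q E (PowerSeries.C (ψ i e - ψ j e)⁻¹) *
          (Ring.inl q E (PowerSeries.C (ψ i e)) - Ring.inl q E (PowerSeries.C (ψ j e))) = 1 := by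
        rw [← map_sub, ← map_sub, ← map_mul, ← map_mul, h1, map_one, map_one]
      rw [← h2]
      ring
    have h3 : IsCoprime (a i ^ n i) (a j ^ n j) := hu.pow
    rw [Ideal.isCoprime_iff_exists]
    obtain ⟨x, y, hxy⟩ := h3
    exact ⟨_, (I i).mul_mem_left x (ha i), _, (I j).mul_mem_left y (ha j), hxy⟩
  choose w hw using fun i => H.exists_X_pow_dvd_sub i (n i) (v i)
  obtain ⟨r, hr⟩ := Ideal.exists_forall_sub_mem_ideal hcop w
  refine ⟨r, fun i => ?_⟩
  have := dvd_add ((hI _ _).1 (hr i)) (hw i)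
  rwa [map_sub, sub_add_sub_cancel] at this

variable {ι : Type*} [Fintype ι] (e : Module.Basis ι Q E)

omit H in
variable (q) in
/-- The element of `E ⊗ Λ⟦X⟧` with given coordinates. -/
def ofCoord (f : ι → Λ⟦X⟧) : Ring q E :=
  ∑ j : ι, (Ring.inl q E (f j) * Ring.inr q E (e j) : Ring q E)

omit H in
theorem exists_ofCoord (w : Ring q E) : ∃ f, ofCoord q e f = w :=
  ⟨fun j => Ring.coord q e w j, (BaseChange.Ring.eq_sum_coord q e w).symm⟩

omit H in
theorem ofCoord_split (f : ι → Λ⟦X⟧) : ofCoord q e f =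
    ofCoord q e (fun j => PowerSeries.C (PowerSeries.constantCoeff (f j))) +
      Ring.inl q E PowerSeries.X *
        ofCoord q e (fun j => PowerSeries.mk fun m => PowerSeries.coeff (m + 1) (f j)) := by
  refine Eq.trans ?_ (congrArg₂ (· + ·) rfl (Finset.mul_sum _ _ _).symm)
  refine Eq.trans ?_ Finset.sum_add_distrib
  refine Finset.sum_congr rfl fun j _ => ?_
  conv_lhs => rw [PowerSeries.eq_X_mul_shift_add_const (f j)]
  rw [map_add, map_mul, add_mul, mul_assoc, add_comm]

variable (Θ) in
omit H in
/-- The linear map sending constant coordinates to truncated expansions. -/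
def truncation (hC : ∀ i c, Θ i (Ring.inl q E (PowerSeries.C c)) = PowerSeries.C c) (n : Ψ → ℕ) :
    (ι → Λ) →ₗ[Λ] ((i : Ψ) → Fin (n i) → Λ) where
  toFun c i m := PowerSeries.coeff m (Θ i (ofCoord q e fun j => PowerSeries.C (c j)))
  map_add' c c' := by
    funext i m
    simp [ofCoord, add_mul, Finset.sum_add_distrib]
  map_smul' a c := by
    funext i m
    simp only [ofCoord, map_sum, map_mul, Pi.smul_apply, smul_eq_mul, RingHom.id_apply, hC,
      PowerSeries.coeff_C_mul, Finset.mul_sum, mul_assoc]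

/-- Non-constant parts of the coordinates are multiples of the parameter `X` of the source, whose
image is divisible by `X^(n i)`; they do not affect the truncations. -/
theorem truncation_surjective (n : Ψ → ℕ)
    (hn : ∀ i, (PowerSeries.X : Λ⟦X⟧) ^ n i ∣ Θ i (Ring.inl q E PowerSeries.X)) :
    Function.Surjective (truncation Θ e H.map_C n) := by
  intro v
  obtain ⟨w, hw⟩ := H.exists_forall_X_pow_dvd_sub n
    (fun i => PowerSeries.mk fun m => if h : m < n i then v i ⟨m, h⟩ else 0)
  obtain ⟨f, rfl⟩ := exists_ofCoord e w
  refine ⟨fun j => PowerSeries.constantCoeff (f j), ?_⟩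
  funext i m
  have h1 := hw i
  rw [ofCoord_split, map_add, map_mul, add_sub_right_comm] at h1
  have h2 := (dvd_add_left ((hn i).mul_right _)).1 h1
  have h3 := PowerSeries.X_pow_dvd_iff.1 h2 m m.2
  rw [map_sub, sub_eq_zero, PowerSeries.coeff_mk, dif_pos m.2] at h3
  exact h3

theorem sum_le [Module.Finite Q E] (n : Ψ → ℕ)
    (hn : ∀ i, (PowerSeries.X : Λ⟦X⟧) ^ n i ∣ Θ i (Ring.inl q E PowerSeries.X)) :
    ∑ i, n i ≤ Module.finrank Q E := by
  have h1 := LinearMap.finrank_le_finrank_of_surjective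
    (f := truncation Θ (Module.finBasis Q E) H.map_C n) (H.truncation_surjective _ n hn)
  simpa [Module.finrank_pi_fintype] using h1

section bijective

variable [Module.Finite Q E] {d : Ψ → ℕ}
  (hd : ∀ i, (PowerSeries.X : Λ⟦X⟧) ^ d i ∣ Θ i (Ring.inl q E PowerSeries.X))
  (hsum : ∑ i, d i = Module.finrank Q E)

include hd hsum

theorem truncation_bijective : Function.Bijective (truncation Θ e H.map_C d) := by
  refine ⟨?_, H.truncation_surjective e d hd⟩
  rw [LinearMap.injective_iff_surjective_of_finrank_eq_finrank]
  · exact H.truncation_surjective e d hd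
  · rw [Module.finrank_pi_fintype, Module.finrank_pi_fintype]
    simp [hsum, Module.finrank_eq_card_basis e]

/-- The `d i` already exhaust the dimension of `E`, so raising one of them would contradict the
bound `sum_le`. Hence the image of `X` under `Θ i` has order exactly `d i`. -/
theorem not_X_pow_succ_dvd (i : Ψ) :
    ¬ (PowerSeries.X : Λ⟦X⟧) ^ (d i + 1) ∣ Θ i (Ring.inl q E PowerSeries.X) := by
  classical
  intro h
  have h1 := H.sum_le (Function.update d i (d i + 1)) (fun j => by
    rcases eq_or_ne j i with rfl | hj
    · rwa [Function.update_self]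
    · rw [Function.update_of_ne hj]
      exact hd j)
  rw [← hsum] at h1
  refine absurd h1 (not_le.2 (Finset.sum_lt_sum (fun j _ => ?_) ⟨i, Finset.mem_univ i, ?_⟩))
  · rcases eq_or_ne j i with rfl | hj
    · simp
    · rw [Function.update_of_ne hj]
  · simp

theorem map_inl_X_ne_zero (i : Ψ) : Θ i (Ring.inl q E PowerSeries.X) ≠ 0 := fun h =>
  H.not_X_pow_succ_dvd hd hsum i (h ▸ dvd_zero _)

theorem map_inl_X_dvd (i : Ψ) : Θ i (Ring.inl q E PowerSeries.X) ∣ PowerSeries.X ^ d i := by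
  obtain ⟨u, hu⟩ := hd i
  have h : IsUnit u := by
    rw [PowerSeries.isUnit_iff_constantCoeff, isUnit_iff_ne_zero]
    intro h0
    apply H.not_X_pow_succ_dvd hd hsum i
    rw [hu, pow_succ]
    exact mul_dvd_mul_left _ (PowerSeries.X_dvd_iff.2 h0)
  rw [hu]
  exact (associated_mul_unit_right _ u h).symm.dvd

theorem constantCoeff_eq_zero {f : ι → Λ⟦X⟧}
    (hf : ∀ i, (PowerSeries.X : Λ⟦X⟧) ^ d i ∣ Θ i (ofCoord q e f)) (j : ι) :
    PowerSeries.constantCoeff (f j) = 0 := by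
  refine congrFun ((H.truncation_bijective e hd hsum).1
    (a₁ := fun j => PowerSeries.constantCoeff (f j)) (a₂ := 0) ?_) j
  rw [map_zero]
  funext i m
  have h1 := hf i
  rw [ofCoord_split, map_add, map_mul] at h1
  exact PowerSeries.X_pow_dvd_iff.1 ((dvd_add_left ((hd i).mul_right _)).1 h1) m m.2

/-- Bijectivity of the truncation kills the constant coordinates. One then divides by `X`, whose
image is nonzero in each domain `Λ⟦X⟧`, and repeats. -/
theorem injective_pi : Function.Injective fun (w : Ring q E) i => Θ i w := by
  have key : ∀ (m : ℕ) (f : Module.Free.ChooseBasisIndex Q E → Λ⟦X⟧),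
      (∀ i, Θ i (ofCoord q (Module.Free.chooseBasis Q E) f) = 0) →
      ∀ j, PowerSeries.coeff m (f j) = 0 := by
    intro m
    induction m with
    | zero =>
      intro f hf j
      rw [PowerSeries.coeff_zero_eq_constantCoeff_apply]
      exact H.constantCoeff_eq_zero _ hd hsum (fun i => hf i ▸ dvd_zero _) j
    | succ m ih =>
      intro f hf j
      have h0 := H.constantCoeff_eq_zero _ hd hsum (fun i => hf i ▸ dvd_zero _)
      have := ih (fun j => PowerSeries.mk fun m => PowerSeries.coeff (m + 1) (f j)) (fun i => by
        have h1 := hf i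
        rw [ofCoord_split, map_add, map_mul] at h1
        simp only [h0, map_zero] at h1
        have h2 : ofCoord q (Module.Free.chooseBasis Q E) (fun _ => (0 : Λ⟦X⟧)) = 0 := by
          simp [ofCoord]
        rw [h2, map_zero, zero_add] at h1
        exact (mul_eq_zero.1 h1).resolve_left (H.map_inl_X_ne_zero hd hsum i)) j
      rwa [PowerSeries.coeff_mk] at this
  intro w w' h
  obtain ⟨f, hf⟩ := exists_ofCoord (q := q) (Module.Free.chooseBasis Q E) (w - w')
  have hz : f = 0 := by
    funext j
    ext m
    refine key m f (fun i => ?_) j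
    rw [hf, map_sub, sub_eq_zero]
    exact congrFun h i
  rw [← sub_eq_zero, ← hf, hz]
  simp [ofCoord]

/-- Successive approximation: constant coordinates match a given `v` up to a multiple of the image
of `X`. The quotients form a new target, and the constants found at each stage are the coefficients
of the solution. -/
theorem surjective_pi (hX : ∀ i, (PowerSeries.X : Λ⟦X⟧) ∣ Θ i (Ring.inl q E PowerSeries.X)) :
    Function.Surjective fun (w : Ring q E) i => Θ i w := by
  let e := Module.Free.chooseBasis Q E
  have step : ∀ v : Ψ → Λ⟦X⟧, ∃ (c : Module.Free.ChooseBasisIndex Q E → Λ) (v' : Ψ → Λ⟦X⟧),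
      ∀ i, v i - Θ i (ofCoord q e fun j => PowerSeries.C (c j)) =
        Θ i (Ring.inl q E PowerSeries.X) * v' i := by
    intro v
    obtain ⟨w, hw⟩ := H.exists_forall_X_pow_dvd_sub d v
    obtain ⟨f, rfl⟩ := exists_ofCoord e w
    have h1 : ∀ i, Θ i (Ring.inl q E PowerSeries.X) ∣ v i - Θ i (ofCoord q e fun j =>
        PowerSeries.C (PowerSeries.constantCoeff (f j))) := by
      intro i
      have h2 := (H.map_inl_X_dvd hd hsum i).trans (hw i)
      rw [ofCoord_split, map_add, map_mul, add_sub_right_comm] at h2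
      rw [← neg_sub, dvd_neg]
      exact (dvd_add_left (dvd_mul_right _ _)).1 h2
    choose v' hv' using h1
    exact ⟨_, v', hv'⟩
  choose c v' hv' using step
  let F : (Ψ → Λ⟦X⟧) → Module.Free.ChooseBasisIndex Q E → Λ⟦X⟧ := fun v j =>
    PowerSeries.mk fun m => c (v'^[m] v) j
  have key : ∀ (N : ℕ) (v : Ψ → Λ⟦X⟧) (i : Ψ),
      (PowerSeries.X : Λ⟦X⟧) ^ N ∣ v i - Θ i (ofCoord q e (F v)) := by
    intro N
    induction N with
    | zero => intro v i; simp
    | succ N ih =>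
      intro v i
      have h1 : (fun j => PowerSeries.mk fun m => PowerSeries.coeff (m + 1) (F v j)) =
          F (v' v) := by
        funext j
        ext m
        simp [F, Function.iterate_succ_apply]
      have h2 : ∀ j, PowerSeries.constantCoeff (F v j) = c v j := fun j => by
        rw [← PowerSeries.coeff_zero_eq_constantCoeff_apply]
        simp [F]
      rw [ofCoord_split, h1, map_add, map_mul, ← sub_sub]
      simp only [h2]
      rw [hv', ← mul_sub, pow_succ']
      exact mul_dvd_mul (hX i) (ih _ _)
  intro v
  refine ⟨ofCoord q e (F v), ?_⟩
  funext i
  ext m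
  have := PowerSeries.X_pow_dvd_iff.1 (key (m + 1) v i) m (Nat.lt_succ_self m)
  rw [map_sub, sub_eq_zero] at this
  exact this.symm

end bijective

end IsExpansionFamily

end Decomposition
end

noncomputable section

/-! ### From a nonzero orbit determinant to a unit one. -/

section UnitDet

open BaseChange (Ring)

variable {A : Type*} [CommRing A] {Q : Type*} [Field Q] {E : Type*} [CommRing E] [Algebra Q E]
  (q : Q →+* A) {N : Type*} [AddCommGroup N] [Module A N] (ρ : E →+* Module.End A N)
  (hρ : ∀ a, ρ (algebraMap Q E a) = algebraMap A _ (q a))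

/-- The action of `E ⊗ A` on an `A`-module with an action of `E`. -/
def ringAction : Ring q E →+* Module.End A N :=
  BaseChange.Ring.lift q (algebraMap A _) (fun b x => Algebra.commutes b x) ρ hρ

theorem ringAction_inl (c : A) (x : N) : ringAction q ρ hρ (Ring.inl q E c) x = c • x := by
  rw [ringAction, BaseChange.Ring.lift_inl, Module.algebraMap_end_apply]

theorem ringAction_inr (a : E) : ringAction q ρ hρ (Ring.inr q E a) = ρ a :=
  BaseChange.Ring.lift_inr _ _ _ _ _ _

variable {n : Type*} [Fintype n] (e : Module.Basis n Q E)

theorem ringAction_sum (c : n → A) (x : N) :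
    ringAction q ρ hρ (∑ j, (Ring.inl q E (c j) * Ring.inr q E (e j) : Ring q E)) x =
      ∑ j, c j • ρ (e j) x := by
  rw [map_sum, LinearMap.sum_apply]
  refine Finset.sum_congr rfl fun j _ => ?_
  rw [map_mul, Module.End.mul_apply, ringAction_inl, ringAction_inr]

theorem ringAction_apply (w : Ring q E) (x : N) :
    ringAction q ρ hρ w x = ∑ j, Ring.coord q e w j • ρ (e j) x := by
  conv_lhs => rw [BaseChange.Ring.eq_sum_coord q e w]
  exact ringAction_sum q ρ hρ e _ x

variable [DecidableEq n]

/-- Cramer's rule for the matrix whose columns are the orbit of `v`. -/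
theorem exists_ringAction_eq_smul (b : Module.Basis n A N) (v x : N) :
    ∃ w, ringAction q ρ hρ w v = b.det (fun j => ρ (e j) v) • x := by
  let V := b.toMatrix fun j => ρ (e j) v
  refine ⟨∑ j, (Ring.inl q E (V.cramer (b.repr x) j) * Ring.inr q E (e j) : Ring q E), ?_⟩
  rw [ringAction_sum]
  apply b.repr.injective
  ext i
  have := congrFun (Matrix.mulVec_cramer V (b.repr x)) i
  rw [map_smul, Finsupp.smul_apply, Module.Basis.det_apply]
  rw [Pi.smul_apply] at this
  rw [← this]
  simp only [map_sum, map_smul, Finsupp.finsetSum_apply, Finsupp.smul_apply, smul_eq_mul,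
    Matrix.mulVec, dotProduct]
  exact Finset.sum_congr rfl fun j _ => mul_comm _ _

include hρ in
/-- If `E ⊗ A` is a principal ideal ring then a faithful orbit spans a free submodule that can be
enlarged to the whole module. -/
theorem exists_isUnit_det [IsDomain A] [IsPrincipalIdealRing (Ring q E)] (b : Module.Basis n A N)
    {v₀ : N} (h₀ : b.det (fun j => ρ (e j) v₀) ≠ 0) :
    ∃ v, IsUnit (b.det fun j => ρ (e j) v) := by
  let act := ringAction q ρ hρ
  let δ := b.det fun j => ρ (e j) v₀
  -- `J` consists of the elements that send `v₀` into `δ N`. Dividing by `δ` maps `J` onto `N`, by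
  -- Cramer's rule, so a generator of `J` yields a generator `v` of `N`.
  let J : Ideal (Ring q E) :=
    { carrier := {w | ∃ x, act w v₀ = δ • x}
      add_mem' := by
        rintro w w' ⟨x, hx⟩ ⟨x', hx'⟩
        exact ⟨x + x', by rw [map_add, LinearMap.add_apply, hx, hx', smul_add]⟩
      zero_mem' := ⟨0, by rw [map_zero, smul_zero]; rfl⟩
      smul_mem' := by
        rintro u w ⟨x, hx⟩
        exact ⟨act u x, by
          rw [smul_eq_mul, map_mul, Module.End.mul_apply, hx, map_smul]⟩ }
  obtain ⟨w₁, hw₁⟩ := (IsPrincipalIdealRing.principal J).principal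
  have hmem : ∀ w, w ∈ J ↔ ∃ x, act w v₀ = δ • x := fun w => Iff.rfl
  obtain ⟨v, hv⟩ := (hmem w₁).1 (by rw [hw₁]; exact Submodule.mem_span_singleton_self _)
  have hsmul : ∀ x y : N, δ • x = δ • y → x = y := by
    intro x y hxy
    apply b.repr.injective
    ext i
    have := congrArg (fun z => b.repr z i) hxy
    simp only [map_smul, Finsupp.smul_apply, smul_eq_mul] at this
    exact mul_left_cancel₀ h₀ this
  have hgen : ∀ x, ∃ u, act u v = x := by
    intro x
    obtain ⟨w, hw⟩ := exists_ringAction_eq_smul q ρ hρ e b v₀ x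
    have h1 : w ∈ J := (hmem w).2 ⟨x, hw⟩
    rw [hw₁] at h1
    obtain ⟨u, rfl⟩ := Submodule.mem_span_singleton.1 h1
    refine ⟨u, hsmul _ _ ?_⟩
    refine Eq.trans ?_ hw
    rw [← map_smul, ← hv, smul_eq_mul, map_mul, Module.End.mul_apply]
  choose u hu using fun j => hgen (b j)
  refine ⟨v, ?_⟩
  rw [Module.Basis.det_apply]
  refine Matrix.isUnit_det_of_right_inverse
    (B := Matrix.of fun j i => Ring.coord q e (u i) j) ?_
  ext i l
  have := congrArg (fun x => b.repr x i) (hu l)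
  simp only [act, ringAction_apply q ρ hρ e, map_sum, map_smul, Finsupp.finsetSum_apply,
    Finsupp.smul_apply, smul_eq_mul, Module.Basis.repr_self] at this
  rw [Matrix.mul_apply, Matrix.one_apply]
  rw [Finsupp.single_apply] at this
  simp only [Module.Basis.toMatrix_apply, Matrix.of_apply]
  refine Eq.trans ?_ (this.trans (by simp only [eq_comm]))
  exact Finset.sum_congr rfl fun j _ => mul_comm _ _

end UnitDet

namespace LocalShtuka

/-! ### The product decomposition for local fields, and the principal ideal property. -/

section Expansion

open BaseChange (Ring)

variable {k : Type*} [Field k] [Fintype k] {p : ℕ} [hp : Fact p.Prime] [CharP k⸨X⸩ p]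
  [CharP k p]
  {Λ : Type*} [Field Λ] [CharP Λ p] {E : Type*} [CommRing E] [Algebra k⸨X⸩ E]
  [Module.Finite k⸨X⸩ E]
  {q : k⸨X⸩ →+* Λ⟦X⟧} {c : Λ}
  {y : (ψ : Emb k E (PowerSeries.constantCoeff.comp q)) → CM.Factor ψ}
  {Θ : Emb k E (PowerSeries.constantCoeff.comp q) → Ring q E →+* Λ⟦X⟧}

theorem isExpansionFamily [Fintype (Emb k E (PowerSeries.constantCoeff.comp q))]
    (hΘ : ∀ ψ, IsExpansion ψ (y ψ) (Θ ψ)) :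
    IsExpansionFamily (fun ψ : Emb k E (PowerSeries.constantCoeff.comp q) => ψ.1) Θ where
  injective := Subtype.val_injective
  map_C ψ := (hΘ ψ).map_C
  constantCoeff_map ψ := (hΘ ψ).constantCoeff_map
  exists_uniformizer ψ := by
    obtain ⟨e, he⟩ := Ideal.Quotient.mk_surjective (y ψ)
    exact ⟨e, (hΘ ψ).map_uniformizer e he⟩

theorem bijective_pi_of_isExpansion (p : ℕ) [hp : Fact p.Prime] [CharP k⸨X⸩ p]
    [CharP k p] [CharP Λ p] [IsSemisimpleRing E]
    (hq : q (algebraMap k⟦X⟧ k⸨X⸩ PowerSeries.X) = PowerSeries.C c + PowerSeries.X)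
    (hemb : ∀ (ψ : Emb k E ((algebraMap Λ (AlgebraicClosure Λ)).comp
      (PowerSeries.constantCoeff.comp q))) (a : E),
      ψ.1 a ∈ (algebraMap Λ (AlgebraicClosure Λ)).range)
    (hΘ : ∀ ψ, IsExpansion ψ (y ψ) (Θ ψ)) :
    Function.Bijective fun (w : Ring q E) ψ => Θ ψ w := by
  have := Fintype.ofFinite (Emb k E (PowerSeries.constantCoeff.comp q))
  have H := isExpansionFamily hΘ
  have hd : ∀ ψ, (PowerSeries.X : Λ⟦X⟧) ^ CM.insepDegree ψ ∣ Θ ψ (Ring.inl q E PowerSeries.X) :=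
    fun ψ => X_pow_insepDegree_dvd p hq (hΘ ψ).map_C (hΘ ψ).constantCoeff_map
  exact ⟨H.injective_pi hd (sum_insepDegree hemb),
    H.surjective_pi hd (sum_insepDegree hemb) fun ψ => PowerSeries.X_dvd_iff.2
      (constantCoeff_inl_X hq (hΘ ψ).map_C (hΘ ψ).constantCoeff_map)⟩

/-- A field with `[F : F^p] = p` is not perfect. Such an element serves as expansion parameter where
no uniformizer is prescribed. -/
theorem exists_notPow (ψ : Emb k E (PowerSeries.constantCoeff.comp q)) :
    ∃ y : CM.Factor ψ, NotPow p y := by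
  have := ψ.isMaximal_ker
  have := PerfectField.ofFinite (K := k)
  let : Field (CM.Factor ψ) := Ideal.Quotient.field _
  have : CharP (CM.Factor ψ) p := charP_quotient k⸨X⸩ _
  have hF : PRankOne (F := CM.Factor ψ) p :=
    (LaurentSeries.pRankOne (k := k) (p := p)).of_finite
  obtain ⟨y, hy⟩ := hF.exists_notMem
  exact ⟨y, fun w hw => hy ⟨w, hw⟩⟩

/-- Over an algebraically closed field the condition on embeddings is automatic, and a finite
product of power series rings over a field is principal. -/
theorem isPrincipalIdealRing_of_isAlgClosed (p : ℕ) [hp : Fact p.Prime] [CharP k⸨X⸩ p]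
    [CharP k p] [CharP Λ p] [IsSemisimpleRing E] [IsAlgClosed Λ]
    (hq : q (algebraMap k⟦X⟧ k⸨X⸩ PowerSeries.X) = PowerSeries.C c + PowerSeries.X) :
    IsPrincipalIdealRing (Ring q E) := by
  choose y hy using fun ψ : Emb k E (PowerSeries.constantCoeff.comp q) =>
    exists_notPow (p := p) ψ
  choose Θ hΘ using fun ψ => exists_isExpansion hq (hy ψ)
  have hbij := bijective_pi_of_isExpansion p hq (fun ψ a =>
    IsAlgClosed.algebraMap_bijective_of_isIntegral (k := Λ) (K := AlgebraicClosure Λ).2 (ψ.1 a)) hΘ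
  let g : Ring q E ≃+* (Emb k E (PowerSeries.constantCoeff.comp q) → Λ⟦X⟧) :=
    RingEquiv.ofBijective (RingHom.pi Θ) hbij
  exact IsPrincipalIdealRing.of_surjective g.symm g.symm.surjective

end Expansion

section Shift

variable {R : Type*} [CommRing R] [IsLocalRing R] [IsAdicComplete (IsLocalRing.maximalIdeal R) R]

/-- The shift by `-ζ` is a left inverse, because a map of power series rings that fixes constants
and `X` is the identity. -/
theorem taylorShift_injective (P : CharPoint R) : Function.Injective (taylorShift P) := by
  let P' : CharPoint R := ⟨-P.ζ, neg_mem P.mem, neg_ne_zero.2 P.ne_zero⟩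
  have hX : taylorShift P' (taylorShift P PowerSeries.X) = PowerSeries.X := by
    rw [taylorShift_X, map_add, taylorShift_X]
    refine (congrArg (· + _) ((taylorShift P').commutes P.ζ)).trans ?_
    change PowerSeries.C P.ζ + (PowerSeries.C (-P.ζ) + PowerSeries.X) = _
    rw [map_neg]
    ring
  have h : (taylorShift P').toRingHom.comp (taylorShift P).toRingHom = RingHom.id _ := by
    refine PowerSeries.ringHom_ext_of_X (fun c => ?_) hX ?_
    · exact ((taylorShift P').comp (taylorShift P)).commutes c
    · exact (congrArg _ hX).trans (by simp)
  exact Function.LeftInverse.injective (g := taylorShift P') fun x => RingHom.congr_fun h x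

theorem frobSeries_injective {k S : Type*} [Field k] [Fintype k] [CommRing S] [IsDomain S]
    (φ : k →+* S) : Function.Injective (frobSeries φ) :=
  PowerSeries.map_injective _ <| by
    let : Algebra k S := φ.toAlgebra
    rw [injective_iff_map_eq_zero]
    exact fun x hx => eq_zero_of_pow_eq_zero (n := Fintype.card k) hx

end Shift

/-! ### Cyclic vectors in the de Rham realizations. -/

section Generator

variable {k : Type*} [Field k] [Fintype k] {R : Type*} [CommRing R] [IsDomain R] [IsLocalRing R]
  [IsAdicComplete (IsLocalRing.maximalIdeal R) R] [Algebra k R] {P : CharPoint R}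
  (L : Type*) [Field L] [Algebra R L] [IsFractionRing R L]

theorem toSeries_injective : Function.Injective (toSeries L P) :=
  (PowerSeries.map_injective _ (IsFractionRing.injective R L)).comp (taylorShift_injective P)

theorem qToSeries_X : qToSeries k L P (algebraMap k⟦X⟧ k⸨X⸩ PowerSeries.X) =
    PowerSeries.C (algebraMap R L P.ζ) + PowerSeries.X := by
  rw [qToSeries_algebraMap, PowerSeries.algebraMap_apply'', PowerSeries.map_X]
  change PowerSeries.map (algebraMap R L) (taylorShift P PowerSeries.X) = _
  rw [taylorShift_X]
  simp

variable (M : LocalShtuka k P)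

/-- The action of `QEnd_R(M)` on a base change of `σ̂^*M`. -/
def qEndPullback {B : Type*} [CommRing B] (g : R⟦X⟧ →+* B) (q : k⸨X⸩ →+* B)
    (hq : ∀ a, q (algebraMap k⟦X⟧ k⸨X⸩ a) = g (algebraMap k⟦X⟧ R⟦X⟧ a)) :
    M.QEnd →+* Module.End B (BaseChange g M.sigmaPullback) :=
  tensorLift ((algebraMap B _).comp q) (fun _ x => Algebra.commutes _ x)
    (M.endPullback g) (fun a => by rw [endPullback_algebraMap, RingHom.comp_apply, hq])

theorem qEndPullback_one_tmul {B : Type*} [CommRing B] (g : R⟦X⟧ →+* B) (q : k⸨X⸩ →+* B)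
    (hq : ∀ a, q (algebraMap k⟦X⟧ k⸨X⸩ a) = g (algebraMap k⟦X⟧ R⟦X⟧ a)) (f : M.End) :
    M.qEndPullback g q hq (1 ⊗ₜ f) = M.endPullback g f := by
  rw [qEndPullback, tensorLift_tmul, map_one, one_mul]

theorem qEndPullback_algebraMap {B : Type*} [CommRing B] (g : R⟦X⟧ →+* B) (q : k⸨X⸩ →+* B)
    (hq : ∀ a, q (algebraMap k⟦X⟧ k⸨X⸩ a) = g (algebraMap k⟦X⟧ R⟦X⟧ a)) (a : k⸨X⸩) :
    M.qEndPullback g q hq (algebraMap k⸨X⸩ M.QEnd a) = algebraMap B _ (q a) := by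
  refine (tensorLift_tmul _ _ _ _ a 1).trans ?_
  rw [map_one, mul_one, RingHom.comp_apply]

theorem det_endPullback {n : Type*} [Fintype n] [DecidableEq n] {B : Type*} [CommRing B]
    (g : R⟦X⟧ →+* B) (b : Module.Basis n R⟦X⟧ M.carrier) (f : n → M.End)
    (x : BaseChange g M.sigmaPullback) :
    (BaseChange.basis g (BaseChange.basis (sigmaHat k R) b)).det
        (fun j => M.endPullback g (f j) x) =
      MvPolynomial.eval (fun l => (BaseChange.basis g (BaseChange.basis (sigmaHat k R) b)).repr x l)
        (MvPolynomial.map g (MvPolynomial.map (sigmaHat k R) (orbitDet b fun j => (f j).1))) := by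
  rw [map_orbitDet, map_orbitDet, eval_orbitDet]
  rfl

namespace CM

variable {M} {E : Type*} [CommRing E] [Algebra k⸨X⸩ E] [Module.Finite k⸨X⸩ E] [IsSemisimpleRing E]
  (C : M.CM E)

/-- A nonzero polynomial over `R⟦z⟧` could vanish at `z = ζ`. Over `Λ⟦z-ζ⟧`, with `Λ` algebraically
closed, a vector with nonzero determinant can be improved to one with unit determinant, and the unit
stays nonzero modulo `z - ζ`. -/
theorem map_orbitDet_ne_zero (b : Module.Basis (Fin M.rank) R⟦X⟧ M.carrier)
    (e : Module.Basis (Fin M.rank) k⸨X⸩ E) (f : Fin M.rank → M.End)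
    (hf : ∀ j, C.ι (e j) = 1 ⊗ₜ f j) :
    MvPolynomial.map ((algebraMap R L).comp (evalZeta P))
      (MvPolynomial.map (sigmaHat k R) (orbitDet b fun j => (f j).1)) ≠ 0 := by
  obtain ⟨p, hp⟩ := CharP.exists k
  have : Fact p.Prime := ⟨CharP.char_is_prime k p⟩
  have := LaurentSeries.charP (k := k) (p := p)
  let Λ := AlgebraicClosure L
  have : CharP Λ p := charP_of_injective_ringHom
    (((algebraMap L Λ).comp (algebraMap R L)).comp (algebraMap k R)).injective p
  let i : L⟦X⟧ →+* Λ⟦X⟧ := PowerSeries.map (algebraMap L Λ)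
  have hi : Function.Injective i := PowerSeries.map_injective _ (algebraMap L Λ).injective
  let q : k⸨X⸩ →+* Λ⟦X⟧ := i.comp (qToSeries k L P)
  let g : R⟦X⟧ →+* Λ⟦X⟧ := i.comp (toSeries L P)
  have hq : q (algebraMap k⟦X⟧ k⸨X⸩ PowerSeries.X) =
      PowerSeries.C (algebraMap L Λ (algebraMap R L P.ζ)) + PowerSeries.X := by
    rw [RingHom.comp_apply, qToSeries_X, map_add, PowerSeries.map_C, PowerSeries.map_X]
  have := isPrincipalIdealRing_of_isAlgClosed (E := E) p hq
  have hgq : ∀ a, q (algebraMap k⟦X⟧ k⸨X⸩ a) = g (algebraMap k⟦X⟧ R⟦X⟧ a) := fun a =>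
    congrArg i (qToSeries_algebraMap k L P a)
  let ρ : E →+* Module.End Λ⟦X⟧ (BaseChange g M.sigmaPullback) :=
    (M.qEndPullback g q hgq).comp C.ι.toRingHom
  have hρ : ∀ a, ρ (algebraMap k⸨X⸩ E a) = algebraMap _ _ (q a) := fun a => by
    exact (congrArg (M.qEndPullback g q hgq) (C.ι.commutes a)).trans
      (M.qEndPullback_algebraMap g q hgq a)
  have hρf : ∀ j, ρ (e j) = M.endPullback g (f j) := fun j =>
    (congrArg (M.qEndPullback g q hgq) (hf j)).trans (M.qEndPullback_one_tmul g q hgq _)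
  let bg := BaseChange.basis g (BaseChange.basis (sigmaHat k R) b)
  have hne : orbitDet bg (fun j => M.endPullback g (f j)) ≠ 0 := by
    have h1 : orbitDet bg (fun j => M.endPullback g (f j)) = MvPolynomial.map g
        (MvPolynomial.map (sigmaHat k R) (orbitDet b fun j => (f j).1)) := by
      rw [map_orbitDet, map_orbitDet]
      rfl
    rw [h1]
    have h2 := MvPolynomial.map_injective (σ := Fin M.rank) g (hi.comp (toSeries_injective L (P := P)))
    have h3 := MvPolynomial.map_injective (σ := Fin M.rank) _
      (frobSeries_injective (algebraMap k R))
    exact (map_ne_zero_iff (MvPolynomial.map g) h2).2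
      ((map_ne_zero_iff (MvPolynomial.map (sigmaHat k R)) h3).2 (C.orbitDet_end_ne_zero b e f hf))
  have : Infinite Λ⟦X⟧ := Infinite.of_injective _ (PowerSeries.C_injective (R := Λ))
  obtain ⟨v₀, h₀⟩ := exists_det_ne_zero hne
  simp only [← hρf] at h₀
  obtain ⟨v, hv⟩ := exists_isUnit_det q ρ hρ e bg h₀
  simp only [hρf] at hv
  rw [det_endPullback] at hv
  have hv' := (hv.map (PowerSeries.constantCoeff (R := Λ))).ne_zero
  intro h
  apply hv'
  -- Modulo `z - ζ` the map `g` becomes evaluation at `z = ζ`, so the constant term of the unit is a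
  -- value of the polynomial in question.
  have hg : (PowerSeries.constantCoeff (R := Λ)).comp g =
      (algebraMap L Λ).comp ((algebraMap R L).comp (evalZeta P)) := by
    ext x
    simp only [RingHom.comp_apply, g, i, toSeries, evalZeta]
    rw [← PowerSeries.coeff_zero_eq_constantCoeff_apply,
      ← PowerSeries.coeff_zero_eq_constantCoeff_apply, PowerSeries.coeff_map,
      PowerSeries.coeff_map]
  rw [← MvPolynomial.eval₂_eq_eval_map, MvPolynomial.eval₂_comp_left, hg,
    MvPolynomial.eval₂_eq_eval_map, ← MvPolynomial.map_map, h, map_zero, map_zero]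

theorem exists_orbit_basis {n : Type*} [Fintype n] [DecidableEq n] {B : Type*} [CommRing B]
    (g : R⟦X⟧ →+* B) (b : Module.Basis n R⟦X⟧ M.carrier) (f : n → M.End) (c : n → B)
    (hc : IsUnit (MvPolynomial.eval c
      (MvPolynomial.map g (MvPolynomial.map (sigmaHat k R) (orbitDet b fun j => (f j).1))))) :
    ∃ (v : BaseChange g M.sigmaPullback) (t : Module.Basis n B (BaseChange g M.sigmaPullback)),
      ∀ j, t j = M.endPullback g (f j) v := by
  let bg := BaseChange.basis g (BaseChange.basis (sigmaHat k R) b)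
  let v := bg.equivFun.symm c
  have hv : IsUnit (bg.det fun j => M.endPullback g (f j) v) := by
    rw [det_endPullback]
    convert hc using 3
    exact bg.equivFun.apply_symm_apply c
  obtain ⟨h1, h2⟩ := (Module.Basis.is_basis_iff_det bg).2 hv
  exact ⟨v, Module.Basis.mk h1 h2.ge, fun j => Module.Basis.mk_apply h1 h2.ge j⟩

/-- Some basis of `E` has an orbit that is a basis of `H¹_dR(M, L⟦z-ζ⟧)`, and an orbit that is a
basis of `H¹_dR(M, L)`. -/
theorem exists_generator : ∃ e : Module.Basis (Fin M.rank) k⸨X⸩ E,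
    (∃ (v : M.deRhamSeries L) (t : Module.Basis (Fin M.rank) L⟦X⟧ (M.deRhamSeries L)),
      ∀ j, t j = M.qEndSeries L (C.ι (e j)) v) ∧
    ∃ (v : M.deRhamL L) (t : Module.Basis (Fin M.rank) L (M.deRhamL L)),
      ∀ j, t j = C.actionL L (e j) v := by
  have : Infinite k⸨X⸩ := Infinite.of_injective _
    ((IsFractionRing.injective k⟦X⟧ k⸨X⸩).comp (Polynomial.coe_injective k))
  have : Infinite L := Infinite.of_injective _ (gamma k L P).injective
  obtain ⟨e, f, hf⟩ := C.exists_basis_end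
  let b : Module.Basis (Fin M.rank) R⟦X⟧ M.carrier := Module.finBasis R⟦X⟧ M.carrier
  obtain ⟨c, hc⟩ : ∃ c, MvPolynomial.eval c (MvPolynomial.map ((algebraMap R L).comp (evalZeta P))
      (MvPolynomial.map (sigmaHat k R) (orbitDet b fun j => (f j).1))) ≠ 0 := by
    by_contra! hn
    exact C.map_orbitDet_ne_zero L b e f hf (MvPolynomial.funext fun c => by rw [hn, map_zero])
  obtain ⟨v, t, ht⟩ := exists_orbit_basis (M := M) _ b f c (IsUnit.mk0 _ hc)
  have hg : (PowerSeries.constantCoeff (R := L)).comp (toSeries L P) =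
      (algebraMap R L).comp (evalZeta P) := by
    ext x
    simp only [RingHom.comp_apply, toSeries, evalZeta]
    rw [← PowerSeries.coeff_zero_eq_constantCoeff_apply,
      ← PowerSeries.coeff_zero_eq_constantCoeff_apply, PowerSeries.coeff_map]
  -- The same coordinates, taken as constant series, give a determinant with nonzero constant term,
  -- hence a unit.
  obtain ⟨v', t', ht'⟩ := exists_orbit_basis (M := M) (toSeries L P) b f
    (fun j => PowerSeries.C (c j)) (by
      rw [PowerSeries.isUnit_iff_constantCoeff, ← MvPolynomial.eval₂_eq_eval_map,
        MvPolynomial.eval₂_comp_left, hg, MvPolynomial.eval₂_eq_eval_map]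
      refine IsUnit.mk0 _ ?_
      convert hc using 3
      funext j
      exact PowerSeries.constantCoeff_C _)
  refine ⟨e, ⟨v', t', fun j => ?_⟩, v, t, fun j => ?_⟩
  · rw [ht', hf]
    exact congrArg (fun h : Module.End L⟦X⟧ (M.deRhamSeries L) => h v')
      (M.qEndPullback_one_tmul _ _ (qToSeries_algebraMap k L P) _).symm
  · rw [ht, actionL, RingHom.comp_apply]
    refine Eq.trans ?_ (congrArg (fun x => M.qEndL L x v) (hf j).symm)
    exact congrArg (fun h : Module.End L (M.deRhamL L) => h v)
      (M.qEndPullback_one_tmul _ _ (gamma_algebraMap L P) _).symm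

/-- With respect to `e` and its orbit basis `t`, the orbit map of `v` is the identity on
coordinates. -/
theorem deRham_equiv : Nonempty (C.deRham L ≃ₗ[ESeries k P E L] ESeries k P E L) := by
  obtain ⟨e, ⟨v, t, ht⟩, -⟩ := C.exists_generator L
  let ρ : E →+* Module.End L⟦X⟧ (M.deRhamSeries L) := (M.qEndSeries L).comp C.ι.toRingHom
  have hρ : ∀ a, ρ (algebraMap k⸨X⸩ E a) = algebraMap _ _ (qToSeries k L P a) := fun a =>
    (congrArg (M.qEndSeries L) (C.ι.commutes a)).trans
      (M.qEndPullback_algebraMap _ _ (qToSeries_algebraMap k L P) a)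
  have hact : ∀ w, C.seriesAction L w v =
      ∑ j, BaseChange.Ring.coord (qToSeries k L P) e w j • t j := fun w => by
    refine (ringAction_apply (qToSeries k L P) ρ hρ e w v).trans ?_
    exact Finset.sum_congr rfl fun j _ => by rw [ht]; rfl
  refine ⟨(LinearEquiv.ofBijective
    (LinearMap.toSpanSingleton (ESeries k P E L) (C.deRham L) (v : C.deRham L)) ⟨?_, ?_⟩).symm⟩
  · rw [injective_iff_map_eq_zero]
    intro w hw
    have h1 := (hact w).symm.trans hw
    have h2 := Fintype.linearIndependent_iff.1 t.linearIndependent _ h1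
    apply (BaseChange.Ring.coord (qToSeries k L P) e).injective
    rw [map_zero]
    ext j : 1
    exact h2 j
  · intro x
    refine ⟨∑ j, (BaseChange.Ring.inl _ E (t.repr (x : M.deRhamSeries L) j) *
      BaseChange.Ring.inr _ E (e j) : ESeries k P E L), ?_⟩
    refine (hact _).trans (Eq.trans ?_ (t.sum_repr x))
    exact Finset.sum_congr rfl fun j _ => congrArg (· • t j)
      (BaseChange.Ring.coord_sum (qToSeries k L P) e (fun j => t.repr x j) j)

end CM

end Generator

end LocalShtuka
end

/-! ### Decomposing `H¹_dR(M, L⟦z-ζ⟧)` along the embeddings. -/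

noncomputable section

namespace BaseChange

variable {W : Type*} [CommRing W] {N : Type*} [AddCommGroup N] [Module W N]

theorem nonempty_equiv_of_equiv (g : N ≃ₗ[W] W) {B : Type*} [CommRing B] (f : W →+* B) :
    Nonempty (BaseChange f N ≃ₗ[B] B) :=
  ⟨(basis f ((Module.Basis.singleton Unit W).map g.symm)).equivFun ≪≫ₗ
    LinearEquiv.funUnique Unit B B⟩

theorem bijective_mk_pi (g : N ≃ₗ[W] W) {ι : Type*} {B : ι → Type*} [∀ i, CommRing (B i)]
    (f : ∀ i, W →+* B i) (hf : Function.Bijective fun w i => f i w) :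
    Function.Bijective fun (x : N) i => mk (f i) x := by
  let b := (Module.Basis.singleton Unit W).map g.symm
  have h : Function.Bijective fun (x : N) i => (basis (f i) b).equivFun (mk (f i) x) () := by
    have h1 : (fun (x : N) i => (basis (f i) b).equivFun (mk (f i) x) ()) =
        (fun w i => f i w) ∘ g := by
      funext x i
      refine (basis_repr_mk (f i) b x ()).trans ?_
      simp [b]
    rw [h1]
    exact hf.comp g.bijective
  have h2 : Function.Bijective fun (y : ∀ i, BaseChange (f i) N) i =>
      (basis (f i) b).equivFun (y i) () :=
    Function.Bijective.piMap (fun i => ((basis (f i) b).equivFun ≪≫ₗ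
      LinearEquiv.funUnique Unit (B i) (B i)).bijective)
  exact (Function.Bijective.of_comp_iff' h2 _).1 h

end BaseChange

namespace LocalShtuka

namespace CM

variable {k : Type*} [Field k] [Fintype k]

/-- A `p`-th root of an integral element is integral, and an irreducible element is not a `p`-th
power. This is all that the expansion theory needs from a uniformizer. -/
theorem IsUniformizer.notPow {F : Type*} [CommRing F] [Algebra k⸨X⸩ F] {y : F}
    (hy : IsUniformizer k y) {p : ℕ} (hp : p.Prime) : NotPow p y := by
  let : Algebra k⟦X⟧ F := ((algebraMap k⸨X⸩ F).comp (algebraMap k⟦X⟧ k⸨X⸩)).toAlgebra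
  obtain ⟨h, hirr⟩ := hy
  rintro w rfl
  have hw : w ∈ integralClosure k⟦X⟧ F := IsIntegral.of_pow hp.pos h
  exact not_irreducible_pow (M := integralClosure k⟦X⟧ F) (x := ⟨w, hw⟩) hp.one_lt.ne' hirr

variable {R : Type*} [CommRing R] [IsDomain R] [IsLocalRing R]
  [IsAdicComplete (IsLocalRing.maximalIdeal R) R] [Algebra k R] {P : CharPoint R}
  {L : Type*} [Field L] [Algebra R L] [IsFractionRing R L]
  {E : Type*} [CommRing E] [Algebra k⸨X⸩ E] [Module.Finite k⸨X⸩ E]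

theorem Expansion.isExpansion {ψ : Emb k E (gamma k L P)} {y : Factor ψ} (Θ : Expansion ψ y) :
    IsExpansion (q := qToSeries k L P) ψ y Θ.toRingHom :=
  ⟨Θ.map_C, Θ.constantCoeff_map, Θ.map_uniformizer⟩

section charP

variable (p : ℕ) [hp : Fact p.Prime] [CharP k⸨X⸩ p] [CharP k p] [CharP L p]

theorem Expansion.eq_of_notPow {ψ : Emb k E (gamma k L P)} {y : Factor ψ} (hy : NotPow p y)
    (Θ Θ' : Expansion ψ y) : Θ = Θ' :=
  Expansion.ext (IsExpansion.unique (q := qToSeries k L P) (qToSeries_X L) hy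
    Θ.isExpansion Θ'.isExpansion)

theorem nonempty_expansion {ψ : Emb k E (gamma k L P)} {y : Factor ψ} (hy : NotPow p y) :
    Nonempty (Expansion ψ y) := by
  obtain ⟨Θ, hΘ⟩ := exists_isExpansion (q := qToSeries k L P) (ψ := ψ) (qToSeries_X L) hy
  exact ⟨⟨Θ, hΘ.map_C, hΘ.constantCoeff_map, hΘ.map_uniformizer⟩⟩

end charP

variable [IsSemisimpleRing E] {M : LocalShtuka k P} (C : M.CM E)

theorem exists_expansion_decomposition
    (hemb : ∀ (ψ : Emb k E ((algebraMap L (AlgebraicClosure L)).comp (gamma k L P))) (a : E),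
      ψ.1 a ∈ (algebraMap L (AlgebraicClosure L)).range)
    (y : (ψ : Emb k E (gamma k L P)) → Factor ψ) (hy : ∀ ψ, IsUniformizer k (y ψ)) :
    ∃ Θ : ∀ ψ, Expansion ψ (y ψ), (∀ Θ' : ∀ ψ, Expansion ψ (y ψ), Θ' = Θ) ∧
      Function.Bijective (fun (x : ESeries k P E L) ψ => (Θ ψ).toRingHom x) ∧
      Function.Bijective
        (fun (ω : C.deRham L) ψ => (BaseChange.mk (Θ ψ).toRingHom ω : C.HPsiSeries (Θ ψ))) ∧
      ∀ ψ, Nonempty (C.HPsiSeries (Θ ψ) ≃ₗ[L⟦X⟧] L⟦X⟧) := by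
  obtain ⟨p, hp⟩ := CharP.exists k
  have : Fact p.Prime := ⟨CharP.char_is_prime k p⟩
  have := LaurentSeries.charP (k := k) (p := p)
  have : CharP L p := charP_of_injective_ringHom (gamma k L P).injective p
  have hy' := fun ψ => (hy ψ).notPow (Fact.out (p := p.Prime))
  let Θ := fun ψ => (nonempty_expansion p (hy' ψ)).some
  have hbij : Function.Bijective (fun (x : ESeries k P E L) ψ => (Θ ψ).toRingHom x) :=
    bijective_pi_of_isExpansion (q := qToSeries k L P) p (qToSeries_X L) hemb
      (fun ψ => (Θ ψ).isExpansion)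
  obtain ⟨g⟩ := C.deRham_equiv L
  exact ⟨Θ, fun Θ' => funext fun ψ => Expansion.eq_of_notPow p (hy' ψ) _ _, hbij,
    BaseChange.bijective_mk_pi g _ hbij, fun ψ => BaseChange.nonempty_equiv_of_equiv g _⟩

end CM

end LocalShtuka
end

/-! ### Simultaneous generalized eigenspaces of a cyclic module. -/

noncomputable section

/-- Independence bounds the sum of the dimensions by that of `D`, so lower bounds adding up to `dim
D` are all equalities. -/
theorem iSupIndep.bijective_of_finrank {L : Type*} [Field L] {D : Type*} [AddCommGroup D]
    [Module L D] [Module.Finite L D] {ι : Type*} [Fintype ι] [DecidableEq ι] {G : ι → Submodule L D}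
    (hG : iSupIndep G) {d : ι → ℕ} (hd : ∀ i, d i ≤ Module.finrank L (G i))
    (hsum : ∑ i, d i = Module.finrank L D) :
    DirectSum.IsInternal G ∧ ∀ i, Module.finrank L (G i) = d i := by
  have hinj : Function.Injective (DirectSum.coeLinearMap G) := hG.dfinsupp_lsum_injective
  have h1 : ∑ i, Module.finrank L (G i) ≤ Module.finrank L D := by
    rw [← Module.finrank_directSum]
    exact LinearMap.finrank_le_finrank_of_injective hinj
  have h2 : ∀ i, d i = Module.finrank L (G i) := by
    have := (Finset.sum_eq_sum_iff_of_le fun i _ => hd i).1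
      (le_antisymm (Finset.sum_le_sum fun i _ => hd i) (hsum ▸ h1))
    exact fun i => this i (Finset.mem_univ i)
  refine ⟨⟨hinj, ?_⟩, fun i => (h2 i).symm⟩
  refine (LinearMap.injective_iff_surjective_of_finrank_eq_finrank (f := DirectSum.coeLinearMap G) ?_).1 hinj
  rw [Module.finrank_directSum, ← hsum]
  exact Finset.sum_congr rfl fun i _ => (h2 i).symm

namespace IsExpansionFamily

open BaseChange (Ring)

variable {Λ : Type*} [Field Λ] {Q : Type*} [Field Q] {E : Type*} [CommRing E] [Algebra Q E]
  [Module.Finite Q E]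
  {q : Q →+* Λ⟦X⟧} {Ψ : Type*} [Fintype Ψ]
  {ψ : Ψ → E →+* Λ} {Θ : Ψ → Ring q E →+* Λ⟦X⟧} (H : IsExpansionFamily ψ Θ)
  {d : Ψ → ℕ}
  (hd : ∀ i, (PowerSeries.X : Λ⟦X⟧) ^ d i ∣ Θ i (Ring.inl q E PowerSeries.X))
  (hsum : ∑ i, d i = Module.finrank Q E)
  {D : Type*} [AddCommGroup D] [Module Λ D] (ρ : E →+* Module.End Λ D)
  (hρ : ∀ a, ρ (algebraMap Q E a) = algebraMap Λ _ (PowerSeries.constantCoeff (q a)))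
  {n : Type*} [Fintype n] (e : Module.Basis n Q E) {v : D} (t : Module.Basis n Λ D)
  (ht : ∀ j, t j = ρ (e j) v)

/-- The action of `E ⊗ Λ⟦X⟧` on a `Λ`-vector space with an action of `E`, through `X ↦ 0`. -/
def residueAction : Ring q E →+* Module.End Λ D :=
  BaseChange.Ring.lift q ((algebraMap Λ _).comp PowerSeries.constantCoeff)
    (fun b x => Algebra.commutes _ x) ρ hρ

theorem residueAction_inl (c : Λ⟦X⟧) : residueAction ρ hρ (Ring.inl q E c) =
    algebraMap Λ _ (PowerSeries.constantCoeff c) :=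
  BaseChange.Ring.lift_inl _ _ _ _ _ _

theorem residueAction_inr (a : E) : residueAction ρ hρ (Ring.inr q E a) = ρ a :=
  BaseChange.Ring.lift_inr _ _ _ _ _ _

include ht

theorem residueAction_ofCoord (f : n → Λ⟦X⟧) :
    residueAction ρ hρ (ofCoord q e f) v = ∑ j, PowerSeries.constantCoeff (f j) • t j := by
  rw [ofCoord, map_sum, LinearMap.sum_apply]
  refine Finset.sum_congr rfl fun j _ => ?_
  rw [map_mul, Module.End.mul_apply, residueAction_inl, residueAction_inr,
    Module.algebraMap_end_apply, ht]

include H hd hsum hρ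

/-- The action on `v` sees only constant coordinates, and by the bijectivity of truncation these
vanish exactly when all truncated expansions do. So `D` behaves as the product of the `Λ[X]/X^(d
i)`. -/
theorem residueAction_eq_zero_iff (w : Ring q E) :
    residueAction ρ hρ w v = 0 ↔ ∀ i, (PowerSeries.X : Λ⟦X⟧) ^ d i ∣ Θ i w := by
  obtain ⟨f, rfl⟩ := exists_ofCoord e w
  rw [residueAction_ofCoord ρ hρ e t ht]
  constructor
  · intro h i
    have h1 := Fintype.linearIndependent_iff.1 t.linearIndependent _ h
    rw [ofCoord_split]
    simp only [h1, map_zero]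
    have h2 : ofCoord q e (fun _ => (0 : Λ⟦X⟧)) = 0 := by simp [ofCoord]
    rw [h2, zero_add, map_mul]
    exact (hd i).mul_right _
  · intro h
    refine Finset.sum_eq_zero fun j _ => ?_
    rw [H.constantCoeff_eq_zero e hd hsum h, zero_smul]

/-- Choose `w m` that expand to `X^m` in the factor `i` and to `0` in the others, modulo the `X^(d
j)`, for `m < d i`. The vectors `w m • v` are independent, and `(a - ψ i a)^(d i)` kills them since
`a - ψ i a` expands without constant term. -/
theorem le_finrank_iInf_maxGenEigenspace (i : Ψ) :
    d i ≤ Module.finrank Λ (⨅ a : E, (ρ a).maxGenEigenspace (ψ i a) : Submodule Λ D) := by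
  classical
  have : Module.Finite Λ D := Module.Finite.of_basis t
  choose w hw using fun m : Fin (d i) => H.exists_forall_X_pow_dvd_sub d
    (Pi.single i ((PowerSeries.X : Λ⟦X⟧) ^ (m : ℕ)))
  have hwi : ∀ m, (PowerSeries.X : Λ⟦X⟧) ^ d i ∣ Θ i (w m) - PowerSeries.X ^ (m : ℕ) := fun m => by
    simpa using hw m i
  have hwj : ∀ m j, j ≠ i → (PowerSeries.X : Λ⟦X⟧) ^ d j ∣ Θ j (w m) := fun m j hj => by
    simpa [hj] using hw m j
  have hmem : ∀ m, residueAction ρ hρ (w m) v ∈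
      (⨅ a : E, (ρ a).maxGenEigenspace (ψ i a) : Submodule Λ D) := by
    intro m
    rw [Submodule.mem_iInf]
    intro a
    rw [Module.End.mem_maxGenEigenspace]
    refine ⟨d i, ?_⟩
    have h1 : ρ a - ψ i a • 1 = residueAction ρ hρ
        (Ring.inr q E a - Ring.inl q E (PowerSeries.C (ψ i a))) := by
      rw [map_sub, residueAction_inr, residueAction_inl, PowerSeries.constantCoeff_C,
        Algebra.algebraMap_eq_smul_one]
    rw [h1, ← map_pow, ← Module.End.mul_apply, ← map_mul,
      H.residueAction_eq_zero_iff hd hsum ρ hρ e t ht]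
    intro j
    rw [map_mul]
    rcases eq_or_ne j i with rfl | hj
    · refine Dvd.dvd.mul_right ?_ _
      rw [map_pow]
      apply pow_dvd_pow_of_dvd
      rw [PowerSeries.X_dvd_iff, map_sub, map_sub, H.map_C, H.constantCoeff_map]
      simp
    · exact (hwj m j hj).mul_left _
  have hli : LinearIndependent Λ fun m : Fin (d i) =>
      (⟨_, hmem m⟩ : (⨅ a : E, (ρ a).maxGenEigenspace (ψ i a) : Submodule Λ D)) := by
    rw [Fintype.linearIndependent_iff]
    intro c hc m
    have h1 : residueAction ρ hρ
        (∑ m, (Ring.inl q E (PowerSeries.C (c m)) * w m : Ring q E)) v = 0 := by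
      have h2 := congrArg Subtype.val hc
      rw [AddSubmonoidClass.coe_finsetSum] at h2
      rw [map_sum, LinearMap.sum_apply]
      refine Eq.trans (Finset.sum_congr rfl fun m _ => ?_) h2
      rw [map_mul, Module.End.mul_apply, residueAction_inl, PowerSeries.constantCoeff_C,
        Module.algebraMap_end_apply]
      rfl
    have h2 := (H.residueAction_eq_zero_iff hd hsum ρ hρ e t ht _).1 h1 i
    have h3 : (PowerSeries.X : Λ⟦X⟧) ^ d i ∣
        ∑ m, PowerSeries.C (c m) * PowerSeries.X ^ (m : ℕ) := by
      rw [map_sum] at h2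
      simp only [map_mul, H.map_C] at h2
      refine (dvd_iff_dvd_of_dvd_sub ?_).1 h2
      rw [← Finset.sum_sub_distrib]
      refine Finset.dvd_sum fun m _ => ?_
      rw [← mul_sub]
      exact (hwi m).mul_left _
    have h4 := PowerSeries.X_pow_dvd_iff.1 h3 m m.2
    rw [map_sum] at h4
    simp only [PowerSeries.coeff_C_mul, PowerSeries.coeff_X_pow, mul_ite, mul_one, mul_zero] at h4
    simpa [Fin.val_inj] using h4
  simpa using hli.fintype_card_le_finrank

/-- The decomposition into simultaneous generalized eigenspaces. -/
theorem isInternal_iInf_maxGenEigenspace [DecidableEq Ψ] :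
    DirectSum.IsInternal (fun i => (⨅ a : E, (ρ a).maxGenEigenspace (ψ i a) : Submodule Λ D)) ∧
      ∀ i, Module.finrank Λ (⨅ a : E, (ρ a).maxGenEigenspace (ψ i a) : Submodule Λ D) = d i := by
  have : Module.Finite Λ D := Module.Finite.of_basis t
  refine iSupIndep.bijective_of_finrank ?_
    (H.le_finrank_iInf_maxGenEigenspace hd hsum ρ hρ e t ht) ?_
  -- The operators commute and the `ψ i` are pairwise distinct, so the simultaneous eigenspaces are
  -- independent.
  · have h1 := Module.End.independent_iInf_maxGenEigenspace_of_forall_mapsTo (fun a : E => ρ a)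
      (fun a b φ => Module.End.mapsTo_maxGenEigenspace_of_comm
        ((Commute.all b a).map ρ) φ)
    exact h1.comp (f := fun i a => ψ i a) fun i j hij =>
      H.injective (RingHom.ext fun a => congrFun hij a)
  · rw [hsum, Module.finrank_eq_card_basis e, Module.finrank_eq_card_basis t]

end IsExpansionFamily
end

/-! ### Integral structures: clearing denominators and the lattices `H^ψ(M, R)`. -/

noncomputable section

section Denominators

variable {R : Type*} [CommRing R] [IsDomain R] {L : Type*} [Field L] [Algebra R L]
  [IsFractionRing R L] {N : Type*} [AddCommGroup N] [Module R N] {D : Type*} [AddCommGroup D]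
  [Module L D] (j : N →ₛₗ[algebraMap R L] D)

theorem exists_smul_eq_of_mem_span {y : D} (hy : y ∈ Submodule.span L (Set.range j)) :
    ∃ s : R, s ≠ 0 ∧ ∃ x, algebraMap R L s • y = j x := by
  induction hy using Submodule.span_induction with
  | mem y hy =>
    obtain ⟨x, rfl⟩ := hy
    exact ⟨1, one_ne_zero, x, by rw [map_one, one_smul]⟩
  | zero => exact ⟨1, one_ne_zero, 0, by rw [smul_zero, map_zero]⟩
  | add y y' _ _ h h' =>
    obtain ⟨s, hs, x, hx⟩ := h
    obtain ⟨s', hs', x', hx'⟩ := h'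
    refine ⟨s * s', mul_ne_zero hs hs', s' • x + s • x', ?_⟩
    rw [map_add, map_smulₛₗ, map_smulₛₗ, ← hx, ← hx', smul_add, map_mul, smul_smul, smul_smul,
      mul_comm (algebraMap R L s')]
  | smul c y _ h =>
    obtain ⟨s, hs, x, hx⟩ := h
    obtain ⟨a, b, hb, rfl⟩ := IsFractionRing.div_surjective (A := R) c
    have hb0 := nonZeroDivisors.ne_zero hb
    have hb' : algebraMap R L b ≠ 0 := by
      simpa using (IsFractionRing.injective R L).ne hb0
    refine ⟨b * s, mul_ne_zero hb0 hs, a • x, ?_⟩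
    rw [map_smulₛₗ, ← hx, smul_smul, smul_smul, map_mul]
    congr 1
    field_simp

theorem BaseChange.mem_span_range_mk {A B : Type*} [CommRing A] [CommRing B] (f : A →+* B)
    {M : Type*} [AddCommGroup M] [Module A M] (x : BaseChange f M) :
    x ∈ Submodule.span B (Set.range (mk f : M → BaseChange f M)) :=
  BaseChange.induction f (p := fun x => x ∈ Submodule.span B (Set.range (mk f)))
    (fun b m => Submodule.smul_mem _ _ (Submodule.subset_span (Set.mem_range_self m)))
    (fun _ _ => Submodule.add_mem _) x

theorem Module.End.maxGenEigenspace_smul {K V : Type*} [Field K] [AddCommGroup V] [Module K V]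
    {c : K} (hc : c ≠ 0) (f : Module.End K V) (μ : K) :
    (c • f).maxGenEigenspace (c * μ) = f.maxGenEigenspace μ := by
  ext x
  rw [Module.End.mem_maxGenEigenspace, Module.End.mem_maxGenEigenspace]
  refine exists_congr fun n => ?_
  rw [mul_smul, ← smul_sub, smul_pow, LinearMap.smul_apply, smul_eq_zero_iff_right (pow_ne_zero n hc)]

end Denominators

namespace LocalShtuka

variable {k : Type*} [Field k] [Fintype k] {R : Type*} [CommRing R] [IsDomain R]
  [IsDiscreteValuationRing R]
  [IsAdicComplete (IsLocalRing.maximalIdeal R) R] [Algebra k R] {P : CharPoint R}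
  {L : Type*} [Field L] [Algebra R L] [IsFractionRing R L]

section lattice

variable (M : LocalShtuka k P)

variable (L) in
theorem deRhamRtoL_injective : Function.Injective (M.deRhamRtoL L) := by
  let b := BaseChange.basis (sigmaHat k R) (Module.finBasis R⟦X⟧ M.carrier)
  intro x y hxy
  apply (BaseChange.basis (evalZeta P) b).repr.injective
  ext i
  apply IsFractionRing.injective R L
  refine (BaseChange.basis_repr_along (evalZeta P) (algebraMap R L) _ rfl b x i).symm.trans ?_
  refine Eq.trans ?_ (BaseChange.basis_repr_along (evalZeta P) (algebraMap R L) _ rfl b y i)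
  exact congrArg (fun z => (BaseChange.basis _ b).repr z i) hxy

variable (L) in
theorem span_range_deRhamRtoL (x : M.deRhamL L) :
    x ∈ Submodule.span L (Set.range (M.deRhamRtoL L)) := by
  refine Submodule.span_mono ?_ (BaseChange.mem_span_range_mk _ x)
  rintro _ ⟨m, rfl⟩
  exact ⟨BaseChange.mk _ m, BaseChange.along_mk _ _ _ _⟩

variable (L) in
theorem deRhamRtoL_endPullback (f : M.End) (x : M.deRhamR) :
    M.deRhamRtoL L (M.endPullback (evalZeta P) f x) =
      M.endPullback ((algebraMap R L).comp (evalZeta P)) f (M.deRhamRtoL L x) := by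
  refine BaseChange.induction (evalZeta P) (p := fun x => M.deRhamRtoL L
    (M.endPullback (evalZeta P) f x) = M.endPullback ((algebraMap R L).comp (evalZeta P)) f
      (M.deRhamRtoL L x)) (fun b m => ?_) (fun x y hx hy => ?_) x
  · rw [map_smul, map_smulₛₗ, map_smulₛₗ, map_smul]
    rfl
  · simp only [map_add, hx, hy]

instance : Module.Finite R M.deRhamR :=
  Module.Finite.of_basis (BaseChange.basis (evalZeta P)
    (BaseChange.basis (sigmaHat k R) (Module.finBasis R⟦X⟧ M.carrier)))

instance : Module.Free R M.deRhamR :=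
  Module.Free.of_basis (BaseChange.basis (evalZeta P)
    (BaseChange.basis (sigmaHat k R) (Module.finBasis R⟦X⟧ M.carrier)))

instance : Module.Finite L (M.deRhamL L) :=
  Module.Finite.of_basis (BaseChange.basis _
    (BaseChange.basis (sigmaHat k R) (Module.finBasis R⟦X⟧ M.carrier)))

/-- The characteristic polynomial is monic with coefficients in `R`, because `f` preserves the
lattice `H¹_dR(M, R)`; and `R` is integrally closed. -/
theorem mem_range_of_hasEigenvalue (f : M.End) {r : L}
    (h : (M.endPullback ((algebraMap R L).comp (evalZeta P)) f).HasEigenvalue r) :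
    r ∈ (algebraMap R L).range := by
  let b := BaseChange.basis (sigmaHat k R) (Module.finBasis R⟦X⟧ M.carrier)
  let φ := BaseChange.map (sigmaHat k R) f.1
  have h1 := (Module.End.hasEigenvalue_iff_isRoot_charpoly _ r).1 h
  have h2 : (M.endPullback ((algebraMap R L).comp (evalZeta P)) f).charpoly =
      ((LinearMap.toMatrix b b φ).map (evalZeta P)).charpoly.map (algebraMap R L) := by
    rw [← Matrix.charpoly_map, ← LinearMap.charpoly_toMatrix _ (BaseChange.basis _ b)]
    congr 1
    exact BaseChange.toMatrix_map _ b φ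
  have h3 : IsIntegral R r := by
    refine ⟨_, Matrix.charpoly_monic ((LinearMap.toMatrix b b φ).map (evalZeta P)), ?_⟩
    rw [← Polynomial.eval_map, ← h2]
    exact h1
  exact IsIntegrallyClosed.isIntegral_iff.1 h3

end lattice

namespace CM

variable {E : Type*} [CommRing E] [Algebra k⸨X⸩ E] [Module.Finite k⸨X⸩ E]
  {M : LocalShtuka k P} (C : M.CM E)

theorem actionL_algebraMap (a : k⸨X⸩) : C.actionL L (algebraMap k⸨X⸩ E a) =
    algebraMap L _ (gamma k L P a) :=
  (congrArg (M.qEndL L) (C.ι.commutes a)).trans (M.qEndPullback_algebraMap _ _ (gamma_algebraMap L P) a)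

theorem actionL_eq {a : E} {f : M.End} (h : C.ι a = 1 ⊗ₜ f) : C.actionL L a =
    M.endPullback ((algebraMap R L).comp (evalZeta P)) f :=
  (congrArg (M.qEndL L) h).trans (M.qEndPullback_one_tmul _ _ (gamma_algebraMap L P) f)

theorem HPsiRtoL_mk (ψ : Emb k E (gamma k L P)) (x : C.HPsiR ψ) :
    C.HPsiRtoL ψ (BaseChange.mk _ x) = M.deRhamRtoL L x.1 := BaseChange.extend_mk _ _ _

theorem HPsiRtoL_injective (ψ : Emb k E (gamma k L P)) : Function.Injective (C.HPsiRtoL ψ) := by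
  rw [injective_iff_map_eq_zero]
  intro x hx
  obtain ⟨s, hs, ω, h⟩ := exists_smul_eq_of_mem_span _
    (BaseChange.mem_span_range_mk (algebraMap R L) x)
  have hs' : algebraMap R L s ≠ 0 := by simpa using (IsFractionRing.injective R L).ne hs
  have h1 : C.HPsiRtoL ψ (algebraMap R L s • x) = 0 := by rw [map_smul, hx, smul_zero]
  rw [h, HPsiRtoL_mk, map_eq_zero_iff _ (M.deRhamRtoL_injective L)] at h1
  rw [show ω = 0 from Subtype.ext h1, map_zero] at h
  exact (smul_eq_zero_iff_right hs').1 h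

section decomposition

variable [IsSemisimpleRing E]
  (hemb : ∀ (ψ : Emb k E ((algebraMap L (AlgebraicClosure L)).comp (gamma k L P))) (a : E),
      ψ.1 a ∈ (algebraMap L (AlgebraicClosure L)).range)

include hemb

open Classical in
theorem isInternal_genEigenspace : DirectSum.IsInternal (fun ψ => C.genEigenspace (L := L) ψ) ∧
    ∀ ψ, Module.finrank L (C.genEigenspace (L := L) ψ) = insepDegree ψ := by
  obtain ⟨p, hp⟩ := CharP.exists k
  have : Fact p.Prime := ⟨CharP.char_is_prime k p⟩
  have := LaurentSeries.charP (k := k) (p := p)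
  have : CharP L p := charP_of_injective_ringHom (gamma k L P).injective p
  have := Fintype.ofFinite (Emb k E (PowerSeries.constantCoeff.comp (qToSeries k L P)))
  choose y hy using fun ψ : Emb k E (gamma k L P) =>
    exists_notPow (p := p) (q := qToSeries k L P) ψ
  let Θ := fun ψ => (nonempty_expansion p (hy ψ)).some
  have H := isExpansionFamily (q := qToSeries k L P) fun ψ => (Θ ψ).isExpansion
  obtain ⟨e, -, v, t, ht⟩ := C.exists_generator L
  exact H.isInternal_iInf_maxGenEigenspace
    (fun ψ => X_pow_insepDegree_dvd (q := qToSeries k L P) (ψ := ψ) p (qToSeries_X L) (Θ ψ).map_C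
      (Θ ψ).constantCoeff_map)
    (sum_insepDegree hemb) (C.actionL L) C.actionL_algebraMap e t ht

omit hemb [IsSemisimpleRing E] in
theorem insepDegree_ne_zero (ψ : Emb k E (gamma k L P)) : insepDegree ψ ≠ 0 := by
  have := ψ.isMaximal_ker
  let : Field (CM.Factor ψ) := Ideal.Quotient.field _
  have hd : CM.insepDegree ψ = Field.finInsepDegree k⸨X⸩ (CM.Factor ψ) := rfl
  rw [hd]
  exact NeZero.ne _

theorem genEigenspace_ne_bot (ψ : Emb k E (gamma k L P)) : C.genEigenspace ψ ≠ ⊥ := by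
  intro h
  have h1 := (C.isInternal_genEigenspace hemb).2 ψ
  rw [h, finrank_bot] at h1
  exact insepDegree_ne_zero ψ h1.symm

/-- The generalized `ψ`-eigenspace has dimension the inseparability degree, so it is nonzero and
`ψ(a)` is an eigenvalue of an endomorphism defined over `R`. -/
theorem apply_mem_range (ψ : Emb k E (gamma k L P)) (a : E) (f : M.End) (h : C.ι a = 1 ⊗ₜ f) :
    ψ.1 a ∈ (algebraMap R L).range := by
  refine M.mem_range_of_hasEigenvalue f ?_
  rw [← C.actionL_eq h]
  refine Module.End.HasUnifEigenvalue.lt (k := ⊤) (m := 1) (by simp) fun hbot => ?_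
  exact C.genEigenspace_ne_bot hemb ψ (eq_bot_iff.2 ((iInf_le _ a).trans hbot.le))

/-- The lattice tests only `a ∈ E ∩ End_R(M)`, but every `a ∈ E` has a multiple `s a` of this kind
with `s ≠ 0` in `A_v`. Scaling by `γ(s) ≠ 0` does not change the generalized eigenspace. -/
theorem mem_HPsiR_iff (ψ : Emb k E (gamma k L P)) (x : M.deRhamR) :
    x ∈ C.HPsiR ψ ↔ M.deRhamRtoL L x ∈ C.genEigenspace ψ := by
  have key : ∀ (a : E) (f : M.End) (r : R), C.ι a = 1 ⊗ₜ f → algebraMap R L r = ψ.1 a →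
      (x ∈ (M.endPullback (evalZeta P) f).maxGenEigenspace r ↔
        M.deRhamRtoL L x ∈ (C.actionL L a).maxGenEigenspace (ψ.1 a)) := by
    intro a f r hf hr
    rw [Module.End.mem_maxGenEigenspace, Module.End.mem_maxGenEigenspace]
    refine exists_congr fun n => ?_
    have h1 : ∀ (n : ℕ) (x : M.deRhamR),
        M.deRhamRtoL L (((M.endPullback (evalZeta P) f - r • 1) ^ n) x) =
          ((C.actionL L a - ψ.1 a • 1) ^ n) (M.deRhamRtoL L x) := by
      intro n
      induction n with
      | zero => intro x; rfl
      | succ n ih =>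
        intro x
        rw [pow_succ, pow_succ, Module.End.mul_apply, Module.End.mul_apply, ih]
        congr 1
        rw [LinearMap.sub_apply, LinearMap.sub_apply, map_sub, deRhamRtoL_endPullback,
          C.actionL_eq hf, LinearMap.smul_apply, LinearMap.smul_apply, map_smulₛₗ, hr]
        rfl
    rw [← h1, map_eq_zero_iff _ (M.deRhamRtoL_injective L)]
  simp only [HPsiR, genEigenspace, Submodule.mem_iInf]
  constructor
  · intro h a
    obtain ⟨s, hs, f, hf⟩ := C.exists_smul_mem_end a
    obtain ⟨r, hr⟩ := C.apply_mem_range hemb ψ _ f hf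
    have h1 := (key _ f r hf hr).1 (h _ f r hf hr)
    have hc : gamma k L P (algebraMap k⟦X⟧ k⸨X⸩ s) ≠ 0 := by
      rw [map_ne_zero_iff _ (gamma k L P).injective]
      simpa using (IsFractionRing.injective k⟦X⟧ k⸨X⸩).ne hs
    rw [← Module.End.maxGenEigenspace_smul hc]
    have h2 : C.actionL L (algebraMap k⟦X⟧ k⸨X⸩ s • a) =
        gamma k L P (algebraMap k⟦X⟧ k⸨X⸩ s) • C.actionL L a := by
      rw [Algebra.smul_def, map_mul, actionL_algebraMap, ← Algebra.smul_def]
    have h3 : ψ.1 (algebraMap k⟦X⟧ k⸨X⸩ s • a) =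
        gamma k L P (algebraMap k⟦X⟧ k⸨X⸩ s) * ψ.1 a := by
      rw [Algebra.smul_def, map_mul]
      exact congrArg (· * _) (RingHom.congr_fun ψ.2 _)
    rw [← h2, ← h3]
    exact h1
  · intro h a f r hf hr
    exact (key a f r hf hr).2 (h a)

/-- Every vector of the eigenspace has a nonzero `R`-multiple in `H¹_dR(M, R)`, and this multiple is
still in the eigenspace. -/
theorem range_HPsiRtoL (ψ : Emb k E (gamma k L P)) :
    LinearMap.range (C.HPsiRtoL ψ) = C.genEigenspace ψ := by
  ext y
  constructor
  · rintro ⟨x, rfl⟩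
    refine BaseChange.induction (algebraMap R L)
      (p := fun x => C.HPsiRtoL ψ x ∈ C.genEigenspace ψ) (fun b m => ?_) (fun x y hx hy => ?_) x
    · rw [map_smul, HPsiRtoL_mk]
      exact Submodule.smul_mem _ _ ((C.mem_HPsiR_iff hemb ψ _).1 m.2)
    · rw [map_add]
      exact Submodule.add_mem _ hx hy
  · intro hy
    obtain ⟨s, hs, ω, h⟩ := exists_smul_eq_of_mem_span _ (M.span_range_deRhamRtoL L y)
    have hs' : algebraMap R L s ≠ 0 := by simpa using (IsFractionRing.injective R L).ne hs
    have hω : ω ∈ C.HPsiR ψ := by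
      rw [C.mem_HPsiR_iff hemb, ← h]
      exact Submodule.smul_mem _ _ hy
    refine ⟨(algebraMap R L s)⁻¹ • BaseChange.mk _ ⟨ω, hω⟩, ?_⟩
    rw [map_smul, HPsiRtoL_mk, ← h, inv_smul_smul₀ hs']

theorem free_HPsiR (ψ : Emb k E (gamma k L P)) :
    Module.Free R (C.HPsiR ψ) ∧ Module.Finite R (C.HPsiR ψ) ∧
      Module.finrank R (C.HPsiR ψ) = insepDegree ψ := by
  -- A submodule of a finite free module over a discrete valuation ring is finite free; its rank is
  -- read off after tensoring with `L`.
  have h1 : Module.Finite R (C.HPsiR ψ) := inferInstance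
  have h2 : Module.Free R (C.HPsiR ψ) := inferInstance
  refine ⟨h2, h1, ?_⟩
  rw [← (C.isInternal_genEigenspace hemb).2 ψ, ← C.range_HPsiRtoL hemb,
    LinearMap.finrank_range_of_inj (C.HPsiRtoL_injective ψ),
    Module.finrank_eq_card_basis (BaseChange.basis (algebraMap R L)
      (Module.Free.chooseBasis R (C.HPsiR ψ))), Module.finrank_eq_card_chooseBasisIndex]

open Classical in
theorem bijective_toModule_HPsiRtoL : Function.Bijective (DirectSum.toModule L
    (Emb k E (gamma k L P)) (M.deRhamL L) (fun ψ => C.HPsiRtoL ψ)) := by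
  have h := (C.isInternal_genEigenspace hemb).1
  let g : ∀ ψ : Emb k E (gamma k L P),
      BaseChange (algebraMap R L) (C.HPsiR ψ) ≃ₗ[L] C.genEigenspace ψ := fun ψ =>
    LinearEquiv.ofInjective _ (C.HPsiRtoL_injective ψ) ≪≫ₗ
      LinearEquiv.ofEq _ _ (C.range_HPsiRtoL hemb ψ)
  have h1 : DirectSum.toModule L (Emb k E (gamma k L P)) (M.deRhamL L) (fun ψ => C.HPsiRtoL ψ) =
      (DirectSum.coeLinearMap fun ψ => C.genEigenspace ψ) ∘ₗ
        (DFinsupp.mapRange.linearEquiv g).toLinearMap := by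
    refine DirectSum.linearMap_ext _ fun ψ => LinearMap.ext fun x => ?_
    rw [LinearMap.comp_apply, LinearMap.comp_apply, LinearMap.comp_apply, DirectSum.toModule_lof]
    refine Eq.trans ?_ (congrArg (DirectSum.coeLinearMap fun ψ => C.genEigenspace ψ)
      (DFinsupp.mapRange_single (f := fun ψ => g ψ) (hf := fun ψ => map_zero (g ψ))).symm)
    exact (DirectSum.coeLinearMap_lof (fun ψ => C.genEigenspace ψ) ψ (g ψ x)).symm
  rw [h1, LinearMap.coe_comp]
  exact Function.Bijective.comp h (DFinsupp.mapRange.linearEquiv g).bijective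

end decomposition

end CM

end LocalShtuka
end

theorem proposition3p6 {k : Type*} [Field k] [Fintype k]
    {R : Type*} [CommRing R] [IsDomain R] [IsDiscreteValuationRing R]
    [IsAdicComplete (IsLocalRing.maximalIdeal R) R] [Finite (IsLocalRing.ResidueField R)]
    [Algebra k R] (P : CharPoint R)
    (L : Type*) [Field L] [Algebra R L] [IsFractionRing R L]
    (M : LocalShtuka k P)
    (E : Type*) [CommRing E] [Algebra k⸨X⸩ E] [Module.Finite k⸨X⸩ E] [IsSemisimpleRing E]
    (C : M.CM E) :
    -- `R` is a complete discrete valuation ring over `k = 𝔽_v` with finite residue field and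
    -- fraction field `L`; the local shtuka `M` over `R` has complex multiplication by `E`.
    -- `H¹_v(M, Q_v)` is free of rank one over `E`
    Nonempty (C.tate L ≃ₗ[E] E) ∧
    -- `H¹_dR(M, L⟦z-ζ⟧)` is free of rank one over `E ⊗ L⟦z-ζ⟧`
    Nonempty (C.deRham L ≃ₗ[LocalShtuka.CM.ESeries k P E L] LocalShtuka.CM.ESeries k P E L) ∧
    -- if `L` contains `ψ(E)` for every `Q_v`-homomorphism `ψ` to an algebraic closure
    ((∀ (ψ : LocalShtuka.Emb k E
          ((algebraMap L (AlgebraicClosure L)).comp (LocalShtuka.gamma k L P))) (a : E),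
        ψ.1 a ∈ (algebraMap L (AlgebraicClosure L)).range) →
      -- for every choice of uniformizers, `E ⊗ L⟦z-ζ⟧ = ∏_ψ L⟦y-ψ(y)⟧`, and this induces
      -- `H¹_dR(M, L⟦z-ζ⟧) = ∏_ψ H^ψ(M, L⟦y-ψ(y)⟧)` with factors free of rank one
      (∀ y : (ψ : LocalShtuka.Emb k E (LocalShtuka.gamma k L P)) → LocalShtuka.CM.Factor ψ,
        (∀ ψ, LocalShtuka.CM.IsUniformizer k (y ψ)) →
        ∃ Θ : ∀ ψ, LocalShtuka.CM.Expansion ψ (y ψ),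
          (∀ Θ' : ∀ ψ, LocalShtuka.CM.Expansion ψ (y ψ), Θ' = Θ) ∧
          Function.Bijective (fun (x : LocalShtuka.CM.ESeries k P E L) ψ => (Θ ψ).toRingHom x) ∧
          Function.Bijective
            (fun (ω : C.deRham L) ψ => (BaseChange.mk (Θ ψ).toRingHom ω : C.HPsiSeries (Θ ψ))) ∧
          ∀ ψ, Nonempty (C.HPsiSeries (Θ ψ) ≃ₗ[L⟦X⟧] L⟦X⟧)) ∧
      -- for `a` in `E ∩ End_R(M)` the element `ψ(a)` lies in `R`
      (∀ (ψ : LocalShtuka.Emb k E (LocalShtuka.gamma k L P)) (a : E) (f : M.End), C.ι a = 1 ⊗ₜ f →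
        ψ.1 a ∈ (algebraMap R L).range) ∧
      -- `H¹_dR(M, L) = ⨁_ψ H^ψ(M, R) ⊗_R L`, the decomposition into generalized eigenspaces
      (open Classical in Function.Bijective (DirectSum.toModule L
        (LocalShtuka.Emb k E (LocalShtuka.gamma k L P)) (M.deRhamL L)
        (fun ψ => C.HPsiRtoL ψ))) ∧
      (∀ ψ : LocalShtuka.Emb k E (LocalShtuka.gamma k L P),
        LinearMap.range (C.HPsiRtoL ψ) = C.genEigenspace ψ) ∧
      -- `H^ψ(M, R)` is free of rank equal to the inseparability degree of `E_{i(ψ)}` over `Q_v`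
      ∀ ψ : LocalShtuka.Emb k E (LocalShtuka.gamma k L P),
        Module.Free R (C.HPsiR ψ) ∧ Module.Finite R (C.HPsiR ψ) ∧
        Module.finrank R (C.HPsiR ψ) = LocalShtuka.CM.insepDegree ψ) := by
  refine ⟨C.tate_equiv L, C.deRham_equiv L, fun hemb =>
    ⟨C.exists_expansion_decomposition hemb, C.apply_mem_range hemb,
      ?_, C.range_HPsiRtoL hemb, C.free_HPsiR hemb⟩⟩
  exact C.bijective_toModule_HPsiRtoL hemb
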